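/- Let $p$ be a prime number and $G$ a $p$-adic Lie group with Lie algebra $\mathfrak g$. A one-parameter morphism of $G$ is a continuous group morphism $\varphi:\mathbb Q_p\to G$; let $\mathfrak g_G\subset\mathfrak g$ be the set of derivatives (at $0$) of one-parameter morphisms of $G$. The group $G$ is weakly regular if any two one-parameter morphisms of $G$ with the same derivative are equal. An element $g$ of a $p$-adic Lie group admits a logarithm if $g^{p^n}\to e$ as $n\to\infty$; then $\log(g)$ is the derivative at $0$ of the continuous morphism $\mathbb Z_p\to G$ extending $n\mapsto g^n$. A $p$-adic Lie group $N$ is algebraic unipotent if its Lie algebra $\mathfrak n$ is nilpotent, every element of $N$ admits a logarithm, and $\log:N\to\mathfrak n$ is a bijection. **Proposition 2.5** (Ratner). Let $G$ be a weakly regular $p$-adic Lie group and let $\mathfrak n\subset\mathfrak g$ be a nilpotent Lie subalgebra. Then the set $\mathfrak n_G:=\mathfrak n\cap\mathfrak g_G$ is an ideal of $\mathfrak n$, and there exists an algebraic unipotent (closed Lie) subgroup $N_G$ of $G$ whose Lie algebra is $\mathfrak n_G$. -/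

import Mathlib

open scoped Manifold ContDiff Topology

noncomputable section

namespace PadicLie

variable (p : ℕ) [Fact p.Prime]

/-- The model of `m`-dimensional `p`-adic manifolds: charts take values in `ℚ_p ^ m`. A `p`-adic
Lie group of dimension `m` is a group `G` with `[TopologicalSpace G]`,
`[ChartedSpace (Fin m → ℚ_[p]) G]` and `[LieGroup (model p m) ω G]`, where `ω` means that the
manifold structure and the group operations are analytic. -/
abbrev model (m : ℕ) : ModelWithCorners ℚ_[p] (Fin m → ℚ_[p]) (Fin m → ℚ_[p]) :=
  𝓘(ℚ_[p], Fin m → ℚ_[p])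

section Group

variable (m : ℕ) (G : Type*) [TopologicalSpace G] [ChartedSpace (Fin m → ℚ_[p]) G] [Group G]

/-- The Lie algebra of a `p`-adic Lie group: its tangent space at the identity, with the bracket
of left invariant vector fields. -/
abbrev LieAlg : Type := GroupLieAlgebra (model p m) G

/-- A one-parameter morphism of `G`: a continuous group morphism `ℚ_p → G`. -/
abbrev OneParameterMorphism : Type _ := Multiplicative ℚ_[p] →ₜ* G

variable {m G}

/-- The function `f`, defined near `0` in `ℚ_p` and with `f 0 = 1`, is differentiable at `0` with
derivative the vector `X` of the Lie algebra. -/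
def HasDerivativeAtZero (f : ℚ_[p] → G) (X : LieAlg p m G) : Prop :=
  f 0 = 1 ∧
    HasMFDerivAt 𝓘(ℚ_[p], ℚ_[p]) (model p m) f 0
      (ContinuousLinearMap.toSpanSingleton ℚ_[p] (M₁ := Fin m → ℚ_[p]) X)

/-- `X` is the derivative of the one-parameter morphism `φ`. -/
def OneParameterMorphism.HasDerivative (φ : OneParameterMorphism p G) (X : LieAlg p m G) : Prop :=
  HasDerivativeAtZero p (fun t : ℚ_[p] => φ (Multiplicative.ofAdd t)) X

variable (m G)

/-- Two one-parameter morphisms of `G` with the same derivative are equal. -/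
def IsWeaklyRegular : Prop :=
  ∀ (φ ψ : OneParameterMorphism p G) (X : LieAlg p m G),
    φ.HasDerivative p X → ψ.HasDerivative p X → φ = ψ

/-- The set `𝔤_G` of derivatives of one-parameter morphisms of `G`. -/
def oneParameterDerivatives : Set (LieAlg p m G) :=
  {X | ∃ φ : OneParameterMorphism p G, φ.HasDerivative p X}

variable {G}

/-- `g` admits a logarithm: `g ^ (p ^ n)` tends to the identity. -/
def AdmitsLog (g : G) : Prop :=
  Filter.Tendsto (fun n : ℕ => g ^ (p ^ n)) Filter.atTop (𝓝 1)

/-- `X` is the derivative at `0` of a continuous morphism `ℤ_p → G` extending `n ↦ g ^ n`. Here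
`ℤ_p` is the unit ball of `ℚ_p`, a neighbourhood of `0`; the value `1` off that ball plays
no role. -/
def IsLog (g : G) (X : LieAlg p m G) : Prop :=
  ∃ γ : Multiplicative ℤ_[p] →ₜ* G, γ (Multiplicative.ofAdd 1) = g ∧
    HasDerivativeAtZero p
      (fun t : ℚ_[p] => if h : ‖t‖ ≤ 1 then γ (Multiplicative.ofAdd (⟨t, h⟩ : ℤ_[p])) else 1) X

/-- The logarithm `log g` of an element `g` that admits one (an arbitrary vector otherwise). -/
def log (g : G) : LieAlg p m G :=
  Classical.epsilon fun X : LieAlg p m G => IsLog p m g X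

variable (G)

/-- A `p`-adic Lie group is algebraic unipotent if its Lie algebra is nilpotent, every element
admits a logarithm, and the logarithm is a bijection onto the Lie algebra. -/
structure IsAlgebraicUnipotent [LieGroup (model p m) ω G] : Prop where
  isNilpotent : LieRing.IsNilpotent (LieAlg p m G)
  admitsLog : ∀ g : G, AdmitsLog p g
  bijective_log : Function.Bijective (log p m : G → LieAlg p m G)

end Group

section Subgroup

variable {m : ℕ} {G : Type*} [TopologicalSpace G] [ChartedSpace (Fin m → ℚ_[p]) G] [Group G]

/-- A closed subgroup `N` of `G`, with its induced topology and an atlas of dimension `d`, is a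
`p`-adic Lie subgroup: it is a `p`-adic Lie group and its inclusion in `G` is an
analytic immersion. -/
structure IsLieSubgroup (N : Subgroup G) (d : ℕ) [ChartedSpace (Fin d → ℚ_[p]) N] : Prop where
  isClosed : IsClosed (N : Set G)
  lieGroup : LieGroup (model p d) ω N
  contMDiff_coe : ContMDiff (model p d) (model p m) ω (fun g : N => (g : G))
  injective_mfderiv :
    Function.Injective (mfderiv (model p d) (model p m) (fun g : N => (g : G)) 1)

/-- The Lie algebra of the Lie subgroup `N`, seen in the Lie algebra of `G`: the image of the
tangent map at the identity of the inclusion. -/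
def subgroupLieAlg (N : Subgroup G) (d : ℕ) [ChartedSpace (Fin d → ℚ_[p]) N] :
    Set (LieAlg p m G) :=
  {X | ∃ Y : LieAlg p d N,
    mfderiv (model p d) (model p m) (fun g : N => (g : G)) 1 Y = X}

/-- `N` is an algebraic unipotent (Lie) subgroup of `G` with Lie algebra `𝔪`. -/
def IsAlgebraicUnipotentSubgroup (N : Subgroup G) (𝔪 : Set (LieAlg p m G)) : Prop :=
  ∃ (d : ℕ) (_ : ChartedSpace (Fin d → ℚ_[p]) N) (h : IsLieSubgroup p (m := m) N d),
    haveI := h.lieGroup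
    IsAlgebraicUnipotent p d N ∧ subgroupLieAlg p N d = 𝔪

end Subgroup

end PadicLie

end

/-!
For a `p`-adic Lie group `G`, let `𝔤_G` be the set of derivatives of one-parameter morphisms
`ℚ_p → G`. The proof builds closed subgroups of `G` from one-parameter morphisms, one dimension at
a time, along a flag of the nilpotent Lie algebra.

*Local theory.* In coordinates at the identity, the exponential is the solution of the radial
differential equation `f'(x) x = V(f(x)) x`, where `V(x)` is the derivative at `1` of the left
translation by `x`. It is solved by a power series, whose coefficients satisfy a bound of the form
`‖a_k‖ ≤ C ^ k / ‖k!‖` because the norms are ultrametric (`exists_radial_solution`). Its solutions are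
compared by means of one observation: an analytic function of one variable whose derivative is
bounded by itself vanishes, since its order of vanishing cannot drop
(`eventuallyEq_zero_of_deriv_isBigO`). It gives the additivity of the exponential along lines
(`exists_exp`), and shows that `Ad (γ t)` preserves the subspaces preserved by `ad X`, for a local
one-parameter subgroup `γ` tangent to `X` (`IsLocalOneParam.eventually_Ad_sub_mem`). The derivative
of `Ad` at the identity is the bracket of left invariant vector fields (`ad_apply`). A closed
subgroup which is the image of an analytic immersion near the identity is a Lie subgroup
(`IsLocalParam.exists_isLieSubgroup`).

*Unipotent lists.* A list of one-parameter morphisms is unipotent when each of them normalises the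
subgroup generated by the subsequent ones, meets it trivially, and acts on it unipotently. The
subgroup `N` generated by such a list has unique `p`-th roots
(`IsUnipotentList.existsUnique_root`), and `g ^ (p ^ n) → 1` for `g ∈ N`
(`IsUnipotentList.exists_pow_mem`). Thanks to the unique roots, any local one-parameter subgroup of
`N` extends to `ℚ_p` (`HasUniqueRoots.exists_oneParameterMorphism`), so that the whole Lie algebra
of `N` lies in `𝔤_G`; they also make the logarithm of `N` a bijection
(`HasUniqueRoots.bijective_log`).

*Flags.* Let `Y₁, …, Y_d ∈ 𝔤_G` be linearly independent vectors, such that `ad Y_i` sends each later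
`Y_j` to the span of the vectors after `Y_j`. The corresponding one-parameter morphisms form a
unipotent list, and they generate a closed Lie subgroup whose Lie algebra is the span of the `Y_i`
(`IsFlag.hasLieAlg`). This is where weak regularity is used: to commute the morphisms `φ` and `ψ` of
two vectors `Y` and `Z` modulo the subgroup `N` of the subsequent ones, the conjugate of `ψ` by
`φ t` is compared with the one-parameter morphism with the same derivative that takes values in the
subgroup generated by `N` and `ψ` (`commutator_mem_gen`).

*Conclusion.* It remains to find a flag whose span is `𝔫 ∩ 𝔤_G` (`exists_isFlag`). If
`[𝔫, 𝔫 ∩ 𝔤_G] ⊆ 𝔤_G`, a maximal flag stable under `𝔫` does it, by descending induction along the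
lower central series (`exists_isFlag_of_ad_mem`). The inclusion is obtained by induction on the
dimension of `𝔫`: for `Y ∈ 𝔫 ∩ 𝔤_G`, the ideal `𝔫' = ℚ_p Y + [𝔫, 𝔫]` is either `𝔫`, which is then
abelian, or of smaller dimension. In the second case `𝔫' ∩ 𝔤_G` is a vector space, which contains
`Ad (exp (t X)) Y` for `X ∈ 𝔫` and small `t`, and thus also the derivative `[X, Y]`.
-/

noncomputable section

namespace PadicLie

open Filter Asymptotics
open scoped Pointwise

/-! ### Analytic functions with derivative bounded by the function -/

section Analysis

variable {𝕜 : Type*} [NontriviallyNormedField 𝕜] {F : Type*} [NormedAddCommGroup F]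
  [NormedSpace 𝕜 F]

/-- A uniqueness principle for linear differential equations, in place of Gronwall's lemma: if `f`
had order of vanishing `k + 1` at `0`, then `f'` would have order `k`, and could not be `O(f)`. -/
theorem eventuallyEq_zero_of_deriv_isBigO [CharZero 𝕜] [CompleteSpace F] {f : 𝕜 → F}
    (hf : AnalyticAt 𝕜 f 0) (h0 : f 0 = 0) (h : deriv f =O[𝓝 0] f) : ∀ᶠ z in 𝓝 0, f z = 0 := by
  by_contra hne
  obtain ⟨n, g, hg, hg0, hfg⟩ := hf.exists_eventuallyEq_pow_smul_nonzero_iff.mpr hne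
  simp only [sub_zero] at hfg
  have hn : n ≠ 0 := by
    rintro rfl
    have := hfg.self_of_nhds
    simp_all
  obtain ⟨k, rfl⟩ := Nat.exists_eq_succ_of_ne_zero hn
  obtain ⟨C, hC⟩ := h.bound
  have hd : ∀ᶠ z in 𝓝 (0 : 𝕜), deriv f z = (z ^ (k + 1)) • deriv g z
      + (((k + 1 : ℕ) : 𝕜) * z ^ k) • g z := by
    filter_upwards [hfg.eventually_nhds, hg.eventually_analyticAt] with z hz hgz
    rw [Filter.EventuallyEq.deriv_eq (f := fun z => z ^ (k + 1) • g z) hz]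
    have := ((hasDerivAt_pow (k + 1) z).smul hgz.differentiableAt.hasDerivAt)
    simpa [Pi.smul_def'] using this.deriv
  have key : ∀ᶠ z in 𝓝[≠] (0 : 𝕜), ‖z • deriv g z + ((k + 1 : ℕ) : 𝕜) • g z‖
      ≤ C * (‖z‖ * ‖g z‖) := by
    filter_upwards [hfg.filter_mono nhdsWithin_le_nhds, hd.filter_mono nhdsWithin_le_nhds,
      hC.filter_mono nhdsWithin_le_nhds, self_mem_nhdsWithin] with z h1 h2 h3 h4
    have hz : 0 < ‖z‖ ^ k := pow_pos (norm_pos_iff.2 h4) _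
    have e : deriv f z = z ^ k • (z • deriv g z + ((k + 1 : ℕ) : 𝕜) • g z) := by
      rw [h2, smul_add, smul_smul, smul_smul, pow_succ, mul_comm (z ^ k) ((k + 1 : ℕ) : 𝕜)]
    rw [e, h1, norm_smul, norm_smul, norm_pow, norm_pow] at h3
    refine le_of_mul_le_mul_left (h3.trans (le_of_eq ?_)) hz
    simp only [Nat.succ_eq_add_one]
    ring
  have hgc := hg.continuousAt
  have hdc := hg.deriv.continuousAt
  have l1 : Tendsto (fun z => ‖z • deriv g z + ((k + 1 : ℕ) : 𝕜) • g z‖) (𝓝[≠] (0 : 𝕜))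
      (𝓝 ‖(0 : 𝕜) • deriv g 0 + ((k + 1 : ℕ) : 𝕜) • g 0‖) := by
    have : ContinuousAt (fun z => ‖z • deriv g z + ((k + 1 : ℕ) : 𝕜) • g z‖) 0 := by fun_prop
    exact this.tendsto.mono_left nhdsWithin_le_nhds
  have l2 : Tendsto (fun z => C * (‖z‖ * ‖g z‖)) (𝓝[≠] (0 : 𝕜)) (𝓝 (C * (‖(0 : 𝕜)‖ * ‖g 0‖))) := by
    have : ContinuousAt (fun z => C * (‖z‖ * ‖g z‖)) 0 := by fun_prop
    exact this.tendsto.mono_left nhdsWithin_le_nhds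
  have := le_of_tendsto_of_tendsto l1 l2 key
  simp only [zero_smul, zero_add, norm_zero, zero_mul, mul_zero, norm_le_zero_iff,
    smul_eq_zero, hg0, or_false] at this
  exact Nat.cast_ne_zero.2 (Nat.succ_ne_zero k) this

theorem eq_zero_on_ball_of_eventually {f : 𝕜 → F} {q : FormalMultilinearSeries 𝕜 𝕜 F}
    {r : ENNReal} (hf : HasFPowerSeriesOnBall f q 0 r) (h : ∀ᶠ z in 𝓝 0, f z = 0) {z : 𝕜}
    (hz : z ∈ Metric.eball (0 : 𝕜) r) : f z = 0 := by
  have hq : q = 0 := HasFPowerSeriesAt.eq_zero (hf.hasFPowerSeriesAt.congr (g := 0) h)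
  have := hf.hasSum hz
  rw [hq] at this
  simpa using this.unique hasSum_zero

end Analysis

/-! ### The radial differential equation -/

section RadialODE

variable {𝕜 : Type*} [NontriviallyNormedField 𝕜] {E : Type*} [NormedAddCommGroup E]
  [NormedSpace 𝕜 E]

/-- The formal power series `f` with `f 0 = 0` solving the radial equation `f'(x) x = V(f(x)) x`,
where `q` is the power series of `V`. In degree `n + 1` the equation reads
`(n + 1) f_{n+1} = (V ∘ f)_n`, and the right hand side only involves the terms of `f` of degree at
most `n`. The test `k < n + 1` is there for the recursion to be well-founded. -/
def radialSeries (q : FormalMultilinearSeries 𝕜 E (E →L[𝕜] E)) : FormalMultilinearSeries 𝕜 E E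
  | 0 => 0
  | n + 1 => ((n + 1 : ℕ) : 𝕜)⁻¹ • (continuousMultilinearCurryRightEquiv' 𝕜 n E E).symm
      (q.comp (fun k => if k < n + 1 then radialSeries q k else 0) n)

theorem radialSeries_zero (q : FormalMultilinearSeries 𝕜 E (E →L[𝕜] E)) :
    radialSeries q 0 = 0 := by rw [radialSeries]

theorem radialSeries_succ (q : FormalMultilinearSeries 𝕜 E (E →L[𝕜] E)) (n : ℕ) :
    radialSeries q (n + 1) = ((n + 1 : ℕ) : 𝕜)⁻¹ •
      (continuousMultilinearCurryRightEquiv' 𝕜 n E E).symm (q.comp (radialSeries q) n) := by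
  rw [radialSeries]
  have : q.comp (fun k => if k < n + 1 then radialSeries q k else 0) n =
      q.comp (radialSeries q) n := by
    simp only [FormalMultilinearSeries.comp]
    refine Finset.sum_congr rfl fun c _ => ?_
    ext1 v
    change q c.length (FormalMultilinearSeries.applyComposition _ c v) =
      q c.length (FormalMultilinearSeries.applyComposition _ c v)
    refine congrArg (q c.length) (funext fun i => ?_)
    simp only [FormalMultilinearSeries.applyComposition]
    rw [if_pos (Nat.lt_succ_of_le (c.blocksFun_le i))]
  rw [this]

theorem norm_sum_multilinear_le {F ι : Type*} [NormedAddCommGroup F] [NormedSpace 𝕜 F]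
    [IsUltrametricDist F] {n : ℕ} (s : Finset ι) (f : ι → E [×n]→L[𝕜] F) {C : ℝ} (hC : 0 ≤ C)
    (h : ∀ i ∈ s, ‖f i‖ ≤ C) : ‖∑ i ∈ s, f i‖ ≤ C := by
  refine ContinuousMultilinearMap.opNorm_le_bound hC fun v => ?_
  rw [sum_apply]
  refine IsUltrametricDist.norm_sum_le_of_forall_le_of_nonneg (by positivity) fun i hi => ?_
  exact (f i).le_of_opNorm_le (h i hi) v

end RadialODE

section PadicRadial

variable {p : ℕ} [Fact p.Prime] {E : Type*} [NormedAddCommGroup E] [NormedSpace ℚ_[p] E]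

theorem norm_factorial_le_prod {ι : Type*} (s : Finset ι) (c : ι → ℕ) :
    ‖((∑ i ∈ s, c i).factorial : ℚ_[p])‖ ≤ ∏ i ∈ s, ‖((c i).factorial : ℚ_[p])‖ := by
  obtain ⟨d, hd⟩ := Nat.prod_factorial_dvd_factorial_sum s c
  rw [hd]
  push_cast
  rw [norm_mul, norm_prod]
  exact mul_le_of_le_one_right (by positivity) (by exact_mod_cast Padic.norm_int_le_one (d : ℤ))

/-- Legendre's formula: the valuation of `k!` is at most `k`. -/
theorem inv_pow_le_norm_factorial (k : ℕ) : ((p : ℝ) ^ k)⁻¹ ≤ ‖(k.factorial : ℚ_[p])‖ := by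
  have hp : 1 ≤ (p : ℝ) := by exact_mod_cast (Fact.out : p.Prime).one_le
  rw [Padic.norm_eq_zpow_neg_valuation (by exact_mod_cast k.factorial_ne_zero),
    Padic.valuation_natCast, ← zpow_natCast, ← zpow_neg]
  refine zpow_le_zpow_right₀ hp ?_
  have h := sub_one_mul_padicValNat_factorial (p := p) k
  have h2 : 1 ≤ p - 1 := Nat.le_sub_one_of_lt (Fact.out : p.Prime).one_lt
  have h3 : padicValNat p k.factorial ≤ k := by nlinarith [Nat.sub_le k (p.digits k).sum]
  simpa using h3

/-- The coefficients of the radial solution are at most `M ^ (2 k) / ‖k!‖`. In the induction, the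
product of the `1 / ‖k_i!‖` over a composition of `n` is at most `1 / ‖n!‖`, since the product of
the `k_i!` divides `n!`, and the sum over all compositions costs nothing because the norm is
ultrametric. -/
theorem norm_radialSeries_le [IsUltrametricDist E]
    (q : FormalMultilinearSeries ℚ_[p] E (E →L[ℚ_[p]] E)) {M : ℝ} (hM : 1 ≤ M)
    (hq : ∀ n, ‖q n‖ ≤ M * M ^ n) (k : ℕ) (hk : 0 < k) :
    M * (‖(k.factorial : ℚ_[p])‖ * ‖radialSeries q k‖) ≤ M ^ (2 * k) := by
  induction k using Nat.strong_induction_on with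
  | _ k ih =>
  obtain ⟨n, rfl⟩ := Nat.exists_eq_succ_of_ne_zero hk.ne'
  have hM0 : 0 ≤ M := by linarith
  have aux : ∀ {A Q B N D L T : ℝ}, A ≤ Q * B → N ≤ D → L * (D * B) ≤ T → Q ≤ M * L → 0 ≤ M →
      0 ≤ B → 0 ≤ N → 0 ≤ Q → A * N ≤ M * T := by
    intro A Q B N D L T h1 h2 h3 h4 h5 h6 h7 h8
    calc A * N ≤ (Q * B) * N := by gcongr
      _ ≤ (Q * B) * D := by gcongr
      _ ≤ ((M * L) * B) * D := by gcongr; exact h7.trans h2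
      _ = M * (L * (D * B)) := by ring
      _ ≤ M * T := by gcongr
  have key : ‖((continuousMultilinearCurryRightEquiv' ℚ_[p] n E E).symm
      (q.comp (radialSeries q) n))‖ * ‖(n.factorial : ℚ_[p])‖ ≤ M * M ^ (2 * n) := by
    have hpos : 0 < ‖(n.factorial : ℚ_[p])‖ :=
      norm_pos_iff.2 (by exact_mod_cast n.factorial_ne_zero)
    rw [← le_div_iff₀ hpos]
    rw [FormalMultilinearSeries.comp, map_sum]
    refine norm_sum_multilinear_le _ _ (by positivity) fun c _ => ?_
    rw [LinearIsometryEquiv.norm_map, le_div_iff₀ hpos]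
    have h1 := FormalMultilinearSeries.compAlongComposition_norm q (radialSeries q) c
    have h2 : ‖(n.factorial : ℚ_[p])‖ ≤ ∏ i, ‖((c.blocksFun i).factorial : ℚ_[p])‖ := by
      have := norm_factorial_le_prod (p := p) Finset.univ c.blocksFun
      rwa [c.sum_blocksFun] at this
    have h3 : M ^ c.length * ∏ i, (‖((c.blocksFun i).factorial : ℚ_[p])‖ *
        ‖radialSeries q (c.blocksFun i)‖) ≤ M ^ (2 * n) := by
      have e1 : M ^ c.length = ∏ _i : Fin c.length, M := by simp
      rw [e1, ← Finset.prod_mul_distrib]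
      calc _ ≤ ∏ i, M ^ (2 * c.blocksFun i) := by
            refine Finset.prod_le_prod (fun i _ => by positivity) fun i _ => ?_
            exact ih _ (Nat.lt_succ_of_le (c.blocksFun_le i)) (c.one_le_blocksFun i)
        _ = M ^ (2 * n) := by
            rw [Finset.prod_pow_eq_pow_sum, ← Finset.mul_sum, c.sum_blocksFun]
    rw [Finset.prod_mul_distrib] at h3
    have h4 : 0 ≤ ∏ i, ‖radialSeries q (c.blocksFun i)‖ :=
      Finset.prod_nonneg fun i _ => norm_nonneg _
    exact aux h1 h2 h3 (hq _) hM0 h4 (norm_nonneg _) (norm_nonneg _)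
  have hn1 : ‖((n + 1 : ℕ) : ℚ_[p])‖ ≠ 0 := norm_ne_zero_iff.2 (by exact_mod_cast n.succ_ne_zero)
  rw [Nat.succ_eq_add_one, radialSeries_succ, norm_smul, norm_inv, Nat.factorial_succ]
  push_cast [norm_mul] at hn1 ⊢
  generalize ‖((continuousMultilinearCurryRightEquiv' ℚ_[p] n E E).symm
      (q.comp (radialSeries q) n))‖ = A at key ⊢
  calc _ = M * (A * ‖(n.factorial : ℚ_[p])‖) := by field_simp
    _ ≤ M * (M * M ^ (2 * n)) := by gcongr
    _ = _ := by ring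

theorem radialSeries_radius_pos [IsUltrametricDist E]
    (q : FormalMultilinearSeries ℚ_[p] E (E →L[ℚ_[p]] E)) (hq : 0 < q.radius) :
    0 < (radialSeries q).radius := by
  obtain ⟨C, r, hC, hr, h⟩ := q.le_mul_pow_of_radius_pos hq
  set M := max 1 (max C r) with hMdef
  have hM : 1 ≤ M := le_max_left _ _
  have hM0 : 0 < M := by linarith
  have hp : 0 < (p : ℝ) := by exact_mod_cast (Fact.out : p.Prime).pos
  have hqM : ∀ n, ‖q n‖ ≤ M * M ^ n := fun n => (h n).trans <| by
    gcongr
    · exact (le_max_left _ _).trans (le_max_right _ _)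
    · exact (le_max_right _ _).trans (le_max_right _ _)
  have hb : ∀ k, ‖radialSeries q k‖ ≤ (p * M ^ 2) ^ k := by
    intro k
    rcases Nat.eq_zero_or_pos k with rfl | hk
    · simp [radialSeries_zero]
    have h1 := norm_radialSeries_le q hM hqM k hk
    have h2 := inv_pow_le_norm_factorial (p := p) k
    have h3 : ((p : ℝ) ^ k)⁻¹ * ‖radialSeries q k‖ ≤ M ^ (2 * k) :=
      calc _ ≤ ‖(k.factorial : ℚ_[p])‖ * ‖radialSeries q k‖ := by gcongr
        _ ≤ M * (‖(k.factorial : ℚ_[p])‖ * ‖radialSeries q k‖) :=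
            le_mul_of_one_le_left (by positivity) hM
        _ ≤ _ := h1
    rw [inv_mul_le_iff₀ (by positivity)] at h3
    rwa [mul_pow, ← pow_mul]
  set r0 : NNReal := Real.toNNReal (p * M ^ 2)⁻¹
  have hr0 : (0 : ℝ) < (p * M ^ 2)⁻¹ := by positivity
  have hr1 : (r0 : ℝ) = (p * M ^ 2)⁻¹ := Real.coe_toNNReal _ hr0.le
  have := (radialSeries q).le_radius_of_bound 1 (r := r0) (fun n => by
    rw [hr1, inv_pow]
    calc _ ≤ (p * M ^ 2) ^ n * ((p * M ^ 2) ^ n)⁻¹ := by gcongr; exact hb n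
      _ = 1 := mul_inv_cancel₀ (by positivity))
  refine lt_of_lt_of_le ?_ this
  exact_mod_cast Real.toNNReal_pos.2 hr0

/-- Existence of an analytic solution of the radial equation `f'(x) x = V(f(x)) x`, tangent to the
identity. -/
theorem exists_radial_solution [IsUltrametricDist E] [CompleteSpace E] {V : E → E →L[ℚ_[p]] E}
    (hV : AnalyticAt ℚ_[p] V 0) (hV0 : V 0 = ContinuousLinearMap.id ℚ_[p] E) :
    ∃ f : E → E, AnalyticAt ℚ_[p] f 0 ∧ f 0 = 0 ∧
      HasStrictFDerivAt f (ContinuousLinearMap.id ℚ_[p] E) 0 ∧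
      ∀ᶠ x in 𝓝 0, fderiv ℚ_[p] f x x = V (f x) x := by
  obtain ⟨q, hq⟩ := hV
  set P := radialSeries q
  have hP := P.hasFPowerSeriesOnBall (radialSeries_radius_pos q hq.radius_pos)
  have hf0 : P.sum 0 = 0 := by
    have := hP.coeff_zero (fun _ => 0)
    rw [← this]
    simp [P, radialSeries_zero]
  have hcomp : HasFPowerSeriesAt (V ∘ P.sum) (q.comp P) 0 :=
    HasFPowerSeriesAt.comp (by rwa [hf0]) hP.hasFPowerSeriesAt
  have hrad : ∀ᶠ x in 𝓝 0, fderiv ℚ_[p] P.sum x x = V (P.sum x) x := by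
    obtain ⟨r, hr⟩ := hcomp
    have hd := hP.fderiv
    filter_upwards [Metric.eball_mem_nhds (0 : E) hr.r_pos,
      Metric.eball_mem_nhds (0 : E) hP.r_pos] with x hx1 hx2
    have s1 := (hr.hasSum hx1).mapL (ContinuousLinearMap.apply ℚ_[p] E x)
    have s2 := (hd.hasSum hx2).mapL (ContinuousLinearMap.apply ℚ_[p] E x)
    simp only [zero_add, ContinuousLinearMap.apply_apply] at s1 s2
    change _ = (V ∘ P.sum) x x
    refine s2.unique ?_
    convert s1 using 2 with n
    rw [FormalMultilinearSeries.derivSeries_apply_diag]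
    simp only [P]
    rw [radialSeries_succ, smul_apply, ← Nat.cast_smul_eq_nsmul ℚ_[p]]
    rw [smul_smul, mul_inv_cancel₀ (by exact_mod_cast n.succ_ne_zero), one_smul]
    rfl
  have hstrict := hP.hasFPowerSeriesAt.hasStrictFDerivAt
  refine ⟨P.sum, hP.analyticAt, hf0, ?_, hrad⟩
  convert hstrict using 1
  ext x
  simp only [P]
  rw [continuousMultilinearCurryFin1_apply, radialSeries_succ, smul_apply]
  have := hq.coeff_zero (fun _ : Fin 0 => (0 : E))
  rw [hV0] at this
  simp [FormalMultilinearSeries.comp_coeff_zero', this]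

end PadicRadial

/-! ### Coordinates at the identity -/

section Coordinates

variable (p : ℕ) [Fact p.Prime] (m : ℕ) {G : Type*} [TopologicalSpace G]
  [ChartedSpace (Fin m → ℚ_[p]) G] [Group G]

/-- The preferred chart at the identity, translated so that the identity has coordinate `0`. Its
value is arbitrary off the source of the chart, as are those of all maps in coordinates below: they
are only used near the identity. -/
def coord (g : G) : Fin m → ℚ_[p] :=
  extChartAt (model p m) (1 : G) g - extChartAt (model p m) (1 : G) 1

variable (G) in
/-- The inverse of the chart `coord`, near `0`. -/
def coordInv (x : Fin m → ℚ_[p]) : G :=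
  (extChartAt (model p m) (1 : G)).symm (extChartAt (model p m) (1 : G) 1 + x)

@[simp] theorem coord_one : coord p m (1 : G) = 0 := sub_self _

@[simp] theorem coordInv_zero : coordInv p m G 0 = 1 := by
  simp [coordInv]

theorem continuousAt_coord : ContinuousAt (coord p m : G → _) 1 :=
  (continuousAt_extChartAt (I := model p m) (1 : G)).sub continuousAt_const

theorem continuousAt_coordInv : ContinuousAt (coordInv p m G) 0 := by
  have h := continuousAt_extChartAt_symm (I := model p m) (1 : G)
  refine ContinuousAt.comp (g := (extChartAt (model p m) (1 : G)).symm) ?_ (by fun_prop)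
  simpa using h

theorem eventually_coord_coordInv : ∀ᶠ x in 𝓝 0, coord p m (coordInv p m G x) = x := by
  have h : Tendsto (fun x => extChartAt (model p m) (1 : G) 1 + x) (𝓝 0)
      (𝓝 (extChartAt (model p m) (1 : G) 1)) := by
    have : ContinuousAt (fun x => extChartAt (model p m) (1 : G) 1 + x) 0 := by fun_prop
    simpa using this.tendsto
  filter_upwards [h.eventually (extChartAt_target_mem_nhds (I := model p m) (1 : G))] with x hx
  rw [coord, coordInv, (extChartAt (model p m) (1 : G)).right_inv hx, add_sub_cancel_left]

theorem eventually_coordInv_coord : ∀ᶠ g in 𝓝 (1 : G), coordInv p m G (coord p m g) = g := by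
  filter_upwards [extChartAt_source_mem_nhds (I := model p m) (1 : G)] with g hg
  rw [coord, coordInv, add_sub_cancel, (extChartAt (model p m) (1 : G)).left_inv hg]

theorem hasDerivativeAtZero_iff {f : ℚ_[p] → G} {X : Fin m → ℚ_[p]} :
    HasDerivativeAtZero p f (X : LieAlg p m G) ↔
      f 0 = 1 ∧ ContinuousAt f 0 ∧ HasDerivAt (fun t => coord p m (f t)) X 0 := by
  unfold HasDerivativeAtZero HasMFDerivAt
  refine and_congr_right fun h0 => and_congr_right fun _ => ?_
  have hr : (Set.range (𝓘(ℚ_[p], ℚ_[p]) : ℚ_[p] → ℚ_[p])) = Set.univ := by simp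
  have h1 : writtenInExtChartAt 𝓘(ℚ_[p], ℚ_[p]) (model p m) 0 f =
      fun t => extChartAt (model p m) (1 : G) (f t) := by
    ext1 t
    simp only [writtenInExtChartAt, extChartAt_model_space_eq_id, h0]
    rfl
  rw [hr, h1]
  change HasFDerivWithinAt (E := ℚ_[p]) (F := Fin m → ℚ_[p])
    (fun t => extChartAt (model p m) (1 : G) (f t))
    (ContinuousLinearMap.toSpanSingleton ℚ_[p] X) Set.univ (0 : ℚ_[p]) ↔ _
  rw [hasFDerivWithinAt_univ, hasDerivAt_iff_hasFDerivAt]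
  exact (hasFDerivAt_sub_const_iff (extChartAt (model p m) (1 : G) 1)).symm

theorem contMDiffAt_coord : ContMDiffAt (model p m) (model p m) ω (coord p m : G → _) 1 :=
  (contMDiffAt_extChartAt (I := model p m)).sub contMDiffAt_const

variable {p m} in
theorem analyticAt_coord_comp {F : Type*} [NormedAddCommGroup F] [NormedSpace ℚ_[p] F]
    {f : F → G} {x : F} (hf : ContMDiffAt 𝓘(ℚ_[p], F) (model p m) ω f x) (hx : f x = 1) :
    AnalyticAt ℚ_[p] (fun y => coord p m (f y)) x := by
  have : ContMDiffAt 𝓘(ℚ_[p], F) (model p m) ω (fun y => coord p m (f y)) x :=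
    ContMDiffAt.comp (g := (coord p m : G → _)) x (by rw [hx]; exact contMDiffAt_coord p m) hf
  exact (contMDiffAt_iff_contDiffAt.1 this).analyticAt

section Manifold

variable [IsManifold (model p m) ω G]

theorem contMDiffAt_coordInv : ContMDiffAt (model p m) (model p m) ω (coordInv p m G) 0 := by
  have h := (contMDiffOn_extChartAt_symm (I := model p m) (n := ω) (1 : G)).contMDiffAt
    (extChartAt_target_mem_nhds (I := model p m) (1 : G))
  refine ContMDiffAt.comp (g := (extChartAt (model p m) (1 : G)).symm) (0 : Fin m → ℚ_[p])
    (by simpa using h) ?_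
  exact (contMDiffAt_const.add contMDiffAt_id)

variable {p m}

theorem contMDiffAt_coordInv_comp {F : Type*} [NormedAddCommGroup F] [NormedSpace ℚ_[p] F]
    {f : F → Fin m → ℚ_[p]} {x : F} (hf : AnalyticAt ℚ_[p] f x) (hx : f x = 0) :
    ContMDiffAt 𝓘(ℚ_[p], F) (model p m) ω (fun y => coordInv p m G (f y)) x :=
  ContMDiffAt.comp (g := coordInv p m G) x (by rw [hx]; exact contMDiffAt_coordInv p m)
    (contMDiffAt_iff_contDiffAt.2 hf.contDiffAt)

end Manifold

variable (G) in
/-- The multiplication of `G` in the coordinates at the identity. -/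
def mulCoord (z : (Fin m → ℚ_[p]) × (Fin m → ℚ_[p])) : Fin m → ℚ_[p] :=
  coord p m (coordInv p m G z.1 * coordInv p m G z.2)

theorem eventually_mulCoord_zero_right : ∀ᶠ x in 𝓝 0, mulCoord p m G (x, 0) = x := by
  simpa [mulCoord] using eventually_coord_coordInv p m

theorem eventually_mulCoord_zero_left : ∀ᶠ x in 𝓝 0, mulCoord p m G (0, x) = x := by
  simpa [mulCoord] using eventually_coord_coordInv p m

section LieGroup

variable [LieGroup (model p m) ω G]

variable (G) in
theorem analyticAt_mulCoord : AnalyticAt ℚ_[p] (mulCoord p m G) 0 :=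
  analyticAt_coord_comp (f := fun z : (Fin m → ℚ_[p]) × (Fin m → ℚ_[p]) =>
      coordInv p m G z.1 * coordInv p m G z.2)
    ((contMDiffAt_coordInv_comp (f := Prod.fst) analyticAt_fst rfl).mul
    (contMDiffAt_coordInv_comp (f := Prod.snd) analyticAt_snd rfl)) (by simp)

theorem hasStrictFDerivAt_mulCoord : HasStrictFDerivAt (mulCoord p m G)
    (ContinuousLinearMap.fst ℚ_[p] (Fin m → ℚ_[p]) (Fin m → ℚ_[p]) +
      ContinuousLinearMap.snd ℚ_[p] (Fin m → ℚ_[p]) (Fin m → ℚ_[p])) 0 := by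
  have h := (analyticAt_mulCoord p m G).hasStrictFDerivAt
  refine h.congr_fderiv ?_
  have h1 : HasFDerivAt (fun x : Fin m → ℚ_[p] => mulCoord p m G (x, 0))
      (ContinuousLinearMap.id _ _) 0 :=
    (hasFDerivAt_id (𝕜 := ℚ_[p]) (0 : Fin m → ℚ_[p])).congr_of_eventuallyEq
      (eventually_mulCoord_zero_right p m)
  have h2 : HasFDerivAt (fun x : Fin m → ℚ_[p] => mulCoord p m G (0, x))
      (ContinuousLinearMap.id _ _) 0 :=
    (hasFDerivAt_id (𝕜 := ℚ_[p]) (0 : Fin m → ℚ_[p])).congr_of_eventuallyEq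
      (eventually_mulCoord_zero_left p m)
  have e1 := h1.unique (HasFDerivAt.comp (g := mulCoord p m G)
    (f := fun x : Fin m → ℚ_[p] => (x, (0 : Fin m → ℚ_[p])))
    (0 : Fin m → ℚ_[p]) h.hasFDerivAt
    (hasFDerivAt_prodMk_left (𝕜 := ℚ_[p]) (0 : Fin m → ℚ_[p]) (0 : Fin m → ℚ_[p])))
  have e2 := h2.unique (HasFDerivAt.comp (g := mulCoord p m G)
    (f := fun x : Fin m → ℚ_[p] => ((0 : Fin m → ℚ_[p]), x))
    (0 : Fin m → ℚ_[p]) h.hasFDerivAt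
    (hasFDerivAt_prodMk_right (𝕜 := ℚ_[p]) (0 : Fin m → ℚ_[p]) (0 : Fin m → ℚ_[p])))
  ext1
  · rw [← e1]
    ext v i
    simp
  · rw [← e2]
    ext v i
    simp

theorem eventually_coordInv_mulCoord :
    ∀ᶠ z : (Fin m → ℚ_[p]) × (Fin m → ℚ_[p]) in 𝓝 0,
      coordInv p m G (mulCoord p m G z) = coordInv p m G z.1 * coordInv p m G z.2 := by
  have : IsTopologicalGroup G := topologicalGroup_of_lieGroup (model p m) ω
  have hci := continuousAt_coordInv p m (G := G)
  have h1 : ContinuousAt (fun z : (Fin m → ℚ_[p]) × (Fin m → ℚ_[p]) =>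
      coordInv p m G z.1 * coordInv p m G z.2) 0 :=
    (ContinuousAt.comp (f := Prod.fst) (g := coordInv p m G) hci continuousAt_fst).mul
      (ContinuousAt.comp (f := Prod.snd) (g := coordInv p m G) hci continuousAt_snd)
  have h2 : Tendsto (fun z : (Fin m → ℚ_[p]) × (Fin m → ℚ_[p]) =>
      coordInv p m G z.1 * coordInv p m G z.2) (𝓝 0) (𝓝 1) := by simpa using h1.tendsto
  exact h2.eventually (eventually_coordInv_coord p m)

/-- A `p`-adic Lie group has arbitrarily small open subgroups: as the multiplication is tangent to
the addition and the norm is ultrametric, the small balls in coordinates are stable under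
multiplication and inversion. -/
theorem exists_subgroup_subset_of_mem_nhds (p : ℕ) [Fact p.Prime] (m : ℕ) {G : Type*}
    [TopologicalSpace G] [ChartedSpace (Fin m → ℚ_[p]) G] [Group G] [LieGroup (model p m) ω G]
    {U : Set G} (hU : U ∈ 𝓝 1) :
    ∃ K : Subgroup G, (K : Set G) ∈ 𝓝 1 ∧ (K : Set G) ⊆ U := by
  have : IsTopologicalGroup G := topologicalGroup_of_lieGroup (model p m) ω
  have hci := continuousAt_coordInv p m (G := G)
  have hc := continuousAt_coord p m (G := G)
  -- multiplication in coordinates does not increase the norm near the identity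
  have hF : ∀ᶠ z : (Fin m → ℚ_[p]) × (Fin m → ℚ_[p]) in 𝓝 0, ‖mulCoord p m G z‖ ≤ ‖z‖ := by
    have h := (hasStrictFDerivAt_mulCoord p m (G := G)).hasFDerivAt.isLittleO.def one_pos
    filter_upwards [h] with z hz
    have e : mulCoord p m G z = (mulCoord p m G z - mulCoord p m G 0 -
        (ContinuousLinearMap.fst ℚ_[p] (Fin m → ℚ_[p]) (Fin m → ℚ_[p]) +
      ContinuousLinearMap.snd ℚ_[p] (Fin m → ℚ_[p]) (Fin m → ℚ_[p])) (z - 0)) + (z.1 + z.2) := by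
      simp [mulCoord]
    rw [e]
    refine (IsUltrametricDist.norm_add_le_max _ _).trans (max_le (by simpa using hz) ?_)
    exact (IsUltrametricDist.norm_add_le_max _ _).trans (max_le (norm_fst_le z) (norm_snd_le z))
  have hinv0 : AnalyticAt ℚ_[p] (fun x => coord p m (coordInv p m G x)⁻¹) 0 :=
    analyticAt_coord_comp ((contMDiffAt_coordInv p m).inv) (by simp)
  have hmI : ∀ᶠ x in 𝓝 (0 : Fin m → ℚ_[p]),
      mulCoord p m G (x, coord p m (coordInv p m G x)⁻¹) = 0 := by
    have : Tendsto (fun x => (coordInv p m G x)⁻¹) (𝓝 0) (𝓝 1) := by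
      have h : ContinuousAt (fun x => (coordInv p m G x)⁻¹) 0 := hci.inv
      simpa using h.tendsto
    filter_upwards [this.eventually (eventually_coordInv_coord p m)] with x hx
    simp [mulCoord, hx]
  have hI : ∀ᶠ x in 𝓝 (0 : Fin m → ℚ_[p]), ‖coord p m (coordInv p m G x)⁻¹‖ ≤ ‖x‖ := by
    have h := (hasStrictFDerivAt_mulCoord p m (G := G)).hasFDerivAt.isLittleO.def one_half_pos
    have hpair : Tendsto (fun x => (x, coord p m (coordInv p m G x)⁻¹))
        (𝓝 (0 : Fin m → ℚ_[p])) (𝓝 0) := by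
      have := (continuousAt_id.prodMk hinv0.continuousAt).tendsto
      simpa [← Prod.mk_zero_zero] using this
    filter_upwards [hpair.eventually h, hmI] with x hx h0
    set y := coord p m (coordInv p m G x)⁻¹
    rw [h0] at hx
    have hx' : ‖x + y‖ ≤ 1 / 2 * ‖(x, y)‖ := by
      have e : mulCoord p m G 0 = 0 := by simp [mulCoord]
      rw [e, sub_zero, sub_zero, zero_sub, norm_neg] at hx
      exact hx
    by_contra hlt
    rw [not_le] at hlt
    have : ‖(x, y)‖ = ‖y‖ := by rw [Prod.norm_def]; exact max_eq_right hlt.le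
    rw [this] at hx'
    have e : y = (x + y) + (-x) := by abel
    have h3 : ‖y‖ ≤ max ‖x + y‖ ‖-x‖ := by
      conv_lhs => rw [e]
      exact IsUltrametricDist.norm_add_le_max _ _
    rw [norm_neg] at h3
    have : 0 < ‖y‖ := (norm_nonneg _).trans_lt hlt
    rcases le_max_iff.1 h3 with h | h <;> linarith
  have hMul := eventually_coordInv_mulCoord p m (G := G)
  have hInv : ∀ᶠ x in 𝓝 (0 : Fin m → ℚ_[p]),
      coordInv p m G (coord p m (coordInv p m G x)⁻¹) = (coordInv p m G x)⁻¹ := by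
    have : Tendsto (fun x => (coordInv p m G x)⁻¹) (𝓝 0) (𝓝 1) := by
      have h : ContinuousAt (fun x => (coordInv p m G x)⁻¹) 0 := hci.inv
      simpa using h.tendsto
    exact this.eventually (eventually_coordInv_coord p m)
  have hUx : ∀ᶠ x in 𝓝 (0 : Fin m → ℚ_[p]), coordInv p m G x ∈ U :=
    hci.eventually (by simpa using hU)
  obtain ⟨r, hr, hball⟩ := Metric.nhds_basis_closedBall.mem_iff.1 (hF.and hMul)
  obtain ⟨r', hr', hball'⟩ := Metric.nhds_basis_closedBall.mem_iff.1 (hI.and (hInv.and hUx))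
  set ρ := min r r'
  have hρ : 0 < ρ := lt_min hr hr'
  refine ⟨{ carrier := coordInv p m G '' Metric.closedBall 0 ρ
            mul_mem' := ?_
            one_mem' := ⟨0, by simp [hρ.le], by simp⟩
            inv_mem' := ?_ }, ?_, ?_⟩
  · rintro _ _ ⟨x, hx, rfl⟩ ⟨y, hy, rfl⟩
    rw [mem_closedBall_zero_iff] at hx hy
    have hxy : ‖(x, y)‖ ≤ ρ := max_le hx hy
    obtain ⟨h1, h2⟩ := hball (mem_closedBall_zero_iff.2 (hxy.trans (min_le_left _ _)))
    exact ⟨_, mem_closedBall_zero_iff.2 (h1.trans hxy), h2⟩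
  · rintro _ ⟨x, hx, rfl⟩
    rw [mem_closedBall_zero_iff] at hx
    obtain ⟨h1, h2, -⟩ := hball' (mem_closedBall_zero_iff.2 (hx.trans (min_le_right _ _)))
    exact ⟨_, mem_closedBall_zero_iff.2 (h1.trans hx), h2⟩
  · have : ∀ᶠ g in 𝓝 (1 : G), coord p m g ∈ Metric.closedBall (0 : Fin m → ℚ_[p]) ρ :=
      hc.eventually (by rw [coord_one]; exact Metric.closedBall_mem_nhds _ hρ)
    filter_upwards [this, eventually_coordInv_coord p m] with g h1 h2
    exact ⟨_, h1, h2⟩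
  · rintro _ ⟨x, hx, rfl⟩
    exact (hball' (Metric.closedBall_subset_closedBall (min_le_right _ _) hx)).2.2

/-- Separation is not part of the definition of a Lie group, but holds because a point in the
closure of the identity has the same coordinate as the identity. -/
theorem t2Space_of_lieGroup (p : ℕ) [Fact p.Prime] (m : ℕ) (G : Type*)
    [TopologicalSpace G] [ChartedSpace (Fin m → ℚ_[p]) G] [Group G] [LieGroup (model p m) ω G] :
    T2Space G := by
  have : IsTopologicalGroup G := topologicalGroup_of_lieGroup (model p m) ω
  have h1 : IsClosed ({1} : Set G) := by
    refine isClosed_of_closure_subset fun g hg => ?_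
    have hs : 𝓝 (1 : G) = 𝓝 g := (specializes_iff_mem_closure.2 hg).inseparable
    have hmem : ∀ U ∈ 𝓝 (1 : G), g ∈ U := fun U hU => mem_of_mem_nhds (hs ▸ hU)
    have h0 : coord p m g = 0 := by
      by_contra hne
      have : ∀ᶠ x in 𝓝 (coord p m (1 : G)), x ≠ coord p m g :=
        (isOpen_ne).mem_nhds (by simpa using Ne.symm hne)
      exact hmem _ ((continuousAt_coord p m).eventually this) rfl
    have := hmem _ (eventually_coordInv_coord p m)
    simp only [Set.mem_ofPred_eq, h0, coordInv_zero] at this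
    exact this.symm
  have := IsTopologicalGroup.t1Space G h1
  infer_instance

theorem hasStrictFDerivAt_coord_mul {F : Type*} [NormedAddCommGroup F] [NormedSpace ℚ_[p] F]
    {f g : F → G} {f' g' : F →L[ℚ_[p]] (Fin m → ℚ_[p])} {x : F}
    (hf : HasStrictFDerivAt (fun y => coord p m (f y)) f' x)
    (hg : HasStrictFDerivAt (fun y => coord p m (g y)) g' x)
    (hfc : ContinuousAt f x) (hgc : ContinuousAt g x) (hf1 : f x = 1) (hg1 : g x = 1) :
    HasStrictFDerivAt (fun y => coord p m (f y * g y)) (f' + g') x := by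
  have h := hasStrictFDerivAt_mulCoord p m (G := G)
  have h2 : HasStrictFDerivAt (fun y => mulCoord p m G (coord p m (f y), coord p m (g y)))
      (f' + g') x := by
    refine HasStrictFDerivAt.congr_fderiv (HasStrictFDerivAt.comp (g := mulCoord p m G)
      (f := fun y => (coord p m (f y), coord p m (g y))) x
      (by simp only [hf1, hg1, coord_one]; exact h) (hf.prodMk hg)) ?_
    ext v : 1
    simp
  refine h2.congr_of_eventuallyEq ?_
  have e1 := hfc.eventually (by rw [hf1]; exact eventually_coordInv_coord p m)
  have e2 := hgc.eventually (by rw [hg1]; exact eventually_coordInv_coord p m)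
  filter_upwards [e1, e2] with y h1 h2
  simp [mulCoord, h1, h2]

theorem hasDerivAt_coord_mul {f g : ℚ_[p] → G} {f' g' : Fin m → ℚ_[p]} {x : ℚ_[p]}
    (hf : HasDerivAt (fun y => coord p m (f y)) f' x)
    (hg : HasDerivAt (fun y => coord p m (g y)) g' x)
    (hfc : ContinuousAt f x) (hgc : ContinuousAt g x) (hf1 : f x = 1) (hg1 : g x = 1) :
    HasDerivAt (fun y => coord p m (f y * g y)) (f' + g') x := by
  have h := (hasStrictFDerivAt_mulCoord p m (G := G)).hasFDerivAt
  have h2 : HasDerivAt (fun y => mulCoord p m G (coord p m (f y), coord p m (g y)))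
      (f' + g') x := by
    refine (HasFDerivAt.comp_hasDerivAt (l := mulCoord p m G)
      (f := fun y => (coord p m (f y), coord p m (g y))) x
      (by simp only [hf1, hg1, coord_one]; exact h) (hf.prodMk hg)).congr_deriv ?_
    simp
  refine h2.congr_of_eventuallyEq ?_
  have e1 := hfc.eventually (by rw [hf1]; exact eventually_coordInv_coord p m)
  have e2 := hgc.eventually (by rw [hg1]; exact eventually_coordInv_coord p m)
  filter_upwards [e1, e2] with y h1 h2
  simp [mulCoord, h1, h2]

theorem hasStrictFDerivAt_coord_pow (n : ℕ) :
    HasStrictFDerivAt (fun x => coord p m ((coordInv p m G x) ^ n))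
      ((n : ℚ_[p]) • ContinuousLinearMap.id ℚ_[p] (Fin m → ℚ_[p])) 0 := by
  have : IsTopologicalGroup G := topologicalGroup_of_lieGroup (model p m) ω
  induction n with
  | zero =>
    simpa using hasStrictFDerivAt_const (𝕜 := ℚ_[p]) (0 : Fin m → ℚ_[p]) (0 : Fin m → ℚ_[p])
  | succ n ih =>
    have h1 : HasStrictFDerivAt (fun x => coord p m (coordInv p m G x))
        (ContinuousLinearMap.id ℚ_[p] (Fin m → ℚ_[p])) 0 :=
      (hasStrictFDerivAt_id _).congr_of_eventuallyEq
        ((eventually_coord_coordInv p m).mono fun x hx => hx.symm)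
    have := hasStrictFDerivAt_coord_mul p m ih h1 ((continuousAt_coordInv p m).pow n)
      (continuousAt_coordInv p m) (by simp) (by simp)
    simp only [pow_succ]
    refine this.congr_fderiv ?_
    ext v i
    simp [add_mul]

/-- Near the identity, `g ↦ g ^ p` contracts distances by `1 / p` at most, since its derivative is
the multiplication by `p`. -/
theorem eventually_norm_coord_sub_le :
    ∀ᶠ z in 𝓝 ((1, 1) : G × G), ‖coord p m z.1 - coord p m z.2‖ ≤
      p * ‖coord p m (z.1 ^ p) - coord p m (z.2 ^ p)‖ := by
  have hp : 0 < (p : ℝ) := by exact_mod_cast (Fact.out : p.Prime).pos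
  have h := (hasStrictFDerivAt_coord_pow p m (G := G) p).isLittleO.def
    (c := (p : ℝ)⁻¹ / 2) (by positivity)
  have hc : Tendsto (fun z : G × G => (coord p m z.1, coord p m z.2)) (𝓝 (1, 1)) (𝓝 (0, 0)) := by
    have := (continuousAt_coord p m (G := G))
    have h1 : ContinuousAt (fun z : G × G => (coord p m z.1, coord p m z.2)) (1, 1) :=
      (ContinuousAt.comp (f := Prod.fst) (g := coord p m) this continuousAt_fst).prodMk
        (ContinuousAt.comp (f := Prod.snd) (g := coord p m) this continuousAt_snd)
    simpa using h1.tendsto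
  have e : ∀ᶠ z in 𝓝 ((1, 1) : G × G), coordInv p m G (coord p m z.1) = z.1 ∧
      coordInv p m G (coord p m z.2) = z.2 := by
    rw [nhds_prod_eq]
    exact (eventually_coordInv_coord p m).prod_mk (eventually_coordInv_coord p m)
  filter_upwards [hc.eventually h, e] with z hz ⟨h1, h2⟩
  simp only [h1, h2, smul_apply, ContinuousLinearMap.id_apply] at hz
  set a := coord p m z.1 - coord p m z.2
  set b := coord p m (z.1 ^ p) - coord p m (z.2 ^ p)
  have hpa : ‖(p : ℚ_[p]) • a‖ = (p : ℝ)⁻¹ * ‖a‖ := by rw [norm_smul, Padic.norm_p]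
  have : (p : ℝ)⁻¹ * ‖a‖ ≤ max ‖b‖ ((p : ℝ)⁻¹ / 2 * ‖a‖) := by
    rw [← hpa]
    have e : (p : ℚ_[p]) • a = b + -(b - (p : ℚ_[p]) • a) := by abel
    rw [e]
    refine (IsUltrametricDist.norm_add_le_max _ _).trans (max_le_max le_rfl ?_)
    rwa [norm_neg]
  rcases le_max_iff.1 this with h | h
  · rwa [inv_mul_le_iff₀ hp] at h
  · have h0 : ‖a‖ = 0 := by
      by_contra hne
      have : 0 < ‖a‖ := lt_of_le_of_ne (norm_nonneg _) (Ne.symm hne)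
      have : 0 < (p : ℝ)⁻¹ * ‖a‖ := by positivity
      linarith
    rw [h0]; positivity

end LieGroup

end Coordinates

/-! ### Left translations in coordinates -/

section LeftTranslation

variable (p : ℕ) [Fact p.Prime] (m : ℕ) (G : Type*) [TopologicalSpace G]
  [ChartedSpace (Fin m → ℚ_[p]) G] [Group G]

/-- The derivative at the identity of the left translation by the element of coordinate `x`. As a
function of `x`, applied to a fixed vector, it is a left invariant vector field. -/
def leftDeriv (x : Fin m → ℚ_[p]) : (Fin m → ℚ_[p]) →L[ℚ_[p]] (Fin m → ℚ_[p]) :=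
  (fderiv ℚ_[p] (mulCoord p m G) (x, 0)).comp
    (ContinuousLinearMap.inr ℚ_[p] (Fin m → ℚ_[p]) (Fin m → ℚ_[p]))

variable [LieGroup (model p m) ω G]

theorem analyticAt_leftDeriv : AnalyticAt ℚ_[p] (leftDeriv p m G) 0 := by
  have h1 : AnalyticAt ℚ_[p] (fun x : Fin m → ℚ_[p] =>
      fderiv ℚ_[p] (mulCoord p m G) (x, (0 : Fin m → ℚ_[p]))) 0 :=
    AnalyticAt.comp (g := fderiv ℚ_[p] (mulCoord p m G)) (analyticAt_mulCoord p m G).fderiv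
      (analyticAt_id.prod analyticAt_const)
  exact (((ContinuousLinearMap.compL ℚ_[p] (Fin m → ℚ_[p]) _ (Fin m → ℚ_[p])).flip
    (ContinuousLinearMap.inr ℚ_[p] (Fin m → ℚ_[p]) (Fin m → ℚ_[p]))).analyticAt _).comp h1

theorem leftDeriv_zero : leftDeriv p m G 0 = ContinuousLinearMap.id _ _ := by
  have h := (hasStrictFDerivAt_mulCoord p m (G := G)).hasFDerivAt.fderiv
  rw [leftDeriv, Prod.mk_zero_zero, h]
  ext v i
  simp

theorem eventually_mulCoord_assoc :
    ∀ᶠ z : ((Fin m → ℚ_[p]) × (Fin m → ℚ_[p])) × (Fin m → ℚ_[p]) in 𝓝 0,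
      mulCoord p m G (mulCoord p m G z.1, z.2) =
        mulCoord p m G (z.1.1, mulCoord p m G (z.1.2, z.2)) := by
  have h := eventually_coordInv_mulCoord p m (G := G)
  have t1 : Tendsto (fun z : ((Fin m → ℚ_[p]) × (Fin m → ℚ_[p])) × (Fin m → ℚ_[p]) => z.1)
      (𝓝 0) (𝓝 0) := (continuous_fst.tendsto _)
  have t2 : Tendsto (fun z : ((Fin m → ℚ_[p]) × (Fin m → ℚ_[p])) × (Fin m → ℚ_[p]) =>
      (z.1.2, z.2)) (𝓝 0) (𝓝 0) :=
    ((continuous_snd.comp continuous_fst).prodMk continuous_snd).tendsto _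
  filter_upwards [t1.eventually h, t2.eventually h] with z h1 h2
  simp only [mulCoord] at h1 h2 ⊢
  rw [h1, h2, mul_assoc]

/-- The left invariance of the vector fields `leftDeriv`: associativity, differentiated in the third
variable at the identity. -/
theorem eventually_leftDeriv_mulCoord :
    ∀ᶠ z : (Fin m → ℚ_[p]) × (Fin m → ℚ_[p]) in 𝓝 0,
      ∀ v, leftDeriv p m G (mulCoord p m G z) v =
        fderiv ℚ_[p] (mulCoord p m G) z (0, leftDeriv p m G z.2 v) := by
  have hA := (analyticAt_mulCoord p m G)
  have h0 : mulCoord p m G 0 = 0 := by simp [mulCoord]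
  have hassoc : ∀ᶠ z : (Fin m → ℚ_[p]) × (Fin m → ℚ_[p]) in 𝓝 0,
      ∀ᶠ w in 𝓝 (0 : Fin m → ℚ_[p]), mulCoord p m G (mulCoord p m G z, w) =
        mulCoord p m G (z.1, mulCoord p m G (z.2, w)) :=
    (eventually_mulCoord_assoc p m G).curry_nhds
  have t1 : Tendsto (fun z : (Fin m → ℚ_[p]) × (Fin m → ℚ_[p]) =>
      (mulCoord p m G z, (0 : Fin m → ℚ_[p]))) (𝓝 0) (𝓝 0) := by
    have := (hA.continuousAt.prodMk (continuousAt_const (y := (0 : Fin m → ℚ_[p])))).tendsto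
    rwa [h0] at this
  have t2 : Tendsto (fun z : (Fin m → ℚ_[p]) × (Fin m → ℚ_[p]) =>
      (z.2, (0 : Fin m → ℚ_[p]))) (𝓝 0) (𝓝 0) :=
    (continuous_snd.prodMk continuous_const).tendsto _
  have t3 : Tendsto (fun z : (Fin m → ℚ_[p]) × (Fin m → ℚ_[p]) => z.2) (𝓝 0) (𝓝 0) :=
    continuous_snd.tendsto _
  have hd := hA.eventually_analyticAt
  filter_upwards [hassoc, hd, t1.eventually hd, t2.eventually hd,
    t3.eventually (eventually_mulCoord_zero_right p m (G := G))] with z h1 h2 h3 h4 h5 v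
  have inr' : ∀ x : Fin m → ℚ_[p], HasFDerivAt (fun w : Fin m → ℚ_[p] => (x, w))
      (ContinuousLinearMap.inr ℚ_[p] (Fin m → ℚ_[p]) (Fin m → ℚ_[p])) 0 := fun x =>
    hasFDerivAt_prodMk_right (𝕜 := ℚ_[p]) x (0 : Fin m → ℚ_[p])
  have e1 : HasFDerivAt (fun w => mulCoord p m G (mulCoord p m G z, w))
      (leftDeriv p m G (mulCoord p m G z)) 0 :=
    HasFDerivAt.comp (g := mulCoord p m G) (0 : Fin m → ℚ_[p])
      h3.differentiableAt.hasFDerivAt (inr' _)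
  have e2 : HasFDerivAt (fun w => mulCoord p m G (z.2, w)) (leftDeriv p m G z.2) 0 :=
    HasFDerivAt.comp (g := mulCoord p m G) (0 : Fin m → ℚ_[p])
      h4.differentiableAt.hasFDerivAt (inr' _)
  have e3 : HasFDerivAt (fun w => mulCoord p m G (z.1, mulCoord p m G (z.2, w)))
      ((fderiv ℚ_[p] (mulCoord p m G) z).comp ((0 : (Fin m → ℚ_[p]) →L[ℚ_[p]] _).prod
        (leftDeriv p m G z.2))) 0 := by
    refine HasFDerivAt.comp (g := mulCoord p m G) (0 : Fin m → ℚ_[p]) ?_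
      ((hasFDerivAt_const z.1 (0 : Fin m → ℚ_[p])).prodMk e2)
    rw [h5]
    exact h2.differentiableAt.hasFDerivAt
  have := e1.unique (e3.congr_of_eventuallyEq h1)
  rw [this]
  simp

end LeftTranslation

/-! ### The exponential -/

section Exp

variable (p : ℕ) [Fact p.Prime] (m : ℕ) (G : Type*) [TopologicalSpace G]
  [ChartedSpace (Fin m → ℚ_[p]) G] [Group G] [LieGroup (model p m) ω G]

/-- Near `0`, an analytic function which vanishes on a small segment `a + u b` starting from `a`
vanishes at `a + b`. In the ultrametric setting there is no connectedness: one power series has to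
converge on a disc that contains `1`. -/
theorem exists_line_powerSeries {E F : Type*} [NormedAddCommGroup E] [NormedSpace ℚ_[p] E]
    [NormedAddCommGroup F] [NormedSpace ℚ_[p] F] [CompleteSpace F] {w : E → F}
    (hw : AnalyticAt ℚ_[p] w 0) :
    ∃ ρ > 0, ∀ a b : E, ‖a‖ < ρ → ‖b‖ < ρ → (∀ᶠ u in 𝓝 (0 : ℚ_[p]), w (a + u • b) = 0) →
      w (a + b) = 0 := by
  obtain ⟨q, R, hq⟩ := hw
  obtain ⟨ρ, hρ0, hρR⟩ := ENNReal.lt_iff_exists_nnreal_btwn.1 hq.r_pos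
  have hρ0' : 0 < ρ := by exact_mod_cast hρ0
  refine ⟨ρ / 2, by positivity, fun a b ha hb h => ?_⟩
  have hq' := hq.mono hρ0 hρR.le
  have ha' : (‖a‖₊ : ENNReal) < (ρ / 2 : NNReal) := by
    have : ‖a‖₊ < ρ / 2 := by rw [← NNReal.coe_lt_coe]; simpa using ha
    exact_mod_cast this
  have hb' : ‖b‖₊ < ρ / 2 := by rw [← NNReal.coe_lt_coe]; simpa using hb
  have haρ : (‖a‖₊ : ENNReal) < ρ := ha'.trans_le (by
    exact_mod_cast (half_le_self (zero_le (a := ρ))))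
  have h1 := hq'.changeOrigin haρ
  have hsub : ((ρ / 2 : NNReal) : ENNReal) ≤ (ρ : ENNReal) - ‖a‖₊ := by
    refine ENNReal.le_sub_of_add_le_right ENNReal.coe_ne_top ?_
    calc ((ρ / 2 : NNReal) : ENNReal) + ‖a‖₊
        ≤ ((ρ / 2 : NNReal) : ENNReal) + (ρ / 2 : NNReal) := by gcongr
      _ = ρ := by norm_cast; exact add_halves ρ
  have hpos2 : (0 : ENNReal) < ((ρ / 2 : NNReal) : ENNReal) := by
    exact_mod_cast half_pos hρ0'
  have h2 := (h1.mono hpos2 hsub).comp_sub (-a)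
  simp only [zero_add, sub_neg_eq_add, add_neg_cancel] at h2
  have h3 : HasFPowerSeriesOnBall (fun z => w (z + a)) (q.changeOrigin a)
      (ContinuousLinearMap.toSpanSingleton ℚ_[p] b 0) (ρ / 2 : NNReal) := by
    simpa using h2
  have h4 := h3.compContinuousLinearMap
  have h5 := eq_zero_on_ball_of_eventually h4 (z := 1) (by
    filter_upwards [h] with u hu
    simpa [add_comm] using hu) (by
    rw [Metric.mem_eball, edist_zero_right]
    rw [ENNReal.lt_div_iff_mul_lt (Or.inr (by simp)) (Or.inr (by simp))]
    simp only [enorm_one, one_mul]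
    have : ‖ContinuousLinearMap.toSpanSingleton ℚ_[p] b‖ₑ = ‖b‖₊ := by
      rw [enorm_eq_nnnorm]
      congr 1
      ext
      simp
    rw [this]
    exact_mod_cast hb')
  simpa [add_comm] using h5

/-- The exponential map: an analytic local diffeomorphism `e` at `0`, tangent to the identity, which
is additive along each line through `0`. Additivity holds because, for fixed `s`, both
`e ((s + t) X)` and `e (s X) e (t X)` are integral curves of the left invariant vector field of
`X`. -/
theorem exists_exp : ∃ (e : (Fin m → ℚ_[p]) → G) (r : ℝ), 0 < r ∧ e 0 = 1 ∧ ContinuousAt e 0 ∧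
    AnalyticAt ℚ_[p] (fun x => coord p m (e x)) 0 ∧
    HasStrictFDerivAt (fun x => coord p m (e x)) (ContinuousLinearMap.id ℚ_[p] (Fin m → ℚ_[p])) 0 ∧
    ∀ X, ‖X‖ < r → ∀ s t : ℚ_[p], ‖s‖ ≤ 1 → ‖t‖ ≤ 1 → e ((s + t) • X) = e (s • X) * e (t • X) := by
  have hV := analyticAt_leftDeriv p m G
  obtain ⟨f, hfa, hf0, hfd, hf⟩ := exists_radial_solution hV (leftDeriv_zero p m G)
  set F := mulCoord p m G with hFdef
  set V := leftDeriv p m G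
  have hFA : AnalyticAt ℚ_[p] F 0 := analyticAt_mulCoord p m G
  have hF0 : F 0 = 0 := by simp [hFdef, mulCoord]
  -- `w (s X, t X)` is the defect of additivity of `f` on the line of `X`
  set w : (Fin m → ℚ_[p]) × (Fin m → ℚ_[p]) → (Fin m → ℚ_[p]) :=
    fun z => F (f z.1, f z.2) - f (z.1 + z.2) with hw
  have hpair : AnalyticAt ℚ_[p] (fun z : (Fin m → ℚ_[p]) × (Fin m → ℚ_[p]) => (f z.1, f z.2)) 0 :=
    (AnalyticAt.comp (g := f) (f := Prod.fst) hfa analyticAt_fst).prod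
      (AnalyticAt.comp (g := f) (f := Prod.snd) hfa analyticAt_snd)
  have hp0 : (f (0 : (Fin m → ℚ_[p]) × (Fin m → ℚ_[p])).1,
      f (0 : (Fin m → ℚ_[p]) × (Fin m → ℚ_[p])).2) = 0 := by
    simp [hf0]
  have hFf : AnalyticAt ℚ_[p] (fun z : (Fin m → ℚ_[p]) × (Fin m → ℚ_[p]) => F (f z.1, f z.2)) 0 :=
    AnalyticAt.comp (g := F) (by rw [hp0]; exact hFA) hpair
  have hadd : AnalyticAt ℚ_[p] (fun z : (Fin m → ℚ_[p]) × (Fin m → ℚ_[p]) => f (z.1 + z.2)) 0 :=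
    AnalyticAt.comp (g := f) (by simpa using hfa) (analyticAt_fst.add analyticAt_snd)
  have hwA : AnalyticAt ℚ_[p] w 0 := hFf.sub hadd
  obtain ⟨ρ, hρ, hline⟩ := exists_line_powerSeries p hwA
  -- conditions near the origin
  obtain ⟨K, S, hS, hLip⟩ := hV.hasStrictFDerivAt.exists_lipschitzOnWith
  have tp : Tendsto (fun z : (Fin m → ℚ_[p]) × (Fin m → ℚ_[p]) => (f z.1, f z.2)) (𝓝 0) (𝓝 0) := by
    have := hpair.continuousAt.tendsto; rwa [hp0] at this
  have tF : Tendsto (fun z : (Fin m → ℚ_[p]) × (Fin m → ℚ_[p]) => F (f z.1, f z.2))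
      (𝓝 0) (𝓝 0) := by
    have := hFf.continuousAt.tendsto
    rwa [hp0, hF0] at this
  have ta : Tendsto (fun z : (Fin m → ℚ_[p]) × (Fin m → ℚ_[p]) => f (z.1 + z.2)) (𝓝 0) (𝓝 0) := by
    have := hadd.continuousAt.tendsto
    simpa [hf0] using this
  have tf : Tendsto f (𝓝 0) (𝓝 0) := by
    have := hfa.continuousAt.tendsto; rwa [hf0] at this
  have c1 := hf.and hfa.eventually_analyticAt
  have c2 := tf.eventually (eventually_mulCoord_zero_right p m (G := G))
  have c3 := (tp.eventually (eventually_leftDeriv_mulCoord p m G)).and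
    ((tp.eventually hFA.eventually_analyticAt).and ((tF.eventually hS).and ((ta.eventually hS).and
      ((tp.eventually (eventually_coordInv_mulCoord p m (G := G))).and
        hwA.eventually_analyticAt))))
  obtain ⟨r1, hr1, hb1⟩ := Metric.nhds_basis_ball.mem_iff.1 (c1.and c2)
  obtain ⟨r2, hr2, hb2⟩ := Metric.nhds_basis_ball.mem_iff.1 c3
  set r := min (min r1 r2) ρ
  have hr : 0 < r := lt_min (lt_min hr1 hr2) hρ
  refine ⟨fun x => coordInv p m G (f x), r, hr, by simp [hf0], ?_, ?_, ?_, ?_⟩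
  · exact ContinuousAt.comp (g := coordInv p m G) (by rw [hf0]; exact continuousAt_coordInv p m)
      hfa.continuousAt
  · exact analyticAt_coord_comp (contMDiffAt_coordInv_comp hfa hf0) (by simp [hf0])
  · exact hfd.congr_of_eventuallyEq ((tf.eventually (eventually_coord_coordInv p m (G := G))).mono
      fun x hx => hx.symm)
  intro X hX s t hs ht
  have hsm : ∀ c : ℚ_[p], ‖c‖ ≤ 1 → ‖c • X‖ < r := fun c hc => by
    rw [norm_smul]
    exact (mul_le_of_le_one_left (norm_nonneg _) hc).trans_lt hX
  have rad : ∀ c : ℚ_[p], ‖c‖ ≤ 1 → fderiv ℚ_[p] f (c • X) X = V (f (c • X)) X := by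
    intro c hc
    rcases eq_or_ne c 0 with rfl | hc0
    · have : V 0 = ContinuousLinearMap.id _ _ := leftDeriv_zero p m G
      rw [zero_smul, hf0, this, hfd.hasFDerivAt.fderiv]
    · have := (hb1 (mem_ball_zero_iff.2 ((hsm c hc).trans_le
        ((min_le_left _ _).trans (min_le_left _ _))))).1.1
      rw [map_smul, map_smul] at this
      exact smul_right_injective _ hc0 this
  have hder : ∀ c : ℚ_[p], ‖c‖ ≤ 1 → ∀ a : ℚ_[p], ∀ u, a + u = c →
      HasDerivAt (fun u => f ((a + u) • X)) (V (f (c • X)) X) u := by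
    intro c hc a u hu
    have h1 := (hb1 (mem_ball_zero_iff.2 ((hsm c hc).trans_le
        ((min_le_left _ _).trans (min_le_left _ _))))).1.2.differentiableAt.hasFDerivAt
    rw [← rad c hc]
    have h2 : HasDerivAt (fun u => (a + u) • X) X u := by
      simpa using (((hasDerivAt_id u).const_add a).smul_const X)
    exact HasFDerivAt.comp_hasDerivAt (l := f) (f := fun u => (a + u) • X) u
      (by rw [hu]; exact h1) h2
  have hmem : ∀ c d : ℚ_[p], ‖c‖ ≤ 1 → ‖d‖ ≤ 1 →
      (c • X, d • X) ∈ Metric.ball (0 : (Fin m → ℚ_[p]) × (Fin m → ℚ_[p])) r2 := fun c d hc hd => by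
    rw [mem_ball_zero_iff]
    exact (max_lt (hsm c hc) (hsm d hd)).trans_le ((min_le_left _ _).trans (min_le_right _ _))
  have hzero : w (s • X, t • X) = 0 := by
    have hdec : ((s • X, t • X) : (Fin m → ℚ_[p]) × (Fin m → ℚ_[p])) =
        (s • X, 0) + (0, t • X) := by simp
    rw [hdec]
    have hn1 : ‖((s • X, 0) : (Fin m → ℚ_[p]) × (Fin m → ℚ_[p]))‖ < ρ := by
      rw [Prod.norm_def]; exact max_lt ((hsm s hs).trans_le (min_le_right _ _)) (by simpa using hρ)
    have hn2 : ‖((0, t • X) : (Fin m → ℚ_[p]) × (Fin m → ℚ_[p]))‖ < ρ := by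
      rw [Prod.norm_def]; exact max_lt (by simpa using hρ) ((hsm t ht).trans_le (min_le_right _ _))
    refine hline _ _ hn1 hn2 ?_
    have hh : ∀ u : ℚ_[p], ((s • X, (0 : Fin m → ℚ_[p])) + u • ((0 : Fin m → ℚ_[p]), t • X)) =
        (s • X, (u * t) • X) := fun u => by simp [mul_smul]
    simp only [hh]
    have hsmall : ∀ᶠ u : ℚ_[p] in 𝓝 0, ‖u‖ ≤ 1 := by
      filter_upwards [Metric.closedBall_mem_nhds (0 : ℚ_[p]) one_pos] with u hu
      simpa using hu
    have hprod : ∀ u : ℚ_[p], ‖u‖ ≤ 1 → ‖u * t‖ ≤ 1 := fun u hu => by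
      rw [norm_mul]; exact mul_le_one₀ hu (norm_nonneg _) ht
    -- both terms of the defect are integral curves of the same vector field, and this field is
    -- Lipschitz, so the derivative of the defect is bounded by the defect
    refine eventuallyEq_zero_of_deriv_isBigO (f := fun u : ℚ_[p] => w (s • X, (u * t) • X))
      ?_ ?_ ?_
    · have h1 := (hb2 (hmem s 0 hs (by simp))).2.2.2.2.2
      refine AnalyticAt.comp (g := w) (by simpa using h1) ?_
      exact analyticAt_const.prod ((analyticAt_id.mul analyticAt_const).smul analyticAt_const)
    · have h1 := (hb1 (mem_ball_zero_iff.2 ((hsm s hs).trans_le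
        ((min_le_left _ _).trans (min_le_left _ _))))).2
      simp only [hw, zero_mul, zero_smul, hf0, add_zero]
      exact sub_eq_zero.2 h1
    · refine IsBigO.of_bound (K * ‖t • X‖) ?_
      filter_upwards [hsmall] with u hu
      have hb := hb2 (hmem s (u * t) hs (hprod u hu))
      obtain ⟨b1, b2, b3, b4, -, -⟩ := hb
      have hsu : ‖s + u * t‖ ≤ 1 :=
        (IsUltrametricDist.norm_add_le_max _ _).trans (max_le hs (hprod u hu))
      have d1 : HasDerivAt (fun u => f ((u * t) • X)) (t • V (f ((u * t) • X)) X) u := by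
        have := hder (u * t) (hprod u hu) 0 (u * t) (zero_add _)
        simp only [zero_add] at this
        exact HasDerivAt.scomp (g₁ := fun v => f (v • X)) (h := fun u => u * t) u this
          (hasDerivAt_mul_const t)
      have d2 : HasDerivAt (fun u => f ((s + u * t) • X)) (t • V (f ((s + u * t) • X)) X) u := by
        have := hder (s + u * t) hsu s (u * t) rfl
        exact HasDerivAt.scomp (g₁ := fun v => f ((s + v) • X)) (h := fun u => u * t) u this
          (hasDerivAt_mul_const t)
      have d3 : HasDerivAt (fun u => F (f (s • X), f ((u * t) • X)))
          (t • V (F (f (s • X), f ((u * t) • X))) X) u := by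
        have := HasFDerivAt.comp_hasDerivAt (l := F) u
          b2.differentiableAt.hasFDerivAt ((hasDerivAt_const u (f (s • X))).prodMk d1)
        refine this.congr_deriv ?_
        have e : ∀ a : Fin m → ℚ_[p], ((0 : Fin m → ℚ_[p]), t • a) = t • ((0 : Fin m → ℚ_[p]), a) :=
          fun a => by simp
        rw [b1 X, e, map_smul]
      have d4 : HasDerivAt (fun u => w (s • X, (u * t) • X))
          (t • V (F (f (s • X), f ((u * t) • X))) X - t • V (f ((s + u * t) • X)) X) u := by
        refine (d3.sub d2).congr_of_eventuallyEq (Eventually.of_forall fun v => ?_)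
        simp [hw, add_smul]
      rw [d4.deriv, ← map_smul, ← map_smul, ← sub_apply]
      rw [← add_smul] at b4
      have := hLip.norm_sub_le b3 b4
      calc _ ≤ ‖V (F (f (s • X), f ((u * t) • X))) - V (f ((s + u * t) • X))‖ * ‖t • X‖ :=
            ContinuousLinearMap.le_opNorm _ _
        _ ≤ (K * ‖F (f (s • X), f ((u * t) • X)) - f ((s + u * t) • X)‖) * ‖t • X‖ := by gcongr
        _ = _ := by simp only [hw, ← add_smul]; ring
  have hm := (hb2 (hmem s t hs ht)).2.2.2.2.1
  simp only [hw, ← add_smul] at hzero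
  rw [sub_eq_zero] at hzero
  simp only
  rw [← hzero, hm]

end Exp

/-! ### Local one-parameter subgroups -/

section LocalHom

theorem norm_natCast_mul_le (p : ℕ) [Fact p.Prime] (n : ℕ) (t : ℚ_[p]) :
    ‖(n : ℚ_[p]) * t‖ ≤ ‖t‖ := by
  rw [norm_mul]
  exact mul_le_of_le_one_left (norm_nonneg _) (by exact_mod_cast Padic.norm_int_le_one (n : ℤ))

theorem tendsto_pow_mul_zero (p : ℕ) [Fact p.Prime] (t : ℚ_[p]) :
    Tendsto (fun k : ℕ => (p : ℚ_[p]) ^ k * t) atTop (𝓝 0) := by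
  have h : Tendsto (fun k : ℕ => (p : ℚ_[p]) ^ k) atTop (𝓝 0) :=
    tendsto_pow_atTop_nhds_zero_of_norm_lt_one Padic.norm_p_lt_one
  simpa using h.mul_const t

theorem apply_zero_eq_one {p : ℕ} [Fact p.Prime] {G : Type*} [Group G] {γ : ℚ_[p] → G} {δ : ℝ}
    (hδ : 0 ≤ δ) (h : ∀ s t, ‖s‖ ≤ δ → ‖t‖ ≤ δ → γ (s + t) = γ s * γ t) : γ 0 = 1 := by
  have := h 0 0 (by simpa) (by simpa)
  simpa using this

theorem apply_natCast_mul {p : ℕ} [Fact p.Prime] {G : Type*} [Group G] {γ : ℚ_[p] → G} {δ : ℝ}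
    (hδ : 0 ≤ δ) (h : ∀ s t, ‖s‖ ≤ δ → ‖t‖ ≤ δ → γ (s + t) = γ s * γ t) (n : ℕ)
    {t : ℚ_[p]} (ht : ‖t‖ ≤ δ) :
    γ (n * t) = γ t ^ n := by
  induction n with
  | zero => simpa using apply_zero_eq_one hδ h
  | succ n ih =>
    push_cast
    rw [add_mul, one_mul, h _ _ ((norm_natCast_mul_le p n t).trans ht) ht, ih, pow_succ]

end LocalHom

section LocalOneParam

variable (p : ℕ) [Fact p.Prime] {m : ℕ} {G : Type*} [TopologicalSpace G]
  [ChartedSpace (Fin m → ℚ_[p]) G] [Group G]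

/-- The germ at `0` of the function `γ` is a local one-parameter subgroup with derivative `X`. The
values of `γ` off a small ball play no role. -/
structure IsLocalOneParam (γ : ℚ_[p] → G) (X : Fin m → ℚ_[p]) : Prop where
  continuousAt : ContinuousAt γ 0
  hasDerivAt : HasDerivAt (fun t => coord p m (γ t)) X 0
  exists_hom : ∃ δ > 0, ∀ s t, ‖s‖ ≤ δ → ‖t‖ ≤ δ → γ (s + t) = γ s * γ t

variable {p}

theorem IsLocalOneParam.map_zero {γ : ℚ_[p] → G} {X : Fin m → ℚ_[p]}
    (h : IsLocalOneParam p γ X) : γ 0 = 1 := by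
  obtain ⟨δ, hδ, h⟩ := h.exists_hom
  exact apply_zero_eq_one hδ.le h

theorem IsLocalOneParam.hasDerivativeAtZero {γ : ℚ_[p] → G} {X : Fin m → ℚ_[p]}
    (h : IsLocalOneParam p γ X) : HasDerivativeAtZero p γ (X : LieAlg p m G) :=
  (hasDerivativeAtZero_iff p m).2 ⟨h.map_zero, h.continuousAt, h.hasDerivAt⟩

theorem IsLocalOneParam.congr {γ γ' : ℚ_[p] → G} {X : Fin m → ℚ_[p]}
    (h : IsLocalOneParam p γ X) (he : ∀ᶠ t in 𝓝 0, γ' t = γ t) : IsLocalOneParam p γ' X := by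
  obtain ⟨δ, hδ, hh⟩ := h.exists_hom
  obtain ⟨ε, hε, he'⟩ := Metric.nhds_basis_closedBall.mem_iff.1 he
  refine ⟨h.continuousAt.congr (he.mono fun t ht => ht.symm), h.hasDerivAt.congr_of_eventuallyEq
    (he.mono fun t ht => by simp only [ht]), min δ ε, lt_min hδ hε, fun s t hs ht => ?_⟩
  have hmem : ∀ u : ℚ_[p], ‖u‖ ≤ min δ ε → γ' u = γ u := fun u hu =>
    he' (mem_closedBall_zero_iff.2 (hu.trans (min_le_right _ _)))
  rw [hmem _ hs, hmem _ ht, hmem _ ((IsUltrametricDist.norm_add_le_max _ _).trans (max_le hs ht)),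
    hh _ _ (hs.trans (min_le_left _ _)) (ht.trans (min_le_left _ _))]

variable [LieGroup (model p m) ω G]

variable (p m G) in
/-- On a small open subgroup, `p`-th powers contract distances by `1 / p` at most. -/
theorem exists_subgroup_norm_coord_sub_le :
    ∃ K : Subgroup G, (K : Set G) ∈ 𝓝 1 ∧ (∀ g ∈ K, coordInv p m G (coord p m g) = g) ∧
      ∀ g ∈ K, ∀ h ∈ K, ∀ k : ℕ,
        ‖coord p m g - coord p m h‖ ≤ p ^ k * ‖coord p m (g ^ p ^ k) - coord p m (h ^ p ^ k)‖ := by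
  have h1 := eventually_norm_coord_sub_le p m (G := G)
  rw [nhds_prod_eq] at h1
  obtain ⟨S, hS, h1⟩ := mem_prod_same_iff.1 h1
  obtain ⟨K, hK1, hK⟩ := exists_subgroup_subset_of_mem_nhds p m
    (inter_mem hS (eventually_coordInv_coord p m (G := G)))
  refine ⟨K, hK1, fun g hg => (hK hg).2, fun g hg h hh k => ?_⟩
  induction k with
  | zero => simp
  | succ k ih =>
    have := h1 (Set.mk_mem_prod (hK (K.pow_mem hg (p ^ k))).1 (hK (K.pow_mem hh (p ^ k))).1)
    simp only [Set.mem_ofPred_eq, ← pow_mul, ← pow_succ] at this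
    calc _ ≤ _ := ih
      _ ≤ (p : ℝ) ^ k * (p * ‖coord p m (g ^ p ^ (k + 1)) - coord p m (h ^ p ^ (k + 1))‖) := by
        gcongr
      _ = _ := by ring

/-- Uniqueness of local one-parameter subgroups, without any regularity beyond differentiability at
`0`: the distance of `γ t` and `γ' t` is at most `p ^ k` times that of `γ (p ^ k t)` and
`γ' (p ^ k t)`, which is `o(p ^ (-k))`. -/
theorem IsLocalOneParam.eventuallyEq {γ γ' : ℚ_[p] → G} {X : Fin m → ℚ_[p]}
    (h : IsLocalOneParam p γ X) (h' : IsLocalOneParam p γ' X) : ∀ᶠ t in 𝓝 0, γ t = γ' t := by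
  obtain ⟨K, hK1, hK2, hK3⟩ := exists_subgroup_norm_coord_sub_le p m G
  obtain ⟨δ, hδ, hh⟩ := h.exists_hom
  obtain ⟨δ', hδ', hh'⟩ := h'.exists_hom
  have e1 : ∀ᶠ t in 𝓝 0, γ t ∈ K := h.continuousAt.eventually (by rw [h.map_zero]; exact hK1)
  have e2 : ∀ᶠ t in 𝓝 0, γ' t ∈ K := h'.continuousAt.eventually (by rw [h'.map_zero]; exact hK1)
  have e3 : ∀ᶠ t : ℚ_[p] in 𝓝 0, ‖t‖ ≤ min δ δ' := by
    filter_upwards [Metric.closedBall_mem_nhds (0 : ℚ_[p]) (lt_min hδ hδ')] with t ht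
    simpa using ht
  have hD : (fun t => coord p m (γ t) - coord p m (γ' t)) =o[𝓝 0] fun t : ℚ_[p] => t := by
    have := (h.hasDerivAt.sub h'.hasDerivAt).isLittleO
    simpa [h.map_zero, h'.map_zero] using this
  filter_upwards [e1, e2, e3] with t h1 h2 h3
  have hp : 0 < (p : ℝ) := by exact_mod_cast (Fact.out : p.Prime).pos
  have hsmall : ∀ ε > 0, ‖coord p m (γ t) - coord p m (γ' t)‖ ≤ ε * ‖t‖ := by
    intro ε hε
    obtain ⟨k, hk⟩ := ((tendsto_pow_mul_zero p t).eventually (hD.def hε)).exists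
    refine (hK3 _ h1 _ h2 k).trans ?_
    rw [← apply_natCast_mul hδ.le hh _ (h3.trans (min_le_left _ _)),
      ← apply_natCast_mul hδ'.le hh' _ (h3.trans (min_le_right _ _))]
    push_cast
    calc _ ≤ (p : ℝ) ^ k * (ε * ‖(p : ℚ_[p]) ^ k * t‖) := by gcongr
      _ = _ := by
        rw [norm_mul, norm_pow, Padic.norm_p, inv_pow]
        field_simp
  have h0 : ‖coord p m (γ t) - coord p m (γ' t)‖ ≤ 0 := by
    refine le_of_forall_pos_le_add fun ε hε => ?_
    refine (hsmall (ε / (‖t‖ + 1)) (by positivity)).trans ?_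
    rw [zero_add, div_mul_eq_mul_div, div_le_iff₀ (by positivity)]
    nlinarith [norm_nonneg t]
  have := sub_eq_zero.1 (norm_le_zero_iff.1 h0)
  rw [← hK2 _ h1, ← hK2 _ h2, this]

variable (G) in
theorem exists_analytic_isLocalOneParam (X : Fin m → ℚ_[p]) : ∃ γ : ℚ_[p] → G,
    IsLocalOneParam p γ X ∧ AnalyticAt ℚ_[p] (fun t => coord p m (γ t)) 0 := by
  obtain ⟨e, r, hr, h0, hc, ha, hd, hhom⟩ := exists_exp p m G
  have hlin : HasDerivAt (fun t : ℚ_[p] => t • X) X 0 := by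
    simpa using (hasDerivAt_id (0 : ℚ_[p])).smul_const X
  refine ⟨fun t => e (t • X), ⟨?_, ?_, ?_⟩, ?_⟩
  · exact ContinuousAt.comp (g := e) (by simpa using hc) hlin.continuousAt
  · have := HasFDerivAt.comp_hasDerivAt (l := fun x => coord p m (e x))
      (f := fun t : ℚ_[p] => t • X) (0 : ℚ_[p]) (by rw [zero_smul]; exact hd.hasFDerivAt) hlin
    rwa [ContinuousLinearMap.id_apply] at this
  · obtain ⟨k, hk⟩ : ∃ k : ℕ, ‖(p : ℚ_[p]) ^ k • X‖ < r := by
      have h : Tendsto (fun k : ℕ => (p : ℚ_[p]) ^ k) atTop (𝓝 0) :=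
        tendsto_pow_atTop_nhds_zero_of_norm_lt_one Padic.norm_p_lt_one
      have := (h.smul_const X).norm
      simp only [zero_smul, norm_zero] at this
      exact (this.eventually (gt_mem_nhds hr)).exists
    have hpk : (p : ℚ_[p]) ^ k ≠ 0 := pow_ne_zero _ (by exact_mod_cast (Fact.out : p.Prime).ne_zero)
    refine ⟨‖(p : ℚ_[p]) ^ k‖, norm_pos_iff.2 hpk, fun s t hs ht => ?_⟩
    have := hhom _ hk (s / (p : ℚ_[p]) ^ k) (t / (p : ℚ_[p]) ^ k)
      (by rw [norm_div]; exact div_le_one_of_le₀ hs (norm_nonneg _))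
      (by rw [norm_div]; exact div_le_one_of_le₀ ht (norm_nonneg _))
    rw [← add_div] at this
    simpa only [smul_smul, div_mul_cancel₀ _ hpk] using this
  · refine AnalyticAt.comp (g := fun x => coord p m (e x)) (f := fun t : ℚ_[p] => t • X)
      (by rw [zero_smul]; exact ha) ?_
    exact analyticAt_id.smul analyticAt_const

theorem IsLocalOneParam.analyticAt {γ : ℚ_[p] → G} {X : Fin m → ℚ_[p]}
    (h : IsLocalOneParam p γ X) : AnalyticAt ℚ_[p] (fun t => coord p m (γ t)) 0 := by
  obtain ⟨γ', h', ha⟩ := exists_analytic_isLocalOneParam G X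
  refine ha.congr ?_
  filter_upwards [h.eventuallyEq h'] with t ht
  rw [ht]

variable (p m G) in
/-- Surjectivity of the exponential near the identity. -/
theorem eventually_exists_isLocalOneParam : ∀ᶠ g in 𝓝 (1 : G), ∃ (γ : ℚ_[p] → G)
    (X : Fin m → ℚ_[p]), IsLocalOneParam p γ X ∧ γ 1 = g ∧
      ∀ s t : ℚ_[p], ‖s‖ ≤ 1 → ‖t‖ ≤ 1 → γ (s + t) = γ s * γ t := by
  obtain ⟨e, r, hr, h0, hc, ha, hd, hhom⟩ := exists_exp p m G
  have hsurj : ∀ᶠ x in 𝓝 (0 : Fin m → ℚ_[p]), ∃ X, ‖X‖ < r ∧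
      coordInv p m G (coord p m (e X)) = e X ∧ coord p m (e X) = x := by
    have hmap := hd.map_nhds_eq_of_equiv (f' := ContinuousLinearEquiv.refl ℚ_[p] (Fin m → ℚ_[p]))
    simp only [h0, coord_one] at hmap
    rw [← hmap, eventually_map]
    have e1 : ∀ᶠ X in 𝓝 (0 : Fin m → ℚ_[p]), coordInv p m G (coord p m (e X)) = e X :=
      hc.eventually (by rw [h0]; exact eventually_coordInv_coord p m)
    filter_upwards [Metric.ball_mem_nhds (0 : Fin m → ℚ_[p]) hr, e1] with X hX1 hX2
    exact ⟨X, by simpa using hX1, hX2, rfl⟩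
  have hsurj' : ∀ᶠ g in 𝓝 (1 : G), ∃ X, ‖X‖ < r ∧
      coordInv p m G (coord p m (e X)) = e X ∧ coord p m (e X) = coord p m g := by
    have := (continuousAt_coord p m (G := G)).tendsto
    rw [coord_one] at this
    exact this.eventually hsurj
  filter_upwards [hsurj', eventually_coordInv_coord p m (G := G)] with g ⟨X, hX, h1, h2⟩ hg
  have hlin : HasDerivAt (fun t : ℚ_[p] => t • X) X 0 := by
    simpa using (hasDerivAt_id (0 : ℚ_[p])).smul_const X
  refine ⟨fun t => e (t • X), X, ⟨?_, ?_, 1, one_pos, hhom X hX⟩, ?_, hhom X hX⟩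
  · exact ContinuousAt.comp (g := e) (by simpa using hc) hlin.continuousAt
  · have := HasFDerivAt.comp_hasDerivAt (l := fun x => coord p m (e x))
      (f := fun t : ℚ_[p] => t • X) (0 : ℚ_[p]) (by rw [zero_smul]; exact hd.hasFDerivAt) hlin
    rwa [ContinuousLinearMap.id_apply] at this
  · simp only [one_smul]
    rw [← h1, h2, hg]

theorem IsLocalOneParam.contMDiffAt {γ : ℚ_[p] → G} {X : Fin m → ℚ_[p]}
    (h : IsLocalOneParam p γ X) : ContMDiffAt 𝓘(ℚ_[p], ℚ_[p]) (model p m) ω γ 0 := by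
  refine (contMDiffAt_coordInv_comp (G := G) h.analyticAt
    (by simp [h.map_zero])).congr_of_eventuallyEq ?_
  have : ∀ᶠ t in 𝓝 0, coordInv p m G (coord p m (γ t)) = γ t :=
    h.continuousAt.eventually (by rw [h.map_zero]; exact eventually_coordInv_coord p m)
  exact this.mono fun t ht => ht.symm

end LocalOneParam

/-! ### One-parameter morphisms -/

section Curve

variable {p : ℕ} [Fact p.Prime] {G : Type*} [TopologicalSpace G] [Group G]

namespace OneParameterMorphism

/-- A one-parameter morphism as a function of the additive variable. -/
def curve (φ : OneParameterMorphism p G) (t : ℚ_[p]) : G := φ (Multiplicative.ofAdd t)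

theorem curve_add (φ : OneParameterMorphism p G) (s t : ℚ_[p]) :
    φ.curve (s + t) = φ.curve s * φ.curve t := map_mul φ _ _

@[simp] theorem curve_zero (φ : OneParameterMorphism p G) : φ.curve 0 = 1 := map_one φ

theorem curve_neg (φ : OneParameterMorphism p G) (t : ℚ_[p]) : φ.curve (-t) = (φ.curve t)⁻¹ :=
  map_inv φ _

theorem continuous_curve (φ : OneParameterMorphism p G) : Continuous φ.curve :=
  φ.continuous_toFun.comp continuous_ofAdd

theorem curve_natCast_mul (φ : OneParameterMorphism p G) (n : ℕ) (t : ℚ_[p]) :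
    φ.curve (n * t) = φ.curve t ^ n :=
  apply_natCast_mul (norm_nonneg t) (fun _ _ _ _ => φ.curve_add _ _) n le_rfl

/-- An additive function which is continuous at `0` is a one-parameter morphism. -/
def ofCurve [IsTopologicalGroup G] (f : ℚ_[p] → G) (hadd : ∀ s t, f (s + t) = f s * f t)
    (hc : ContinuousAt f 0) : OneParameterMorphism p G where
  toFun t := f t.toAdd
  map_one' := by
    have := hadd 0 0
    simpa using this
  map_mul' s t := hadd _ _
  continuous_toFun := by
    refine Continuous.comp (g := f) ?_ continuous_toAdd
    have h0 : f 0 = 1 := by simpa using hadd 0 0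
    refine continuous_iff_continuousAt.2 fun t => ?_
    have e : f = fun s => f t * f (s - t) := by
      ext s
      rw [← hadd, add_sub_cancel]
    rw [e]
    refine continuousAt_const.mul (ContinuousAt.comp (g := f) (by rwa [sub_self]) ?_)
    fun_prop

@[simp] theorem curve_ofCurve [IsTopologicalGroup G] (f : ℚ_[p] → G)
    (hadd : ∀ s t, f (s + t) = f s * f t) (hc : ContinuousAt f 0) (t : ℚ_[p]) :
    (ofCurve f hadd hc).curve t = f t := rfl

section Manifold

variable {m : ℕ} [ChartedSpace (Fin m → ℚ_[p]) G]

theorem hasDerivative_iff {φ : OneParameterMorphism p G} {X : Fin m → ℚ_[p]} :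
    φ.HasDerivative p (X : LieAlg p m G) ↔ IsLocalOneParam p φ.curve X := by
  refine ⟨fun h => ?_, fun h => h.hasDerivativeAtZero⟩
  obtain ⟨-, -, h⟩ := (hasDerivativeAtZero_iff p m).1 h
  exact ⟨φ.continuous_curve.continuousAt, h, 1, one_pos, fun s t _ _ => φ.curve_add s t⟩

theorem contMDiff_curve [LieGroup (model p m) ω G] {φ : OneParameterMorphism p G}
    {X : Fin m → ℚ_[p]} (h : IsLocalOneParam p φ.curve X) :
    ContMDiff 𝓘(ℚ_[p], ℚ_[p]) (model p m) ω φ.curve := by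
  intro t
  have e : φ.curve = fun s => φ.curve t * φ.curve (s - t) := by
    ext s
    rw [← curve_add, add_sub_cancel]
  rw [e]
  refine contMDiffAt_const.mul (ContMDiffAt.comp (g := φ.curve) t
    (by rw [sub_self]; exact h.contMDiffAt) ?_)
  exact contMDiffAt_id.sub contMDiffAt_const

end Manifold

end OneParameterMorphism

end Curve

/-! ### The bracket in coordinates -/

section Bracket

variable {p : ℕ} [Fact p.Prime] {m : ℕ} {G : Type*} [TopologicalSpace G]
  [ChartedSpace (Fin m → ℚ_[p]) G] [Group G] [LieGroup (model p m) ω G]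

/-- In the chart at the identity, the left invariant vector field of `X` is `x ↦ leftDeriv x X`. -/
theorem mfderiv_extChartAt_mul_left_eq_leftDeriv {x : Fin m → ℚ_[p]}
    (hx : extChartAt (model p m) (1 : G) 1 + x ∈ (extChartAt (model p m) (1 : G)).target)
    (hd : DifferentiableAt ℚ_[p] (mulCoord p m G) (x, 0)) (X : Fin m → ℚ_[p]) :
    mfderiv (model p m) (model p m) (extChartAt (model p m) (1 : G)) (coordInv p m G x)
      (mfderiv (model p m) (model p m) (fun h => coordInv p m G x * h) (1 : G) X) =
      leftDeriv p m G x X := by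
  set c := extChartAt (model p m) (1 : G) 1 with hc
  set g := coordInv p m G x
  have hgs : g ∈ (chartAt (Fin m → ℚ_[p]) (1 : G)).source := by
    rw [← extChartAt_source (model p m)]
    exact (extChartAt (model p m) (1 : G)).map_target hx
  have h1 : MDifferentiableAt (model p m) (model p m) (extChartAt (model p m) (1 : G)) (g * 1) := by
    rw [mul_one]
    exact mdifferentiableAt_extChartAt hgs
  have h2 : MDifferentiableAt (model p m) (model p m) (fun h => g * h) (1 : G) :=
    (contMDiff_mul_left (I := model p m) (n := ω) (a := g)).contMDiffAt.mdifferentiableAt (by simp)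
  have h3 := (h1.hasMFDerivAt.comp (1 : G) h2.hasMFDerivAt)
  set D : (Fin m → ℚ_[p]) →L[ℚ_[p]] (Fin m → ℚ_[p]) :=
    (mfderiv (model p m) (model p m) (extChartAt (model p m) (1 : G)) g).comp
      (mfderiv (model p m) (model p m) (fun h => g * h) (1 : G)) with hD
  have h4 : HasMFDerivAt (model p m) (model p m)
      (fun h => extChartAt (model p m) (1 : G) (g * h)) (1 : G)
      ((mfderiv (model p m) (model p m) (extChartAt (model p m) (1 : G)) g).comp
        (mfderiv (model p m) (model p m) (fun h => g * h) (1 : G))) := by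
    rw [mul_one] at h3
    exact h3
  have h5 : HasFDerivWithinAt (E := Fin m → ℚ_[p]) (F := Fin m → ℚ_[p])
      (fun y => extChartAt (model p m) (1 : G) (g * (extChartAt (model p m) (1 : G)).symm y))
      D (Set.range (model p m)) c := h4.2
  have h6 : HasFDerivAt (fun w : Fin m → ℚ_[p] => mulCoord p m G (x, w))
      (leftDeriv p m G x) 0 :=
    HasFDerivAt.comp (g := mulCoord p m G) (0 : Fin m → ℚ_[p]) hd.hasFDerivAt
      (hasFDerivAt_prodMk_right (𝕜 := ℚ_[p]) x (0 : Fin m → ℚ_[p]))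
  have hr : Set.range (model p m) = Set.univ := by simp
  rw [hr, hasFDerivWithinAt_univ] at h5
  have h7 : HasFDerivAt (fun w : Fin m → ℚ_[p] => mulCoord p m G (x, w))
      D 0 := by
    have h8 : HasFDerivAt (fun w : Fin m → ℚ_[p] => c + w) (ContinuousLinearMap.id _ _) 0 :=
      (hasFDerivAt_id (𝕜 := ℚ_[p]) (0 : Fin m → ℚ_[p])).const_add c
    have h9 := HasFDerivAt.comp (0 : Fin m → ℚ_[p]) (by rw [add_zero]; exact h5) h8
    exact h9.sub_const c
  exact DFunLike.congr_fun (h7.unique h6) X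

/-- The Lie bracket as the antisymmetrised derivative of the left invariant vector fields in
coordinates. -/
theorem lie_eq_fderiv_leftDeriv (X Y : LieAlg p m G) :
    ⁅X, Y⁆ =
      (fderiv ℚ_[p] (leftDeriv p m G) 0 X Y - fderiv ℚ_[p] (leftDeriv p m G) 0 Y X :
        Fin m → ℚ_[p]) := by
  set c := extChartAt (model p m) (1 : G) 1 with hc
  have hfield : ∀ X : Fin m → ℚ_[p], ∀ᶠ y in 𝓝 c,
      VectorField.mpullbackWithin 𝓘(ℚ_[p], Fin m → ℚ_[p]) (model p m)
        (extChartAt (model p m) (1 : G)).symm (mulInvariantVectorField (I := model p m)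
          (X : LieAlg p m G)) (Set.range (model p m)) y = leftDeriv p m G (y - c) X := by
    intro X
    have t : Tendsto (fun y : Fin m → ℚ_[p] => (y - c, (0 : Fin m → ℚ_[p]))) (𝓝 c) (𝓝 0) := by
      have : ContinuousAt (fun y : Fin m → ℚ_[p] => (y - c, (0 : Fin m → ℚ_[p]))) c := by fun_prop
      simpa [← Prod.mk_zero_zero] using this.tendsto
    filter_upwards [extChartAt_target_mem_nhds (I := model p m) (1 : G),
      t.eventually (analyticAt_mulCoord p m G).eventually_analyticAt] with y hy hd
    have e : coordInv p m G (y - c) = (extChartAt (model p m) (1 : G)).symm y := by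
      simp [coordInv, hc]
    have := mfderiv_extChartAt_mul_left_eq_leftDeriv (G := G) (x := y - c)
      (by rw [add_sub_cancel]; exact hy) hd.differentiableAt X
    rw [e] at this
    rw [← this]
    have hinv : (mfderivWithin (model p m) (model p m) (extChartAt (model p m) (1 : G)).symm
        (Set.range (model p m)) y).inverse = mfderiv (model p m) (model p m)
          (extChartAt (model p m) (1 : G)) ((extChartAt (model p m) (1 : G)).symm y) :=
      ContinuousLinearMap.inverse_eq (mfderivWithin_extChartAt_symm_comp_mfderiv_extChartAt hy)
        (mfderiv_extChartAt_comp_mfderivWithin_extChartAt_symm hy)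
    rw [VectorField.mpullbackWithin, hinv]
    rfl
  have hder : ∀ X Y : Fin m → ℚ_[p], fderiv ℚ_[p] (fun y => leftDeriv p m G (y - c) X) c Y =
      fderiv ℚ_[p] (leftDeriv p m G) 0 Y X := by
    intro X Y
    have h1 := (analyticAt_leftDeriv p m G).differentiableAt.hasFDerivAt
    have h2 : HasFDerivAt (fun y : Fin m → ℚ_[p] => y - c) (ContinuousLinearMap.id _ _) c :=
      (hasFDerivAt_id (𝕜 := ℚ_[p]) c).sub_const c
    have h3 := HasFDerivAt.comp c (by rw [sub_self]; exact h1) h2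
    have h4 := h3.clm_apply (hasFDerivAt_const X c)
    have := h4.fderiv
    simp only [Function.comp_def] at this
    rw [this]
    simp
  rw [GroupLieAlgebra.bracket_def, ← VectorField.mlieBracketWithin_univ,
    VectorField.mlieBracketWithin_apply, mfderiv_extChartAt_self]
  have hr : (extChartAt (model p m) (1 : G)).symm ⁻¹' Set.univ ∩ Set.range (model p m) =
    Set.univ := by simp
  rw [hr]
  change ContinuousLinearMap.inverse (ContinuousLinearMap.id ℚ_[p] (Fin m → ℚ_[p]))
    (VectorField.lieBracketWithin ℚ_[p] (E := Fin m → ℚ_[p]) _ _ Set.univ c) = _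
  rw [ContinuousLinearMap.inverse_id, ContinuousLinearMap.id_apply]
  refine (congrFun (VectorField.lieBracketWithin_univ (𝕜 := ℚ_[p])
    (E := Fin m → ℚ_[p])) c).trans ?_
  have := Filter.EventuallyEq.lieBracket_vectorField_eq (𝕜 := ℚ_[p]) (E := Fin m → ℚ_[p])
    (hfield X) (hfield Y)
  refine this.trans ?_
  have hz : ∀ Z : Fin m → ℚ_[p], leftDeriv p m G (c - c) Z = Z := by
    simp [leftDeriv_zero]
  exact congrArg₂ (· - ·)
    ((hder Y _).trans (congrArg (fun Z => fderiv ℚ_[p] (leftDeriv p m G) 0 Z Y) (hz X)))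
    ((hder X _).trans (congrArg (fun Z => fderiv ℚ_[p] (leftDeriv p m G) 0 Z X) (hz Y)))

end Bracket

/-! ### The adjoint action -/

section Ad

variable {p : ℕ} [Fact p.Prime] {m : ℕ} {G : Type*} [TopologicalSpace G]
  [ChartedSpace (Fin m → ℚ_[p]) G] [Group G]

/-- Chain rule for a map `Ψ` between Lie groups which is differentiable at the identity. -/
theorem hasFDerivAt_coord_comp {m' : ℕ} {G' : Type*} [TopologicalSpace G']
    [ChartedSpace (Fin m' → ℚ_[p]) G'] [Group G'] {F : Type*} [NormedAddCommGroup F]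
    [NormedSpace ℚ_[p] F] {Ψ : G → G'} {D : (Fin m → ℚ_[p]) →L[ℚ_[p]] (Fin m' → ℚ_[p])}
    (hΨ : HasFDerivAt (fun x => coord p m' (Ψ (coordInv p m G x))) D 0)
    {f : F → G} {f' : F →L[ℚ_[p]] (Fin m → ℚ_[p])} {x : F}
    (hf : HasFDerivAt (fun y => coord p m (f y)) f' x) (hfc : ContinuousAt f x) (hf1 : f x = 1) :
    HasFDerivAt (fun y => coord p m' (Ψ (f y))) (D.comp f') x := by
  have h := HasFDerivAt.comp (g := fun x => coord p m' (Ψ (coordInv p m G x)))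
    (f := fun y => coord p m (f y)) x (by rw [hf1, coord_one]; exact hΨ) hf
  refine h.congr_of_eventuallyEq ?_
  have : ∀ᶠ y in 𝓝 x, coordInv p m G (coord p m (f y)) = f y :=
    hfc.eventually (by rw [hf1]; exact eventually_coordInv_coord p m)
  exact this.mono fun y hy => by simp only [Function.comp_apply, hy]

theorem hasDerivAt_coord_comp {m' : ℕ} {G' : Type*} [TopologicalSpace G']
    [ChartedSpace (Fin m' → ℚ_[p]) G'] [Group G'] {Ψ : G → G'}
    {D : (Fin m → ℚ_[p]) →L[ℚ_[p]] (Fin m' → ℚ_[p])}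
    (hΨ : HasFDerivAt (fun x => coord p m' (Ψ (coordInv p m G x))) D 0)
    {f : ℚ_[p] → G} {f' : Fin m → ℚ_[p]} {x : ℚ_[p]}
    (hf : HasDerivAt (fun y => coord p m (f y)) f' x) (hfc : ContinuousAt f x) (hf1 : f x = 1) :
    HasDerivAt (fun y => coord p m' (Ψ (f y))) (D f') x := by
  have := (hasFDerivAt_coord_comp hΨ hf.hasFDerivAt hfc hf1).hasDerivAt
  simpa using this

/-- The adjoint action of `g` on the Lie algebra. -/
def Ad (g : G) : (Fin m → ℚ_[p]) →L[ℚ_[p]] (Fin m → ℚ_[p]) :=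
  fderiv ℚ_[p] (fun x => coord p m (g * coordInv p m G x * g⁻¹)) 0

variable [LieGroup (model p m) ω G]

theorem hasFDerivAt_coord_conj (g : G) :
    HasFDerivAt (fun x => coord p m (g * coordInv p m G x * g⁻¹)) (Ad (m := m) g) 0 := by
  have h : AnalyticAt ℚ_[p] (fun x => coord p m (g * coordInv p m G x * g⁻¹)) 0 := by
    refine analyticAt_coord_comp (f := fun x => g * coordInv p m G x * g⁻¹) ?_ (by simp)
    exact (contMDiffAt_const.mul
      (contMDiffAt_coordInv_comp (f := fun x => x) analyticAt_id rfl)).mul contMDiffAt_const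
  exact h.differentiableAt.hasFDerivAt

theorem Ad_one : Ad (p := p) (m := m) (1 : G) = ContinuousLinearMap.id _ _ := by
  refine (hasFDerivAt_coord_conj (1 : G)).unique ((hasFDerivAt_id _).congr_of_eventuallyEq ?_)
  filter_upwards [eventually_coord_coordInv p m (G := G)] with x hx
  simp [hx]

theorem Ad_mul (g h : G) : Ad (p := p) (m := m) (g * h) = (Ad g).comp (Ad h) := by
  have : IsTopologicalGroup G := topologicalGroup_of_lieGroup (model p m) ω
  have hc : ContinuousAt (fun x => h * coordInv p m G x * h⁻¹) 0 :=
    (continuousAt_const.mul (continuousAt_coordInv p m)).mul continuousAt_const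
  have := hasFDerivAt_coord_comp (Ψ := fun y : G => g * y * g⁻¹) (hasFDerivAt_coord_conj g)
    (hasFDerivAt_coord_conj h) hc (by simp)
  refine (hasFDerivAt_coord_conj (g * h)).unique ?_
  simpa only [mul_inv_rev, mul_assoc] using this

theorem IsLocalOneParam.conj {γ : ℚ_[p] → G} {X : Fin m → ℚ_[p]} (h : IsLocalOneParam p γ X)
    (g : G) : IsLocalOneParam p (fun t => g * γ t * g⁻¹) (Ad g X) := by
  have : IsTopologicalGroup G := topologicalGroup_of_lieGroup (model p m) ω
  obtain ⟨δ, hδ, hh⟩ := h.exists_hom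
  refine ⟨(continuousAt_const.mul h.continuousAt).mul continuousAt_const,
    hasDerivAt_coord_comp (Ψ := fun y : G => g * y * g⁻¹) (hasFDerivAt_coord_conj g) h.hasDerivAt
      h.continuousAt h.map_zero, δ, hδ, fun s t hs ht => ?_⟩
  rw [hh s t hs ht]
  group

variable (p m G) in
/-- The conjugation `(x, y) ↦ x y x⁻¹` in coordinates. -/
def conjCoord (z : (Fin m → ℚ_[p]) × (Fin m → ℚ_[p])) : Fin m → ℚ_[p] :=
  coord p m (coordInv p m G z.1 * coordInv p m G z.2 * (coordInv p m G z.1)⁻¹)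

variable (p m G) in
theorem analyticAt_conjCoord : AnalyticAt ℚ_[p] (conjCoord p m G) 0 := by
  have h1 := contMDiffAt_coordInv_comp (G := G) (x := (0 : (Fin m → ℚ_[p]) × (Fin m → ℚ_[p])))
    (f := Prod.fst) analyticAt_fst rfl
  have h2 := contMDiffAt_coordInv_comp (G := G) (x := (0 : (Fin m → ℚ_[p]) × (Fin m → ℚ_[p])))
    (f := Prod.snd) analyticAt_snd rfl
  exact analyticAt_coord_comp (f := fun z : (Fin m → ℚ_[p]) × (Fin m → ℚ_[p]) =>
      coordInv p m G z.1 * coordInv p m G z.2 * (coordInv p m G z.1)⁻¹)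
    ((h1.mul h2).mul h1.inv) (by simp)

variable (p m G) in
theorem tendsto_prodMk_zero : Tendsto (fun x : Fin m → ℚ_[p] => (x, (0 : Fin m → ℚ_[p])))
    (𝓝 0) (𝓝 0) :=
  (Continuous.prodMk_left (0 : Fin m → ℚ_[p])).tendsto _

variable (p m G) in
theorem eventually_Ad_coordInv : ∀ᶠ x in 𝓝 0, Ad (p := p) (m := m) (coordInv p m G x) =
    (fderiv ℚ_[p] (conjCoord p m G) (x, 0)).comp
      (ContinuousLinearMap.inr ℚ_[p] (Fin m → ℚ_[p]) (Fin m → ℚ_[p])) := by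
  filter_upwards [(tendsto_prodMk_zero p m).eventually
    (analyticAt_conjCoord p m G).eventually_analyticAt] with x hx
  have h1 : HasFDerivAt (fun y => conjCoord p m G (x, y))
      ((fderiv ℚ_[p] (conjCoord p m G) (x, 0)).comp
        (ContinuousLinearMap.inr ℚ_[p] (Fin m → ℚ_[p]) (Fin m → ℚ_[p]))) 0 :=
    HasFDerivAt.comp (g := conjCoord p m G) (0 : Fin m → ℚ_[p]) hx.differentiableAt.hasFDerivAt
      (hasFDerivAt_prodMk_right (𝕜 := ℚ_[p]) x (0 : Fin m → ℚ_[p]))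
  have h2 : HasFDerivAt (fun y => conjCoord p m G (x, y)) (Ad (coordInv p m G x)) 0 :=
    hasFDerivAt_coord_conj (coordInv p m G x)
  exact h2.unique h1

variable (p m G) in
theorem analyticAt_Ad_coordInv :
    AnalyticAt ℚ_[p] (fun x => Ad (p := p) (m := m) (coordInv p m G x)) 0 := by
  have h1 : AnalyticAt ℚ_[p] (fun x : Fin m → ℚ_[p] =>
      fderiv ℚ_[p] (conjCoord p m G) (x, (0 : Fin m → ℚ_[p]))) 0 :=
    AnalyticAt.comp (g := fderiv ℚ_[p] (conjCoord p m G)) (analyticAt_conjCoord p m G).fderiv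
      (analyticAt_id.prod analyticAt_const)
  refine AnalyticAt.congr ?_ ((eventually_Ad_coordInv p m G).mono fun x hx => hx.symm)
  exact (((ContinuousLinearMap.compL ℚ_[p] (Fin m → ℚ_[p]) _ (Fin m → ℚ_[p])).flip
    (ContinuousLinearMap.inr ℚ_[p] (Fin m → ℚ_[p]) (Fin m → ℚ_[p]))).analyticAt _).comp h1

variable (p m G) in
/-- Differentiating `(x y x⁻¹) x = x y` in `y`. -/
theorem eventually_fderiv_mulCoord_Ad : ∀ᶠ x in 𝓝 0, ∀ W,
    fderiv ℚ_[p] (mulCoord p m G) (0, x) (Ad (p := p) (m := m) (coordInv p m G x) W, 0) =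
      leftDeriv p m G x W := by
  have hC := analyticAt_conjCoord p m G
  have hF := analyticAt_mulCoord p m G
  have : IsTopologicalGroup G := topologicalGroup_of_lieGroup (model p m) ω
  have hid : ∀ᶠ z : (Fin m → ℚ_[p]) × (Fin m → ℚ_[p]) in 𝓝 0,
      mulCoord p m G (conjCoord p m G z, z.1) = mulCoord p m G z := by
    have hc1 : ContinuousAt (fun z : (Fin m → ℚ_[p]) × (Fin m → ℚ_[p]) => coordInv p m G z.1) 0 :=
      ContinuousAt.comp (g := coordInv p m G) (continuousAt_coordInv p m) continuousAt_fst
    have hc2 : ContinuousAt (fun z : (Fin m → ℚ_[p]) × (Fin m → ℚ_[p]) => coordInv p m G z.2) 0 :=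
      ContinuousAt.comp (g := coordInv p m G) (continuousAt_coordInv p m) continuousAt_snd
    have hc : ContinuousAt (fun z : (Fin m → ℚ_[p]) × (Fin m → ℚ_[p]) =>
      coordInv p m G z.1 * coordInv p m G z.2 * (coordInv p m G z.1)⁻¹) 0 :=
      (hc1.mul hc2).mul hc1.inv
    have := hc.eventually (p := fun g : G =>
      coordInv p m G (coord p m g) = g) (by simpa using eventually_coordInv_coord p m (G := G))
    filter_upwards [this] with z hz
    simp only [mulCoord, conjCoord]
    rw [hz, inv_mul_cancel_right]
  have t1 := tendsto_prodMk_zero p m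
  have t2 : Tendsto (fun x : Fin m → ℚ_[p] => ((0 : Fin m → ℚ_[p]), x)) (𝓝 0) (𝓝 0) :=
    (Continuous.prodMk_right (0 : Fin m → ℚ_[p])).tendsto _
  filter_upwards [t1.eventually hid.eventually_nhds, t1.eventually hC.eventually_analyticAt,
    t1.eventually hF.eventually_analyticAt, t2.eventually hF.eventually_analyticAt,
    eventually_Ad_coordInv p m G] with x h1 h2 h3 h4 h5 W
  have k0 : HasFDerivAt (fun y : Fin m → ℚ_[p] => (x, y)) _ 0 :=
    hasFDerivAt_prodMk_right (𝕜 := ℚ_[p]) x (0 : Fin m → ℚ_[p])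
  have k1 : HasFDerivAt (fun y => mulCoord p m G (x, y)) (leftDeriv p m G x) 0 :=
    HasFDerivAt.comp (g := mulCoord p m G) (0 : Fin m → ℚ_[p]) h3.differentiableAt.hasFDerivAt k0
  have k2 : HasFDerivAt (fun y => conjCoord p m G (x, y)) (Ad (coordInv p m G x)) 0 := by
    rw [h5]
    exact HasFDerivAt.comp (g := conjCoord p m G) (0 : Fin m → ℚ_[p])
      h2.differentiableAt.hasFDerivAt k0
  have e0 : conjCoord p m G (x, 0) = 0 := by simp [conjCoord]
  have k3 : HasFDerivAt (fun y => mulCoord p m G (conjCoord p m G (x, y), x))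
      ((fderiv ℚ_[p] (mulCoord p m G) (0, x)).comp ((Ad (coordInv p m G x)).prod 0)) 0 :=
    HasFDerivAt.comp (g := mulCoord p m G) (0 : Fin m → ℚ_[p])
      (by rw [e0]; exact h4.differentiableAt.hasFDerivAt)
      (k2.prodMk (hasFDerivAt_const x (0 : Fin m → ℚ_[p])))
  have k4 := k3.unique (k1.congr_of_eventuallyEq
    (k0.continuousAt.eventually h1))
  simpa using DFunLike.congr_fun k4 W

variable (p m G) in
/-- The derivative of `Ad` at the identity is the bracket. Differentiating `(x y x⁻¹) x = x y` in
`y` and then in `x` expresses it by second derivatives of the multiplication, whose symmetry gives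
the antisymmetrisation of the derivative of the left invariant vector fields. -/
theorem fderiv_Ad_coordInv (X W : LieAlg p m G) :
    fderiv ℚ_[p] (fun x => Ad (p := p) (m := m) (coordInv p m G x)) 0 X W = ⁅X, W⁆ := by
  have hF := analyticAt_mulCoord p m G
  have hA := (analyticAt_Ad_coordInv p m G).differentiableAt.hasFDerivAt
  have hV := (analyticAt_leftDeriv p m G).differentiableAt.hasFDerivAt
  set A' := fderiv ℚ_[p] (fun x => Ad (p := p) (m := m) (coordInv p m G x)) 0
  set V' := fderiv ℚ_[p] (leftDeriv p m G) 0 with hV'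
  have hF2 := hF.fderiv.differentiableAt.hasFDerivAt
  set F2 := fderiv ℚ_[p] (fderiv ℚ_[p] (mulCoord p m G)) 0
  have hsymm : ∀ v w, F2 v w = F2 w v :=
    hF.contDiffAt.isSymmSndFDerivAt (n := ω) (by simp)
  have hV2 : ∀ v w, V' v w = F2 (v, 0) (0, w) := by
    intro v w
    have h1 : HasFDerivAt (fun x : Fin m → ℚ_[p] => fderiv ℚ_[p] (mulCoord p m G) (x, 0))
        (F2.comp (ContinuousLinearMap.inl ℚ_[p] (Fin m → ℚ_[p]) (Fin m → ℚ_[p]))) 0 :=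
      HasFDerivAt.comp (g := fderiv ℚ_[p] (mulCoord p m G)) (0 : Fin m → ℚ_[p]) hF2
        (hasFDerivAt_prodMk_left (𝕜 := ℚ_[p]) (0 : Fin m → ℚ_[p]) (0 : Fin m → ℚ_[p]))
    have h2 := h1.clm_apply (hasFDerivAt_const ((0 : Fin m → ℚ_[p]), w) (0 : Fin m → ℚ_[p]))
    have h3 := hV.clm_apply (hasFDerivAt_const w (0 : Fin m → ℚ_[p]))
    have := DFunLike.congr_fun (h3.unique h2) v
    simpa using this
  have key : ∀ X W : Fin m → ℚ_[p], A' X W + V' W X = V' X W := by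
    intro X W
    have h1 : HasFDerivAt (fun x : Fin m → ℚ_[p] => fderiv ℚ_[p] (mulCoord p m G) (0, x))
        (F2.comp (ContinuousLinearMap.inr ℚ_[p] (Fin m → ℚ_[p]) (Fin m → ℚ_[p]))) 0 :=
      HasFDerivAt.comp (g := fderiv ℚ_[p] (mulCoord p m G)) (0 : Fin m → ℚ_[p]) hF2
        (hasFDerivAt_prodMk_right (𝕜 := ℚ_[p]) (0 : Fin m → ℚ_[p]) (0 : Fin m → ℚ_[p]))
    have h2 : HasFDerivAt (fun x : Fin m → ℚ_[p] =>
        (Ad (p := p) (m := m) (coordInv p m G x) W, (0 : Fin m → ℚ_[p]))) _ 0 :=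
      (hA.clm_apply (hasFDerivAt_const (W : Fin m → ℚ_[p]) (0 : Fin m → ℚ_[p]))).prodMk
        (hasFDerivAt_const (0 : Fin m → ℚ_[p]) (0 : Fin m → ℚ_[p]))
    have h3 := h1.clm_apply h2
    have h4 := hV.clm_apply (hasFDerivAt_const (W : Fin m → ℚ_[p]) (0 : Fin m → ℚ_[p]))
    have h5 := h3.unique (h4.congr_of_eventuallyEq
      ((eventually_fderiv_mulCoord_Ad p m G).mono fun x hx => hx W))
    have h6 := DFunLike.congr_fun h5 (X : Fin m → ℚ_[p])
    have h7 := (hasStrictFDerivAt_mulCoord p m (G := G)).hasFDerivAt.fderiv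
    rw [Prod.mk_zero_zero, h7] at h6
    rw [hV2 W X, hsymm]
    simpa [Ad_one] using h6
  rw [lie_eq_fderiv_leftDeriv]
  exact eq_sub_of_add_eq (key X W)

end Ad

/-! ### The adjoint action along a one-parameter subgroup -/

section AdFlow

variable {p : ℕ} [Fact p.Prime] {m : ℕ} {G : Type*} [TopologicalSpace G]
  [ChartedSpace (Fin m → ℚ_[p]) G] [Group G]

variable (p m G) in
/-- The adjoint action of a tangent vector, as the derivative of `Ad` at the identity. -/
def ad (X : Fin m → ℚ_[p]) : (Fin m → ℚ_[p]) →L[ℚ_[p]] (Fin m → ℚ_[p]) :=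
  fderiv ℚ_[p] (fun x => Ad (p := p) (m := m) (coordInv p m G x)) 0 X

variable [LieGroup (model p m) ω G]

theorem ad_apply (X Y : LieAlg p m G) : ad p m G X Y = ⁅X, Y⁆ := fderiv_Ad_coordInv p m G X Y

theorem IsLocalOneParam.analyticAt_Ad {γ : ℚ_[p] → G} {X : Fin m → ℚ_[p]}
    (h : IsLocalOneParam p γ X) :
    AnalyticAt ℚ_[p] (fun t => Ad (p := p) (m := m) (γ t)) 0 := by
  have h1 : AnalyticAt ℚ_[p] (fun t => Ad (p := p) (m := m) (coordInv p m G (coord p m (γ t)))) 0 :=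
    AnalyticAt.comp (g := fun x => Ad (p := p) (m := m) (coordInv p m G x))
      (by rw [h.map_zero, coord_one]; exact analyticAt_Ad_coordInv p m G) h.analyticAt
  have h2 : ∀ᶠ t in 𝓝 0, coordInv p m G (coord p m (γ t)) = γ t :=
    h.continuousAt.eventually (by rw [h.map_zero]; exact eventually_coordInv_coord p m)
  exact h1.congr (h2.mono fun t ht => by simp only [ht])

theorem IsLocalOneParam.hasDerivAt_Ad_zero {γ : ℚ_[p] → G} {X : Fin m → ℚ_[p]}
    (h : IsLocalOneParam p γ X) :
    HasDerivAt (fun t => Ad (p := p) (m := m) (γ t)) (ad p m G X) 0 := by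
  have h1 : HasDerivAt (fun t => Ad (p := p) (m := m) (coordInv p m G (coord p m (γ t))))
      (ad p m G X) 0 :=
    HasFDerivAt.comp_hasDerivAt (l := fun x => Ad (p := p) (m := m) (coordInv p m G x))
      (0 : ℚ_[p]) (by rw [h.map_zero, coord_one]
                      exact (analyticAt_Ad_coordInv p m G).differentiableAt.hasFDerivAt)
      h.hasDerivAt
  have h2 : ∀ᶠ t in 𝓝 0, coordInv p m G (coord p m (γ t)) = γ t :=
    h.continuousAt.eventually (by rw [h.map_zero]; exact eventually_coordInv_coord p m)
  exact h1.congr_of_eventuallyEq (h2.mono fun t ht => by simp only [ht])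

/-- `t ↦ Ad (γ t)` solves the linear differential equation `A' = A ∘ ad X`. -/
theorem IsLocalOneParam.eventually_hasDerivAt_Ad {γ : ℚ_[p] → G} {X : Fin m → ℚ_[p]}
    (h : IsLocalOneParam p γ X) : ∀ᶠ t in 𝓝 0,
    HasDerivAt (fun t => Ad (p := p) (m := m) (γ t)) ((Ad (γ t)).comp (ad p m G X)) t := by
  obtain ⟨δ, hδ, hh⟩ := h.exists_hom
  have hball : ∀ᶠ t : ℚ_[p] in 𝓝 0, ‖t‖ ≤ δ := by
    filter_upwards [Metric.closedBall_mem_nhds (0 : ℚ_[p]) hδ] with t ht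
    simpa using ht
  filter_upwards [hball.eventually_nhds] with t ht
  have ht0 := ht.self_of_nhds
  have h1 : HasDerivAt (fun s => Ad (p := p) (m := m) (γ (s - t))) (ad p m G X) t := by
    exact HasDerivAt.comp_sub_const t t (by rw [sub_self]; exact h.hasDerivAt_Ad_zero)
  have h2 : HasDerivAt (fun s => (Ad (p := p) (m := m) (γ t)).comp (Ad (γ (s - t))))
      ((Ad (γ t)).comp (ad p m G X)) t := by
    have := (hasDerivAt_const t (Ad (p := p) (m := m) (γ t))).clm_comp h1
    simpa using this
  refine h2.congr_of_eventuallyEq (ht.mono fun s hs => ?_)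
  simp only
  have hst : ‖s - t‖ ≤ δ := by
    rw [sub_eq_add_neg]
    exact (IsUltrametricDist.norm_add_le_max _ _).trans (max_le hs (by rwa [norm_neg]))
  rw [← Ad_mul, ← hh t (s - t) ht0 hst, add_sub_cancel]

/-- A continuous projection onto a subspace. -/
theorem exists_projection (S : Submodule ℚ_[p] (Fin m → ℚ_[p])) :
    ∃ P : (Fin m → ℚ_[p]) →L[ℚ_[p]] (Fin m → ℚ_[p]), (∀ x, P x ∈ S) ∧ ∀ x, P x = x ↔ x ∈ S := by
  obtain ⟨r, hr⟩ := LinearMap.exists_leftInverse_of_injective S.subtype S.ker_subtype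
  refine ⟨LinearMap.toContinuousLinearMap (S.subtype.comp r), fun x => (r x).2, fun x => ?_⟩
  refine ⟨fun h => h ▸ (r x).2, fun h => ?_⟩
  exact congrArg Subtype.val (DFunLike.congr_fun hr ⟨x, h⟩)

/-- A subspace preserved by `ad X` is preserved by `Ad (γ t)`: the component of `Ad (γ t)` from `S`
to a complement satisfies a linear differential equation, and vanishes at `0`. -/
theorem IsLocalOneParam.eventually_Ad_mem {γ : ℚ_[p] → G} {X : Fin m → ℚ_[p]}
    (h : IsLocalOneParam p γ X) (S : Submodule ℚ_[p] (Fin m → ℚ_[p]))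
    (hS : ∀ W ∈ S, ad p m G X W ∈ S) :
    ∀ᶠ t in 𝓝 0, ∀ W ∈ S, Ad (γ t) W ∈ S := by
  obtain ⟨P, hP, hPS⟩ := exists_projection S
  set Q := ContinuousLinearMap.id ℚ_[p] (Fin m → ℚ_[p]) - P with hQ
  have hder : ∀ᶠ t in 𝓝 0, HasDerivAt (fun t => Q.comp ((Ad (p := p) (m := m) (γ t)).comp P))
      ((Q.comp ((Ad (γ t)).comp P)).comp ((ad p m G X).comp P)) t := by
    filter_upwards [h.eventually_hasDerivAt_Ad] with t ht
    have h1 := (hasDerivAt_const t Q).clm_comp (ht.clm_comp (hasDerivAt_const t P))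
    refine h1.congr_deriv ?_
    ext1 W
    have : P (ad p m G X (P W)) = ad p m G X (P W) := (hPS _).2 (hS _ (hP W))
    simp [this]
  have hana : AnalyticAt ℚ_[p] (fun t => Q.comp ((Ad (p := p) (m := m) (γ t)).comp P)) 0 := by
    have h1 : AnalyticAt ℚ_[p] (fun t => (Ad (p := p) (m := m) (γ t)).comp P) 0 :=
      (((ContinuousLinearMap.compL ℚ_[p] (Fin m → ℚ_[p]) (Fin m → ℚ_[p])
        (Fin m → ℚ_[p])).flip P).analyticAt _).comp h.analyticAt_Ad
    exact ((ContinuousLinearMap.compL ℚ_[p] (Fin m → ℚ_[p]) (Fin m → ℚ_[p])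
        (Fin m → ℚ_[p]) Q).analyticAt _).comp h1
  have hz := eventuallyEq_zero_of_deriv_isBigO hana ?_ ?_
  · filter_upwards [hz] with t ht W hW
    have h1 := DFunLike.congr_fun ht W
    have h2 : P W = W := (hPS W).2 hW
    simp only [ContinuousLinearMap.comp_apply, hQ, sub_apply, h2, zero_apply,
      ContinuousLinearMap.id_apply] at h1
    exact (hPS _).1 (sub_eq_zero.1 h1).symm
  · rw [h.map_zero, Ad_one]
    ext1 W
    simp [hQ, (hPS (P W)).2 (hP W)]
  · refine IsBigO.of_bound ‖(ad p m G X).comp P‖ (hder.mono fun t ht => ?_)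
    rw [ht.deriv, mul_comm]
    exact ContinuousLinearMap.opNorm_comp_le _ _

/-- If `ad X` preserves `S` and sends `W` to `S`, then `Ad (γ t)` fixes `W` modulo `S`. -/
theorem IsLocalOneParam.eventually_Ad_sub_mem {γ : ℚ_[p] → G} {X : Fin m → ℚ_[p]}
    (h : IsLocalOneParam p γ X) (S : Submodule ℚ_[p] (Fin m → ℚ_[p]))
    (hS : ∀ W ∈ S, ad p m G X W ∈ S) {W : Fin m → ℚ_[p]} (hW : ad p m G X W ∈ S) :
    ∀ᶠ t in 𝓝 0, Ad (γ t) W - W ∈ S := by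
  obtain ⟨P, hP, hPS⟩ := exists_projection S
  set Q := ContinuousLinearMap.id ℚ_[p] (Fin m → ℚ_[p]) - P with hQ
  have hQS : ∀ x, Q x = 0 ↔ x ∈ S := fun x => by
    rw [← hPS, hQ, sub_apply, sub_eq_zero, ContinuousLinearMap.id_apply, eq_comm]
  have hder : ∀ᶠ t in 𝓝 0, HasDerivAt (fun t => Q (Ad (p := p) (m := m) (γ t) W - W)) 0 t := by
    filter_upwards [h.eventually_hasDerivAt_Ad, h.eventually_Ad_mem S hS] with t ht hts
    have h1 := (hasDerivAt_const t Q).clm_apply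
      ((ht.clm_apply (hasDerivAt_const t W)).sub_const W)
    refine h1.congr_deriv ?_
    simpa using (hQS _).2 (hts _ hW)
  have hana : AnalyticAt ℚ_[p] (fun t => Q (Ad (p := p) (m := m) (γ t) W - W)) 0 := by
    have h1 : AnalyticAt ℚ_[p] (fun t => Ad (p := p) (m := m) (γ t) W) 0 :=
      ((ContinuousLinearMap.apply ℚ_[p] (Fin m → ℚ_[p]) W).analyticAt _).comp h.analyticAt_Ad
    exact (Q.analyticAt _).comp (h1.sub analyticAt_const)
  have hz := eventuallyEq_zero_of_deriv_isBigO hana ?_ ?_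
  · exact hz.mono fun t ht => (hQS _).1 ht
  · simp [h.map_zero, Ad_one]
  · exact IsBigO.of_bound 0 (hder.mono fun t ht => by rw [ht.deriv]; simp)

/-- The converse of `IsLocalOneParam.eventually_Ad_mem`, for one vector: `ad X W` is the derivative
of `Ad (γ t) W`. -/
theorem IsLocalOneParam.ad_mem_of_eventually {γ : ℚ_[p] → G} {X : Fin m → ℚ_[p]}
    (h : IsLocalOneParam p γ X) (S : Submodule ℚ_[p] (Fin m → ℚ_[p])) {W : Fin m → ℚ_[p]}
    (hW : ∀ᶠ t in 𝓝 0, Ad (γ t) W ∈ S) : ad p m G X W ∈ S := by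
  obtain ⟨P, hP, hPS⟩ := exists_projection S
  have h1 := h.hasDerivAt_Ad_zero.clm_apply (hasDerivAt_const (0 : ℚ_[p]) W)
  have h2 := (hasDerivAt_const (0 : ℚ_[p]) P).clm_apply h1
  have h3 := h2.unique (h1.congr_of_eventuallyEq (hW.mono fun t ht => (hPS _).2 ht))
  refine (hPS _).1 ?_
  simpa using h3

end AdFlow

/-! ### Lie subgroups from local parametrisations -/

section LocalParam

variable {p : ℕ} [Fact p.Prime] {m : ℕ} {G : Type*} [TopologicalSpace G]
  [ChartedSpace (Fin m → ℚ_[p]) G] [Group G]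

/-- `N` is, near the identity, the image of the analytic immersion `Ψ`, with tangent space `S`. The
last field says that `Ψ` maps neighbourhoods of `0` to neighbourhoods of the identity in `N`, for
the topology induced by `G`. -/
structure IsLocalParam (N : Subgroup G) (S : Submodule ℚ_[p] (Fin m → ℚ_[p])) {d : ℕ}
    (Ψ : (Fin d → ℚ_[p]) → N) : Prop where
  contMDiffAt : ContMDiffAt (model p d) (model p m) ω (fun x => (Ψ x : G)) 0
  map_zero : Ψ 0 = 1
  ker_fderiv : ∀ v, fderiv ℚ_[p] (fun x => coord p m (Ψ x : G)) 0 v = 0 → v = 0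
  mem_iff : ∀ X, X ∈ S ↔ ∃ v, fderiv ℚ_[p] (fun x => coord p m (Ψ x : G)) 0 v = X
  eventually_mem_image : ∀ U ∈ 𝓝 (0 : Fin d → ℚ_[p]), ∀ᶠ g in 𝓝 (1 : G), ∀ h : g ∈ N,
    ∃ x ∈ U, Ψ x = ⟨g, h⟩

/-- A chart at the identity of the subgroup `N`, given by mutually inverse maps `Ψ` and `r`, where
`r` is the restriction to `N` of an analytic map of `G`. -/
structure SubgroupChart (p : ℕ) [Fact p.Prime] (m : ℕ) {G : Type*} [TopologicalSpace G]
    [ChartedSpace (Fin m → ℚ_[p]) G] [Group G] (N : Subgroup G) (d : ℕ) where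
  (Ψ : (Fin d → ℚ_[p]) → N) (r : G → Fin d → ℚ_[p])
  (K : Set G) (B : Set (Fin d → ℚ_[p]))
  isOpen_K : IsOpen K
  isOpen_B : IsOpen B
  one_mem : (1 : G) ∈ K
  zero_mem : 0 ∈ B
  map_zero : Ψ 0 = 1
  contMDiffOn_Ψ : ContMDiffOn (model p d) (model p m) ω (fun x => (Ψ x : G)) B
  contMDiffOn_r : ContMDiffOn (model p m) (model p d) ω r K
  r_Ψ : ∀ x ∈ B, r (Ψ x) = x
  r_mem : ∀ g : N, (g : G) ∈ K → r g ∈ B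
  Ψ_r : ∀ g : N, (g : G) ∈ K → Ψ (r g) = g

theorem IsLocalParam.analyticAt {N : Subgroup G} {S : Submodule ℚ_[p] (Fin m → ℚ_[p])} {d : ℕ}
    {Ψ : (Fin d → ℚ_[p]) → N} (h : IsLocalParam N S Ψ) :
    AnalyticAt ℚ_[p] (fun x => coord p m (Ψ x : G)) 0 :=
  analyticAt_coord_comp (f := fun x => (Ψ x : G)) h.contMDiffAt (by simp [h.map_zero])

/-- An analytic immersion has an analytic left inverse. -/
theorem exists_analytic_left_inverse {d : ℕ} {f : (Fin d → ℚ_[p]) → Fin m → ℚ_[p]}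
    (hf : AnalyticAt ℚ_[p] f 0) (h0 : f 0 = 0) (hker : ∀ v, fderiv ℚ_[p] f 0 v = 0 → v = 0) :
    ∃ r : (Fin m → ℚ_[p]) → Fin d → ℚ_[p], AnalyticAt ℚ_[p] r 0 ∧ r 0 = 0 ∧
      ∀ᶠ x in 𝓝 0, r (f x) = x := by
  obtain ⟨l, hl⟩ := LinearMap.exists_leftInverse_of_injective
    (fderiv ℚ_[p] f 0 : (Fin d → ℚ_[p]) →ₗ[ℚ_[p]] (Fin m → ℚ_[p]))
    (LinearMap.ker_eq_bot'.2 hker)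
  set L : (Fin m → ℚ_[p]) →L[ℚ_[p]] (Fin d → ℚ_[p]) := LinearMap.toContinuousLinearMap l
  have hβa : AnalyticAt ℚ_[p] (fun x => L (f x)) 0 := (L.analyticAt _).comp hf
  have hβ : HasStrictFDerivAt (fun x => L (f x))
      (ContinuousLinearEquiv.refl ℚ_[p] (Fin d → ℚ_[p]) :
        (Fin d → ℚ_[p]) →L[ℚ_[p]] (Fin d → ℚ_[p])) 0 := by
    refine (L.hasStrictFDerivAt.comp (0 : Fin d → ℚ_[p]) hf.hasStrictFDerivAt).congr_fderiv ?_
    ext1 v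
    exact DFunLike.congr_fun hl v
  have hinv : AnalyticAt ℚ_[p] (hβ.localInverse _ _ _) (L (f 0)) :=
    OpenPartialHomeomorph.analyticAt_symm' (hβ.toOpenPartialHomeomorph _)
      (i := ContinuousLinearEquiv.refl ℚ_[p] (Fin d → ℚ_[p])) hβ.mem_toOpenPartialHomeomorph_source
      hβa hβ.hasFDerivAt.fderiv
  refine ⟨fun y => hβ.localInverse _ _ _ (L y), ?_, ?_, hβ.eventually_left_inverse⟩
  · exact AnalyticAt.comp (g := hβ.localInverse _ _ _) (by simpa [h0] using hinv) (L.analyticAt 0)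
  · have := hβ.eventually_left_inverse.self_of_nhds
    simpa [h0] using this

/-- A curve in `N`, differentiable at `0` as a curve in `G`, is tangent to `S`. -/
theorem IsLocalParam.mem_of_hasDerivAt {N : Subgroup G} {S : Submodule ℚ_[p] (Fin m → ℚ_[p])}
    {d : ℕ} {Ψ : (Fin d → ℚ_[p]) → N} (h : IsLocalParam N S Ψ) {c : ℚ_[p] → G}
    {Z : Fin m → ℚ_[p]} (hc : ContinuousAt c 0) (h1 : c 0 = 1) (hN : ∀ᶠ t in 𝓝 0, c t ∈ N)
    (hZ : HasDerivAt (fun t => coord p m (c t)) Z 0) : Z ∈ S := by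
  obtain ⟨r, hra, hr0, hr⟩ := exists_analytic_left_inverse h.analyticAt (by simp [h.map_zero])
    h.ker_fderiv
  have e : ∀ᶠ t in 𝓝 0, coord p m (Ψ (r (coord p m (c t))) : G) = coord p m (c t) := by
    filter_upwards [hN, hc.eventually (by rw [h1]; exact h.eventually_mem_image _ hr)]
      with t ht1 ht2
    obtain ⟨x, hx, hxt⟩ := ht2 ht1
    have : (Ψ x : G) = c t := congrArg Subtype.val hxt
    rw [← this, show r (coord p m (Ψ x : G)) = x from hx]
  have k1 : HasDerivAt (fun t => r (coord p m (c t))) _ 0 :=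
    HasFDerivAt.comp_hasDerivAt (l := r) (0 : ℚ_[p])
      (by rw [h1, coord_one]; exact hra.differentiableAt.hasFDerivAt) hZ
  have k2 : HasDerivAt (fun t => coord p m (Ψ (r (coord p m (c t))) : G)) _ 0 :=
    HasFDerivAt.comp_hasDerivAt (l := fun x => coord p m (Ψ x : G)) (0 : ℚ_[p])
      (by rw [h1, coord_one, hr0]; exact h.analyticAt.differentiableAt.hasFDerivAt) k1
  exact (h.mem_iff Z).2 ⟨_, k2.unique (hZ.congr_of_eventuallyEq e)⟩

/-- The derivative at the identity of a morphism of Lie groups, in coordinates. -/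
theorem mfderiv_one_eq_fderiv_coord {d : ℕ} {N : Type*} [TopologicalSpace N]
    [ChartedSpace (Fin d → ℚ_[p]) N] [Group N] {f : N → G} (h1 : f 1 = 1)
    (hf : MDifferentiableAt (model p d) (model p m) f 1) (v : Fin d → ℚ_[p]) :
    mfderiv (model p d) (model p m) f 1 v =
      fderiv ℚ_[p] (fun x => coord p m (f (coordInv p d N x))) 0 v := by
  have hr : Set.range (model p d) = Set.univ := by simp
  refine (DFunLike.congr_fun hf.mfderiv v).trans ?_
  change fderivWithin ℚ_[p] (E := Fin d → ℚ_[p]) (F := Fin m → ℚ_[p])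
    (writtenInExtChartAt (model p d) (model p m) 1 f) (Set.range (model p d))
    (extChartAt (model p d) (1 : N) 1) v = _
  rw [hr, fderivWithin_univ]
  have : (fun x => coord p m (f (coordInv p d N x))) = fun x =>
      (fun y => writtenInExtChartAt (model p d) (model p m) 1 f y -
        extChartAt (model p m) (1 : G) 1) (extChartAt (model p d) (1 : N) 1 + x) := by
    ext1 x
    simp only [writtenInExtChartAt, coord, coordInv, Function.comp_apply, h1]
  have k := fderiv_comp_add_left (𝕜 := ℚ_[p]) (x := (0 : Fin d → ℚ_[p])) (f := fun y =>
    writtenInExtChartAt (model p d) (model p m) 1 f y - extChartAt (model p m) (1 : G) 1)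
    (extChartAt (model p d) (1 : N) 1)
  have k2 := fderiv_sub_const (𝕜 := ℚ_[p]) (x := extChartAt (model p d) (1 : N) 1)
    (f := writtenInExtChartAt (model p d) (model p m) 1 f) (extChartAt (model p m) (1 : G) 1)
  rw [add_zero] at k
  rw [this]
  exact (DFunLike.congr_fun (k.trans k2) v).symm

theorem IsLocalOneParam.map {d : ℕ} {N : Type*} [TopologicalSpace N]
    [ChartedSpace (Fin d → ℚ_[p]) N] [Group N] {f : N →* G}
    {D : (Fin d → ℚ_[p]) →L[ℚ_[p]] (Fin m → ℚ_[p])} {γ : ℚ_[p] → N} {X : Fin d → ℚ_[p]}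
    (h : IsLocalOneParam p γ X)
    (hf : ContinuousAt f 1) (hD : HasFDerivAt (fun x => coord p m (f (coordInv p d N x))) D 0) :
    IsLocalOneParam p (fun t => f (γ t)) (D X) := by
  obtain ⟨δ, hδ, hh⟩ := h.exists_hom
  refine ⟨ContinuousAt.comp (g := f) (by rwa [h.map_zero]) h.continuousAt,
    hasDerivAt_coord_comp hD h.hasDerivAt h.continuousAt h.map_zero, δ, hδ, fun s t hs ht => ?_⟩
  rw [hh s t hs ht, map_mul]

variable [LieGroup (model p m) ω G]

theorem IsLocalParam.exists_subgroupChart {N : Subgroup G}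
    {S : Submodule ℚ_[p] (Fin m → ℚ_[p])} {d : ℕ} {Ψ : (Fin d → ℚ_[p]) → N}
    (h : IsLocalParam N S Ψ) : ∃ c : SubgroupChart p m N d, c.Ψ = Ψ := by
  obtain ⟨r, hra, hr0, hr⟩ := exists_analytic_left_inverse h.analyticAt (by simp [h.map_zero])
    h.ker_fderiv
  have hrc : ContMDiffAt (model p m) (model p d) ω (fun g : G => r (coord p m g)) 1 :=
    ContMDiffAt.comp (g := r) (1 : G)
      (by rw [coord_one]; exact contMDiffAt_iff_contDiffAt.2 hra.contDiffAt) (contMDiffAt_coord p m)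
  obtain ⟨B, hB, hBo, hB0⟩ := mem_nhds_iff.1
    (hr.and ((contMDiffAt_iff_contMDiffAt_nhds (by simp)).1 h.contMDiffAt))
  obtain ⟨K, hK, hKo, hK1⟩ := mem_nhds_iff.1
    ((h.eventually_mem_image B (hBo.mem_nhds hB0)).and
      ((contMDiffAt_iff_contMDiffAt_nhds (by simp)).1 hrc))
  have hmem : ∀ g : N, (g : G) ∈ K → ∃ x ∈ B, Ψ x = g := fun g hg => (hK hg).1 g.2
  refine ⟨⟨Ψ, fun g => r (coord p m g), K, B, hKo, hBo, hK1, hB0, h.map_zero,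
    fun x hx => (hB hx).2.contMDiffWithinAt, fun g hg => (hK hg).2.contMDiffWithinAt,
    fun x hx => (hB hx).1, fun g hg => ?_, fun g hg => ?_⟩, rfl⟩
  · obtain ⟨x, hx, rfl⟩ := hmem g hg
    rwa [(hB hx).1]
  · obtain ⟨x, hx, rfl⟩ := hmem g hg
    rw [(hB hx).1]

namespace SubgroupChart

variable {N : Subgroup G} {d : ℕ} (c : SubgroupChart p m N d)

/-- The translate by `g` of the chart at the identity. -/
def chart (g : N) : OpenPartialHomeomorph N (Fin d → ℚ_[p]) where
  toFun h := c.r ((g⁻¹ * h : N) : G)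
  invFun x := g * c.Ψ x
  source := {h | ((g⁻¹ * h : N) : G) ∈ c.K}
  target := c.B ∩ {x | (c.Ψ x : G) ∈ c.K}
  map_source' h hh := ⟨c.r_mem _ hh, by
    rw [Set.mem_ofPred_eq, c.Ψ_r _ hh]
    exact hh⟩
  map_target' x hx := by
    rw [Set.mem_ofPred_eq, inv_mul_cancel_left]
    exact hx.2
  left_inv' h hh := by
    rw [c.Ψ_r _ hh, mul_inv_cancel_left]
  right_inv' x hx := by
    rw [inv_mul_cancel_left, c.r_Ψ x hx.1]
  open_source := by
    have : IsTopologicalGroup G := topologicalGroup_of_lieGroup (model p m) ω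
    exact c.isOpen_K.preimage (by fun_prop)
  open_target := c.contMDiffOn_Ψ.continuousOn.isOpen_inter_preimage c.isOpen_B c.isOpen_K
  continuousOn_toFun := by
    have : IsTopologicalGroup G := topologicalGroup_of_lieGroup (model p m) ω
    exact c.contMDiffOn_r.continuousOn.comp (f := fun h : N => ((g⁻¹ * h : N) : G))
      (by fun_prop) fun h hh => hh
  continuousOn_invFun := by
    have : IsTopologicalGroup G := topologicalGroup_of_lieGroup (model p m) ω
    have h1 : ContinuousOn c.Ψ c.B :=
      Topology.IsInducing.subtypeVal.continuousOn_iff.2 c.contMDiffOn_Ψ.continuousOn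
    exact continuousOn_const.mul (h1.mono Set.inter_subset_left)

theorem mem_chart_source (g : N) : g ∈ (c.chart g).source := by
  change ((g⁻¹ * g : N) : G) ∈ c.K
  simpa using c.one_mem

/-- The atlas of a subgroup made of all the translates of a chart at the identity. -/
@[reducible] def chartedSpace : ChartedSpace (Fin d → ℚ_[p]) N where
  atlas := Set.range c.chart
  chartAt := c.chart
  mem_chart_source := c.mem_chart_source
  chart_mem_atlas g := ⟨g, rfl⟩

theorem contMDiffOn_coe_mul_Ψ (g : G) :
    ContMDiffOn (model p d) (model p m) ω (fun x => g * (c.Ψ x : G)) c.B :=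
  contMDiffOn_const.mul c.contMDiffOn_Ψ

theorem isManifold : letI := c.chartedSpace; IsManifold (model p d) ω N := by
  let := c.chartedSpace
  refine isManifold_of_contDiffOn _ _ _ ?_
  rintro _ _ ⟨g, rfl⟩ ⟨g', rfl⟩
  have h1 : ContMDiffOn (model p d) (model p d) ω
      (fun x => c.r ((g'⁻¹ * g : N) * (c.Ψ x : G)))
      (c.B ∩ {x | ((g'⁻¹ * g : N) * (c.Ψ x : G) : G) ∈ c.K}) :=
    c.contMDiffOn_r.comp ((c.contMDiffOn_coe_mul_Ψ _).mono Set.inter_subset_left)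
      fun x hx => hx.2
  refine ((contMDiffOn_iff_contDiffOn.1 h1).mono ?_).congr ?_
  · rintro x ⟨⟨hx1, hx2⟩, -⟩
    refine ⟨hx1.1, ?_⟩
    have : ((g'⁻¹ * (g * c.Ψ x) : N) : G) ∈ c.K := hx2
    simpa [mul_assoc] using this
  · intro x hx
    change c.r ((g'⁻¹ * (g * c.Ψ x) : N) : G) = _
    simp [mul_assoc]

theorem contMDiff_coe : letI := c.chartedSpace;
    ContMDiff (model p d) (model p m) ω (fun g : N => (g : G)) := by
  let := c.chartedSpace
  have := c.isManifold
  intro g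
  have h1 : ContMDiffAt (model p d) (model p d) ω (c.chart g) g :=
    contMDiffOn_chart.contMDiffAt (chart_source_mem_nhds (Fin d → ℚ_[p]) g)
  have hmem := c.mem_chart_source g
  have h2 : ContMDiffAt (model p d) (model p m) ω
      (fun h : N => (g : G) * (c.Ψ (c.chart g h) : G)) g :=
    ContMDiffAt.comp (g := fun x => (g : G) * (c.Ψ x : G)) g
      ((c.contMDiffOn_coe_mul_Ψ g).contMDiffAt
        (c.isOpen_B.mem_nhds ((c.chart g).map_source hmem).1)) h1
  refine h2.congr_of_eventuallyEq ?_
  filter_upwards [(c.chart g).open_source.mem_nhds hmem] with h hh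
  exact congrArg Subtype.val ((c.chart g).left_inv hh).symm

/-- The inclusion of the subgroup detects analyticity. -/
theorem contMDiffAt_of_coe {F : Type*} [NormedAddCommGroup F] [NormedSpace ℚ_[p] F]
    {H : Type*} [TopologicalSpace H] {I : ModelWithCorners ℚ_[p] F H} {M : Type*}
    [TopologicalSpace M] [ChartedSpace H M] {f : M → N} {x : M}
    (hf : ContMDiffAt I (model p m) ω (fun y => (f y : G)) x) :
    let := c.chartedSpace; ContMDiffAt I (model p d) ω f x := by
  let := c.chartedSpace
  have := c.isManifold
  have hc : ContinuousAt f x :=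
    Topology.IsInducing.subtypeVal.continuousAt_iff.2 hf.continuousAt
  have hmem := c.mem_chart_source (f x)
  have h1 : ContMDiffAt I (model p d) ω (fun y => c.chart (f x) (f y)) x := by
    refine ContMDiffAt.comp (I' := model p m) (g := c.r)
      (f := fun y => (((f x)⁻¹ * f y : N) : G)) x ?_ ?_
    · exact c.contMDiffOn_r.contMDiffAt (c.isOpen_K.mem_nhds hmem)
    · exact (contMDiffAt_const (c := (((f x)⁻¹ : N) : G))).mul hf
  have h2 : ContMDiffAt I (model p d) ω (fun y => (c.chart (f x)).symm (c.chart (f x) (f y))) x :=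
    ContMDiffAt.comp (g := (c.chart (f x)).symm) x
      (contMDiffOn_chart_symm.contMDiffAt
        ((c.chart (f x)).open_target.mem_nhds ((c.chart (f x)).map_source hmem))) h1
  refine h2.congr_of_eventuallyEq ?_
  filter_upwards [hc ((c.chart (f x)).open_source.mem_nhds hmem)] with y hy
  exact ((c.chart (f x)).left_inv hy).symm

theorem lieGroup : letI := c.chartedSpace; LieGroup (model p d) ω N := by
  let := c.chartedSpace
  have := c.isManifold
  exact
    { contMDiff_mul := fun z => c.contMDiffAt_of_coe
        (ContMDiff.mul (c.contMDiff_coe.comp contMDiff_fst)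
          (c.contMDiff_coe.comp contMDiff_snd)).contMDiffAt
      contMDiff_inv := fun z => c.contMDiffAt_of_coe c.contMDiff_coe.inv.contMDiffAt }

theorem coordInv_eq (x : Fin d → ℚ_[p]) : letI := c.chartedSpace; coordInv p d N x = c.Ψ x := by
  let := c.chartedSpace
  have h0 : c.r ((1 : N) : G) = 0 := by
    rw [← c.map_zero]
    exact c.r_Ψ 0 c.zero_mem
  change 1 * c.Ψ (c.r ((1⁻¹ * 1 : N) : G) + x) = _
  rw [inv_one, one_mul, one_mul, h0, zero_add]

end SubgroupChart

section Hom

variable {d : ℕ} {N : Type*} [TopologicalSpace N] [ChartedSpace (Fin d → ℚ_[p]) N] [Group N]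
  {f : N →* G} {D : (Fin d → ℚ_[p]) →L[ℚ_[p]] (Fin m → ℚ_[p])}

variable [LieGroup (model p d) ω N]

theorem map_Ad (hf : Continuous f)
    (hD : HasFDerivAt (fun x => coord p m (f (coordInv p d N x))) D 0) (g : N)
    (X : Fin d → ℚ_[p]) : D (Ad g X) = Ad (f g) (D X) := by
  have : IsTopologicalGroup N := topologicalGroup_of_lieGroup (model p d) ω
  have h1 := hasFDerivAt_coord_comp (Ψ := f) (f := fun x => g * coordInv p d N x * g⁻¹) hD
    (hasFDerivAt_coord_conj g)
    ((continuousAt_const.mul (continuousAt_coordInv p d)).mul continuousAt_const) (by simp)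
  have h2 := hasFDerivAt_coord_comp (Ψ := fun y : G => f g * y * (f g)⁻¹)
    (f := fun x => f (coordInv p d N x)) (hasFDerivAt_coord_conj (f g)) hD
    (hf.continuousAt.comp (continuousAt_coordInv p d)) (by simp)
  simp only [map_mul, map_inv] at h1
  exact DFunLike.congr_fun (h1.unique h2) X

/-- The derivative of a morphism of Lie groups is compatible with the brackets. -/
theorem map_ad (hf : Continuous f)
    (hD : HasFDerivAt (fun x => coord p m (f (coordInv p d N x))) D 0)
    (X Y : Fin d → ℚ_[p]) : D (ad p d N X Y) = ad p m G (D X) (D Y) := by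
  obtain ⟨γ, hγ, -⟩ := exists_analytic_isLocalOneParam N X
  have h1 := hγ.hasDerivAt_Ad_zero.clm_apply (hasDerivAt_const (0 : ℚ_[p]) Y)
  have h2 := (hasDerivAt_const (0 : ℚ_[p]) D).clm_apply h1
  have h3 := (hγ.map hf.continuousAt hD).hasDerivAt_Ad_zero.clm_apply
    (hasDerivAt_const (0 : ℚ_[p]) (D Y))
  simp only [map_Ad hf hD] at h2
  simpa using h2.unique h3

end Hom

namespace IsLocalParam

variable {N : Subgroup G} {S : Submodule ℚ_[p] (Fin m → ℚ_[p])} {d : ℕ}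
  {Ψ : (Fin d → ℚ_[p]) → N}

/-- A closed subgroup with a local parametrisation is a Lie subgroup. -/
theorem exists_isLieSubgroup (h : IsLocalParam N S Ψ) (hN : IsClosed (N : Set G)) :
    ∃ (_ : ChartedSpace (Fin d → ℚ_[p]) N) (_ : IsLieSubgroup p (m := m) N d)
      (D : (Fin d → ℚ_[p]) →L[ℚ_[p]] (Fin m → ℚ_[p])),
      subgroupLieAlg p (m := m) N d = (S : Set (Fin m → ℚ_[p])) ∧
      HasFDerivAt (fun x => coord p m (N.subtype (coordInv p d N x))) D 0 ∧
      (∀ v, D v = 0 → v = 0) ∧ ∀ X, X ∈ S ↔ ∃ v, D v = X := by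
  obtain ⟨c, rfl⟩ := h.exists_subgroupChart
  let := c.chartedSpace
  have e : (fun x => coord p m (N.subtype (coordInv p d N x))) =
      fun x => coord p m (c.Ψ x : G) := by
    ext1 x
    rw [c.coordInv_eq]
    rfl
  have hm : ∀ v : Fin d → ℚ_[p],
      mfderiv (model p d) (model p m) (fun g : N => (g : G)) 1 v =
        fderiv ℚ_[p] (fun x => coord p m (c.Ψ x : G)) 0 v := by
    intro v
    rw [mfderiv_one_eq_fderiv_coord (f := fun g : N => (g : G)) rfl
      (c.contMDiff_coe.contMDiffAt.mdifferentiableAt (by simp))]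
    exact congrArg (fun F => fderiv ℚ_[p] F 0 v) e
  refine ⟨c.chartedSpace, ⟨hN, c.lieGroup, c.contMDiff_coe, ?_⟩, _, ?_,
    e ▸ h.analyticAt.differentiableAt.hasFDerivAt, h.ker_fderiv, h.mem_iff⟩
  · refine (injective_iff_map_eq_zero _).2 fun v hv => h.ker_fderiv v ?_
    exact (hm v).symm.trans hv
  · ext X
    refine Iff.trans ?_ (h.mem_iff X).symm
    exact exists_congr fun v => ⟨fun e => (hm v).symm.trans e, fun e => (hm v).trans e⟩

theorem exists_isLocalOneParam (h : IsLocalParam N S Ψ) (hN : IsClosed (N : Set G))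
    {X : Fin m → ℚ_[p]} (hX : X ∈ S) :
    ∃ γ : ℚ_[p] → N, IsLocalOneParam p (fun t => (γ t : G)) X := by
  obtain ⟨hch, hL, D, -, hD, -, hD2⟩ := h.exists_isLieSubgroup hN
  have := hL.lieGroup
  obtain ⟨v, rfl⟩ := (hD2 X).1 hX
  obtain ⟨γ, hγ, -⟩ := exists_analytic_isLocalOneParam N v
  exact ⟨γ, hγ.map (f := N.subtype) continuous_subtype_val.continuousAt hD⟩

end IsLocalParam

end LocalParam

/-! ### Unique roots -/

section Roots

variable {G : Type*} [Group G]

/-- Every element of `N` has a unique `p`-th root in `N`. -/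
def HasUniqueRoots (p : ℕ) (N : Subgroup G) : Prop := ∀ x ∈ N, ∃! y, y ∈ N ∧ y ^ p = x

theorem HasUniqueRoots.pow {p : ℕ} {N : Subgroup G} (h : HasUniqueRoots p N) (k : ℕ) :
    HasUniqueRoots (p ^ k) N := by
  induction k with
  | zero =>
    intro x hx
    exact ⟨x, ⟨hx, by simp⟩, fun y hy => by simpa using hy.2⟩
  | succ k ih =>
    intro x hx
    obtain ⟨y, ⟨hy, rfl⟩, hyu⟩ := h x hx
    obtain ⟨z, ⟨hz, rfl⟩, hzu⟩ := ih y hy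
    refine ⟨z, ⟨hz, by rw [pow_succ, pow_mul]⟩, fun w hw => hzu w ⟨hw.1, ?_⟩⟩
    exact hyu _ ⟨pow_mem hw.1 _, by rw [← pow_mul, ← pow_succ, hw.2]⟩

theorem HasUniqueRoots.eq_of_pow_eq {p : ℕ} {N : Subgroup G} (h : HasUniqueRoots p N) {x y : G}
    (hx : x ∈ N) (hy : y ∈ N) (hxy : x ^ p = y ^ p) : x = y :=
  (h _ (pow_mem hy p)).unique ⟨hx, hxy⟩ ⟨hy, rfl⟩

/-- With unique `p`-th roots, elements commute as soon as their `p`-th powers do. -/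
theorem HasUniqueRoots.commute_of_commute_pow {p : ℕ} {N : Subgroup G} (h : HasUniqueRoots p N)
    {x y : G} (hx : x ∈ N) (hy : y ∈ N) (hxy : Commute (x ^ p) (y ^ p)) : Commute x y := by
  have key : ∀ {a b : G}, a ∈ N → b ∈ N → Commute (a ^ p) b → Commute a b := by
    intro a b ha hb hab
    have : b * a * b⁻¹ = a := by
      refine h.eq_of_pow_eq (mul_mem (mul_mem hb ha) (inv_mem hb)) ha ?_
      rw [conj_pow, hab.symm.eq, mul_inv_cancel_right]
    exact (mul_inv_eq_iff_eq_mul.1 this).symm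
  exact key hx hy (key hy (pow_mem hx p) hxy.symm).symm

/-- If `a` and `b` normalise `M` and commute modulo `M`, then `(a b) ^ k = a ^ k b ^ k` modulo
`M`. -/
theorem mul_pow_mul_inv_mem {M : Subgroup G} {a b : G} (ha : a ∈ Subgroup.normalizer (M : Set G))
    (hb : b ∈ Subgroup.normalizer (M : Set G)) (hab : a * b * a⁻¹ * b⁻¹ ∈ M) (k : ℕ) :
    (a * b) ^ k * (a ^ k * b ^ k)⁻¹ ∈ M := by
  set Z := Subgroup.normalizer (M : Set G)
  let ρ : Z →* Z ⧸ M.subgroupOf Z := QuotientGroup.mk' _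
  have hρ : ∀ z : Z, ρ z = 1 ↔ (z : G) ∈ M := fun z => by
    rw [QuotientGroup.mk'_apply, QuotientGroup.eq_one_iff, Subgroup.mem_subgroupOf]
  have h1 : ρ (⟨a, ha⟩ * ⟨b, hb⟩ * ⟨a, ha⟩⁻¹ * ⟨b, hb⟩⁻¹) = 1 := (hρ _).2 hab
  have h2 : Commute (ρ ⟨a, ha⟩) (ρ ⟨b, hb⟩) := by
    simp only [map_mul, map_inv] at h1
    exact mul_inv_eq_iff_eq_mul.1 (mul_inv_eq_one.1 h1)
  have h3 : ρ ((⟨a, ha⟩ * ⟨b, hb⟩) ^ k * (⟨a, ha⟩ ^ k * ⟨b, hb⟩ ^ k)⁻¹) = 1 := by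
    simp only [map_mul, map_inv, map_pow]
    rw [h2.mul_pow, mul_inv_cancel]
  exact (hρ _).1 h3

end Roots

/-! ### Unipotent lists of one-parameter morphisms -/

section Flag

variable {p : ℕ} [Fact p.Prime] {G : Type*} [TopologicalSpace G] [Group G]

open OneParameterMorphism

/-- The subgroup generated by a list of one-parameter morphisms. -/
def gen : List (OneParameterMorphism p G) → Subgroup G
  | [] => ⊥
  | φ :: l => gen l ⊔ (φ : Multiplicative ℚ_[p] →* G).range

/-- `h` acts by conjugation on `gen l` as a unipotent: it commutes with each one-parameter
morphism of the list modulo the subgroup generated by the subsequent ones. -/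
def Centralizes : List (OneParameterMorphism p G) → G → Prop
  | [], _ => True
  | φ :: l, h => Centralizes l h ∧ ∀ t, h * φ.curve t * h⁻¹ * (φ.curve t)⁻¹ ∈ gen l

theorem gen_le_cons (φ : OneParameterMorphism p G) (l) : gen l ≤ gen (φ :: l) := le_sup_left

theorem curve_mem_gen_cons (φ : OneParameterMorphism p G) (l) (t : ℚ_[p]) :
    φ.curve t ∈ gen (φ :: l) :=
  (le_sup_right : (φ : Multiplicative ℚ_[p] →* G).range ≤ gen (φ :: l)) ⟨_, rfl⟩

theorem mem_gen_cons {φ : OneParameterMorphism p G} {l}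
    (hφ : ∀ t, φ.curve t ∈ Subgroup.normalizer (gen l : Set G)) {g : G} :
    g ∈ gen (φ :: l) ↔ ∃ n ∈ gen l, ∃ t, g = n * φ.curve t := by
  constructor
  · intro hg
    have hle : (φ : Multiplicative ℚ_[p] →* G).range ≤ Subgroup.normalizer (gen l : Set G) := by
      rintro _ ⟨t, rfl⟩
      exact hφ t.toAdd
    rw [gen, ← SetLike.mem_coe, Subgroup.coe_mul_of_right_le_normalizer_left _ _ hle] at hg
    obtain ⟨n, hn, _, ⟨t, rfl⟩, rfl⟩ := hg
    exact ⟨n, hn, t.toAdd, rfl⟩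
  · rintro ⟨n, hn, t, rfl⟩
    exact mul_mem (gen_le_cons φ l hn) (curve_mem_gen_cons φ l t)

/-- The three properties are proved together, since each step of the induction uses the first one
for the tail of the list. -/
theorem Centralizes.mem_normalizer_and_mul_and_inv (l : List (OneParameterMorphism p G)) :
    (∀ h, Centralizes l h → h ∈ Subgroup.normalizer (gen l : Set G)) ∧
    (∀ h k, Centralizes l h → Centralizes l k → Centralizes l (h * k)) ∧
    (∀ h, Centralizes l h → Centralizes l h⁻¹) := by
  induction l with
  | nil =>
    refine ⟨fun h _ => ?_, fun _ _ _ _ => trivial, fun _ _ => trivial⟩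
    refine Subgroup.mem_normalizer_iff.2 fun g => ?_
    simp [gen]
  | cons φ l ih =>
    obtain ⟨hn, hm, hi⟩ := ih
    have hinv : ∀ h, Centralizes (φ :: l) h → Centralizes (φ :: l) h⁻¹ := by
      rintro h ⟨h1, h2⟩
      refine ⟨hi h h1, fun t => ?_⟩
      have := (Subgroup.mem_normalizer_iff.1 (hn _ (hi h h1)) _).1 (inv_mem (h2 t))
      convert this using 1
      group
    have hconj : ∀ h, Centralizes (φ :: l) h → ∀ g ∈ gen (φ :: l), h * g * h⁻¹ ∈ gen (φ :: l) := by
      rintro h ⟨h1, h2⟩ g hg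
      have hle : gen (φ :: l) ≤ (gen (φ :: l)).comap (MulAut.conj h).toMonoidHom := by
        refine sup_le (fun n hn' => ?_) ?_
        · exact gen_le_cons φ l ((Subgroup.mem_normalizer_iff.1 (hn _ h1) _).1 hn')
        · rintro _ ⟨t, rfl⟩
          have := mul_mem (gen_le_cons φ l (h2 t.toAdd)) (curve_mem_gen_cons φ l t.toAdd)
          simpa [curve] using this
      exact hle hg
    refine ⟨fun h hh => Subgroup.mem_normalizer_iff.2 fun g =>
      ⟨hconj h hh g, fun hg => ?_⟩, ?_, hinv⟩
    · have := hconj _ (hinv h hh) _ hg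
      simpa [mul_assoc] using this
    · rintro h k ⟨h1, h2⟩ ⟨k1, k2⟩
      refine ⟨hm h k h1 k1, fun t => ?_⟩
      have := mul_mem ((Subgroup.mem_normalizer_iff.1 (hn _ h1) _).1 (k2 t)) (h2 t)
      convert this using 1
      group

theorem Centralizes.mem_normalizer {l : List (OneParameterMorphism p G)} {h : G}
    (hh : Centralizes l h) : h ∈ Subgroup.normalizer (gen l : Set G) :=
  (mem_normalizer_and_mul_and_inv l).1 h hh

theorem Centralizes.mul {l : List (OneParameterMorphism p G)} {h k : G}
    (hh : Centralizes l h) (hk : Centralizes l k) : Centralizes l (h * k) :=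
  (mem_normalizer_and_mul_and_inv l).2.1 h k hh hk

theorem Centralizes.one (l : List (OneParameterMorphism p G)) : Centralizes l 1 := by
  induction l with
  | nil => trivial
  | cons φ l ih => exact ⟨ih, fun t => by simp⟩

theorem Centralizes.pow {l : List (OneParameterMorphism p G)} {h : G}
    (hh : Centralizes l h) (k : ℕ) : Centralizes l (h ^ k) := by
  induction k with
  | zero => simpa using Centralizes.one l
  | succ k ih => rw [pow_succ]; exact ih.mul hh

/-- The list `l` presents `gen l` as an iterated extension by copies of `ℚ_p`: each one-parameter
morphism meets trivially the subgroup generated by the subsequent ones, and the elements of `gen l`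
act unipotently on `gen l`. -/
structure IsUnipotentList (l : List (OneParameterMorphism p G)) : Prop where
  centralizes : ∀ g ∈ gen l, Centralizes l g
  pairwise : ∀ φ l', φ :: l' <:+ l → ∀ t, φ.curve t ∈ gen l' → t = 0

theorem IsUnipotentList.tail {φ : OneParameterMorphism p G} {l}
    (h : IsUnipotentList (φ :: l)) : IsUnipotentList l :=
  ⟨fun g hg => (h.centralizes g (gen_le_cons φ l hg)).1,
    fun ψ l' hl => h.pairwise ψ l' (hl.trans (List.suffix_cons φ l))⟩

theorem IsUnipotentList.centralizes_curve {φ : OneParameterMorphism p G} {l}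
    (h : IsUnipotentList (φ :: l)) (t : ℚ_[p]) : Centralizes (φ :: l) (φ.curve t) :=
  h.centralizes _ (curve_mem_gen_cons φ l t)

theorem IsUnipotentList.curve_mem_normalizer {φ : OneParameterMorphism p G} {l}
    (h : IsUnipotentList (φ :: l)) (t : ℚ_[p]) :
    φ.curve t ∈ Subgroup.normalizer (gen l : Set G) :=
  (h.centralizes_curve t).1.mem_normalizer

/-- Unique `p`-th roots in the coset `gen l * σ`, when `σ` acts unipotently on `gen l`. The coset
makes the induction on the list possible: modulo the tail, the equation determines the component of
the root along the first one-parameter morphism, which is then absorbed into `σ`. -/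
theorem IsUnipotentList.existsUnique_root {l : List (OneParameterMorphism p G)}
    (h : IsUnipotentList l) {σ : G} (hσ : Centralizes l σ) {x : G} (hx : x ∈ gen l) :
    ∃! n, n ∈ gen l ∧ (n * σ) ^ p = x * σ ^ p := by
  induction l generalizing σ x with
  | nil =>
    rw [gen, Subgroup.mem_bot] at hx
    subst hx
    exact ⟨1, ⟨one_mem _, by simp⟩, fun y hy => Subgroup.mem_bot.1 hy.1⟩
  | cons φ l ih =>
    have hp : (p : ℚ_[p]) ≠ 0 := by exact_mod_cast (Fact.out : p.Prime).ne_zero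
    have hmem := fun g => mem_gen_cons h.curve_mem_normalizer (g := g)
    have hσ' : ∀ t, Centralizes l (φ.curve t * σ) := fun t => (h.centralizes_curve t).1.mul hσ.1
    have hcomm : ∀ t, φ.curve t * σ * (φ.curve t)⁻¹ * σ⁻¹ ∈ gen l := fun t => by
      have := (hσ.2 t)
      have := inv_mem this
      convert this using 1
      group
    have hpow : ∀ t, ∃ m ∈ gen l, (φ.curve t * σ) ^ p = m * (φ.curve (p * t) * σ ^ p) := by
      intro t
      refine ⟨_, mul_pow_mul_inv_mem (h.curve_mem_normalizer t) hσ.1.mem_normalizer (hcomm t) p, ?_⟩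
      rw [curve_natCast_mul, inv_mul_cancel_right]
    obtain ⟨m, hm, s, rfl⟩ := (hmem x).1 hx
    -- modulo `gen l`, the component of the root along `φ` can only be `s / p`
    obtain ⟨m0, hm0, e0⟩ := hpow (s / p)
    rw [mul_div_cancel₀ _ hp] at e0
    obtain ⟨n, ⟨hn, en⟩, hu⟩ := ih h.tail (hσ' (s / p)) (mul_mem hm (inv_mem hm0))
    refine ⟨n * φ.curve (s / p), ⟨(hmem _).2 ⟨n, hn, _, rfl⟩, ?_⟩, ?_⟩
    · rw [mul_assoc, en, e0]
      group
    · rintro y ⟨hy, ey⟩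
      obtain ⟨n', hn', t, rfl⟩ := (hmem y).1 hy
      obtain ⟨m1, hm1, e1⟩ := hpow t
      -- the `p`-th power determines `t`, by comparison modulo `gen l`
      have ht : t = s / p := by
        obtain ⟨m2, hm2, e2⟩ : ∃ m2 ∈ gen l, (n' * φ.curve t * σ) ^ p =
            m2 * (φ.curve (p * t) * σ ^ p) := by
          have k := mul_pow_mul_inv_mem (M := gen l) (a := n') (b := φ.curve t * σ)
            (Subgroup.le_normalizer hn') (hσ' t).mem_normalizer
            (by
              have := (Subgroup.mem_normalizer_iff.1 (hσ' t).mem_normalizer _).1 (inv_mem hn')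
              have := mul_mem hn' this
              convert this using 1
              group) p
          refine ⟨_, mul_mem (mul_mem k (pow_mem hn' p)) hm1, ?_⟩
          rw [e1]
          group
        have e3 : m2 * (φ.curve (p * t) * σ ^ p) = m * φ.curve s * σ ^ p := e2.symm.trans ey
        have e4 : φ.curve (p * t - s) = m2⁻¹ * m := by
          rw [sub_eq_add_neg, curve_add, curve_neg, ← mul_left_inj (φ.curve s), ← mul_right_inj m2,
            ← mul_left_inj (σ ^ p)]
          simpa [mul_assoc] using e3
        have := h.pairwise φ l List.suffix_rfl _ (e4 ▸ mul_mem (inv_mem hm2) hm)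
        rw [sub_eq_zero] at this
        rw [← this, mul_div_cancel_left₀ _ hp]
      subst ht
      rw [hu n' ⟨hn', by rw [← mul_assoc, ey, e0]; group⟩]

theorem IsUnipotentList.hasUniqueRoots {l : List (OneParameterMorphism p G)}
    (h : IsUnipotentList l) : HasUniqueRoots p (gen l) := fun x hx => by
  simpa using h.existsUnique_root (Centralizes.one l) hx

/-- The powers `g ^ (p ^ k)` tend to the identity as soon as they do so modulo `gen l`. The
one-parameter morphisms of the list are removed one by one: for a component `φ t`, a high power
`φ (p ^ j t)` belongs to any given open subgroup. -/
theorem IsUnipotentList.exists_pow_mem {l : List (OneParameterMorphism p G)}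
    (h : IsUnipotentList l) {g : G} (hg : Centralizes l g)
    (hl : ∀ K : Subgroup G, (K : Set G) ∈ 𝓝 1 → ∃ k : ℕ, ∃ n ∈ gen l, n * g ^ p ^ k ∈ K)
    {K : Subgroup G} (hK : (K : Set G) ∈ 𝓝 1) : ∃ k : ℕ, g ^ p ^ k ∈ K := by
  induction l generalizing K with
  | nil =>
    obtain ⟨k, n, hn, hk⟩ := hl K hK
    rw [gen, Subgroup.mem_bot] at hn
    exact ⟨k, by simpa [hn] using hk⟩
  | cons φ l ih =>
    refine ih h.tail hg.1 (fun K hK => ?_) hK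
    obtain ⟨k, n, hn, hk⟩ := hl K hK
    obtain ⟨m, hm, t, rfl⟩ := (mem_gen_cons h.curve_mem_normalizer).1 hn
    obtain ⟨j, hj⟩ : ∃ j : ℕ, φ.curve (p ^ j * t) ∈ K := by
      have := (φ.continuous_curve.tendsto 0).comp (tendsto_pow_mul_zero p t)
      rw [curve_zero] at this
      exact (this.eventually hK).exists
    have hgk := hg.pow (p ^ k)
    set a := g ^ p ^ k
    have hmφ : Centralizes (φ :: l) (m * φ.curve t) := h.centralizes _ hn
    have hN := hgk.1.mem_normalizer
    have hNφ := h.curve_mem_normalizer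
    have k1 := mul_pow_mul_inv_mem (M := gen l) (a := m * φ.curve t) (b := a) (k := p ^ j)
      hmφ.1.mem_normalizer hN (by
        have h1 := inv_mem (hgk.2 t)
        have h2 := inv_mem ((Subgroup.mem_normalizer_iff.1 hN _).1 hm)
        have h3 := (Subgroup.mem_normalizer_iff.1 (mul_mem hN (hNφ t)) _).1
          ((Subgroup.mem_normalizer_iff.1 (inv_mem (mul_mem (hNφ t) hN)) _).1 h2)
        have h4 := mul_mem hm (mul_mem h1 h2)
        convert h4 using 1
        group)
    have k2 := mul_pow_mul_inv_mem (M := gen l) (a := m) (b := φ.curve t) (k := p ^ j)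
      (Subgroup.le_normalizer hm) (hNφ t) (by
        have := mul_mem hm ((Subgroup.mem_normalizer_iff.1 (hNφ t) _).1 (inv_mem hm))
        convert this using 1
        group)
    have e1 : φ.curve (p ^ j * t) = φ.curve t ^ p ^ j := by
      have := φ.curve_natCast_mul (p ^ j) t
      exact_mod_cast this
    rw [← e1] at k2
    have k3 := mul_mem (mul_mem k1 k2) (pow_mem hm (p ^ j))
    have k4 := (Subgroup.mem_normalizer_iff.1 (inv_mem (hNφ (p ^ j * t))) _).1 k3
    refine ⟨k + j, _, k4, ?_⟩
    have e2 : g ^ p ^ (k + j) = a ^ p ^ j := by rw [pow_add, pow_mul]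
    have := mul_mem (inv_mem hj) (pow_mem hk (p ^ j))
    rw [e2]
    convert this using 1
    group

theorem IsUnipotentList.admitsLog {m : ℕ} [ChartedSpace (Fin m → ℚ_[p]) G]
    [LieGroup (model p m) ω G] {l : List (OneParameterMorphism p G)}
    (h : IsUnipotentList l) {g : G} (hg : g ∈ gen l) : AdmitsLog p g := by
  refine tendsto_def.2 fun U hU => ?_
  obtain ⟨K, hK, hKU⟩ := exists_subgroup_subset_of_mem_nhds p m hU
  obtain ⟨k, hk⟩ := h.exists_pow_mem (h.centralizes g hg)
    (fun K _ => ⟨0, g⁻¹, inv_mem hg, by simp⟩) hK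
  filter_upwards [eventually_ge_atTop k] with j hj
  obtain ⟨i, rfl⟩ := Nat.exists_eq_add_of_le hj
  refine hKU ?_
  change g ^ p ^ (k + i) ∈ K
  rw [pow_add, pow_mul]
  exact pow_mem hk _

/-- A morphism from a ball of `ℚ_p` to a group with unique `p`-th roots extends to `ℚ_p`: the value
at `t` is the `p ^ k`-th root of the value at `p ^ k t`, for any large `k`. -/
theorem HasUniqueRoots.exists_oneParameterMorphism [IsTopologicalGroup G] {N : Subgroup G}
    (hN : HasUniqueRoots p N) {γ : ℚ_[p] → G} {δ : ℝ} (hδ : 0 < δ)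
    (hadd : ∀ s t, ‖s‖ ≤ δ → ‖t‖ ≤ δ → γ (s + t) = γ s * γ t) (hc : ContinuousAt γ 0)
    (hmem : ∀ t, ‖t‖ ≤ δ → γ t ∈ N) :
    ∃ φ : OneParameterMorphism p G, (∀ t, φ.curve t ∈ N) ∧ ∀ t, ‖t‖ ≤ δ → φ.curve t = γ t := by
  have hsmall : ∀ t : ℚ_[p], ∃ k : ℕ, ∀ j ≥ k, ‖p ^ j * t‖ ≤ δ := by
    intro t
    have := (tendsto_pow_mul_zero p t).norm
    rw [norm_zero] at this
    exact eventually_atTop.1 (this.eventually (eventually_le_nhds hδ))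
  have hpow : ∀ (k j : ℕ) (t : ℚ_[p]), ‖(p : ℚ_[p]) ^ k * t‖ ≤ δ →
      γ (p ^ (k + j) * t) = γ (p ^ k * t) ^ p ^ j := by
    intro k j t ht
    rw [← apply_natCast_mul hδ.le hadd (p ^ j) ht]
    push_cast
    ring_nf
  have hex : ∀ t : ℚ_[p], ∃ n ∈ N, ∀ k : ℕ, ‖(p : ℚ_[p]) ^ k * t‖ ≤ δ →
      n ^ p ^ k = γ (p ^ k * t) := by
    intro t
    obtain ⟨k, hk⟩ := hsmall t
    obtain ⟨n, ⟨hn, en⟩, -⟩ := hN.pow k _ (hmem _ (hk k le_rfl))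
    refine ⟨n, hn, fun j hj => ?_⟩
    rcases le_total k j with h | h
    · obtain ⟨i, rfl⟩ := Nat.exists_eq_add_of_le h
      rw [hpow k i t (hk k le_rfl), ← en, pow_add, pow_mul]
    · obtain ⟨i, rfl⟩ := Nat.exists_eq_add_of_le h
      refine (hN.pow i).eq_of_pow_eq (pow_mem hn _) (hmem _ hj) ?_
      rw [← hpow j i t hj, ← en, pow_add, pow_mul]
  choose F hF hFk using hex
  have hadd' : ∀ s t, F (s + t) = F s * F t := by
    intro s t
    obtain ⟨k1, hk1⟩ := hsmall s
    obtain ⟨k2, hk2⟩ := hsmall t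
    set k := max k1 k2
    have hs := hk1 k (le_max_left _ _)
    have ht := hk2 k (le_max_right _ _)
    have hst : ‖(p : ℚ_[p]) ^ k * (s + t)‖ ≤ δ := by
      rw [mul_add]
      exact (IsUltrametricDist.norm_add_le_max _ _).trans (max_le hs ht)
    have e : ∀ a b : ℚ_[p], ‖a‖ ≤ δ → ‖b‖ ≤ δ → Commute (γ a) (γ b) := fun a b ha hb => by
      rw [commute_iff_eq, ← hadd a b ha hb, ← hadd b a hb ha, add_comm]
    have hcomm : Commute (F s) (F t) := by
      refine (hN.pow k).commute_of_commute_pow (hF s) (hF t) ?_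
      rw [hFk s k hs, hFk t k ht]
      exact e _ _ hs ht
    refine (hN.pow k).eq_of_pow_eq (hF _) (mul_mem (hF s) (hF t)) ?_
    rw [hcomm.mul_pow, hFk _ k hst, hFk s k hs, hFk t k ht, mul_add, hadd _ _ hs ht]
  have hFγ : ∀ t, ‖t‖ ≤ δ → F t = γ t := fun t ht => by
    have := hFk t 0 (by simpa using ht)
    simpa using this
  have hFc : ContinuousAt F 0 := by
    refine hc.congr ?_
    filter_upwards [Metric.closedBall_mem_nhds (0 : ℚ_[p]) hδ] with t ht
    exact (hFγ t (by simpa using ht)).symm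
  exact ⟨ofCurve F hadd' hFc, fun t => hF t, fun t ht => hFγ t ht⟩

end Flag

/-! ### Extension of a closed subgroup by a one-parameter morphism -/

section Extension

open OneParameterMorphism

/-- A closed subgroup which contains `φ t` contains its powers, hence `φ (z t)` for `z ∈ ℤ_p`. -/
theorem curve_mem_of_isClosed {p : ℕ} [Fact p.Prime] {G : Type*} [TopologicalSpace G] [Group G]
    {N : Subgroup G} {φ : OneParameterMorphism p G} (hN : IsClosed (N : Set G))
    {t : ℚ_[p]} (ht : φ.curve t ∈ N) {s : ℚ_[p]} (hs : ‖s‖ ≤ ‖t‖) : φ.curve s ∈ N := by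
  by_cases h0 : t = 0
  · subst h0
    have : s = 0 := norm_le_zero_iff.1 (by simpa using hs)
    simp [this]
  have hz : ‖s / t‖ ≤ 1 := by
    rw [norm_div]
    exact div_le_one_of_le₀ hs (norm_nonneg _)
  have h1 : ∀ z : ℤ_[p], φ.curve (z * t) ∈ N := by
    intro z
    refine PadicInt.denseRange_natCast.induction_on (p := fun z : ℤ_[p] => φ.curve (z * t) ∈ N) z
      ?_ fun n => ?_
    · exact hN.preimage (φ.continuous_curve.comp (by fun_prop))
    · have := pow_mem ht n
      rw [← curve_natCast_mul] at this
      simpa using this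
  have := h1 ⟨s / t, hz⟩
  rwa [div_mul_cancel₀ _ h0] at this

variable {p : ℕ} [Fact p.Prime] {m : ℕ} {G : Type*} [TopologicalSpace G]
  [ChartedSpace (Fin m → ℚ_[p]) G] [Group G]
  {N : Subgroup G} {S : Submodule ℚ_[p] (Fin m → ℚ_[p])} {d : ℕ} {Ψ : (Fin d → ℚ_[p]) → N}
  {φ : OneParameterMorphism p G} {Y : Fin m → ℚ_[p]}

/-- If `φ` is not tangent to `N`, it meets `N` trivially, for otherwise `φ` would have values in `N`
on a whole ball. -/
theorem IsLocalParam.eq_zero_of_curve_mem (h : IsLocalParam N S Ψ) (hN : IsClosed (N : Set G))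
    (hφ : IsLocalOneParam p φ.curve Y) (hY : Y ∉ S) {t : ℚ_[p]} (ht : φ.curve t ∈ N) : t = 0 := by
  by_contra h0
  refine hY (h.mem_of_hasDerivAt hφ.continuousAt hφ.map_zero ?_ hφ.hasDerivAt)
  filter_upwards [Metric.closedBall_mem_nhds (0 : ℚ_[p]) (norm_pos_iff.2 h0)] with s hs
  exact curve_mem_of_isClosed hN ht (by simpa using hs)

variable [LieGroup (model p m) ω G]

/-- In the product `N φ(ℚ_p)`, elements close to the identity have a small component along `φ`.
Otherwise `n φ(t) ∈ K` with `t` large; a power `p ^ j` brings `t` into a fixed annulus, and `φ` of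
this compact annulus keeps away from `N`. -/
theorem exists_subgroup_norm_lt (m : ℕ) [ChartedSpace (Fin m → ℚ_[p]) G]
    [LieGroup (model p m) ω G] (hN : IsClosed (N : Set G))
    (hφN : ∀ t, φ.curve t ∈ Subgroup.normalizer (N : Set G))
    (h0 : ∀ t, φ.curve t ∈ N → t = 0) {ε : ℝ} (hε : 0 < ε) :
    ∃ K : Subgroup G, (K : Set G) ∈ 𝓝 1 ∧ ∀ n ∈ N, ∀ t, n * φ.curve t ∈ K → ‖t‖ < ε := by
  have : IsTopologicalGroup G := topologicalGroup_of_lieGroup (model p m) ω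
  have hp : (0 : ℝ) < p := by exact_mod_cast (Fact.out : p.Prime).pos
  -- an annulus which contains a multiple `p ^ j * t` of each `t` with `ε ≤ ‖t‖`, since
  -- multiplication by `p` divides the norm by `p`
  set C : Set ℚ_[p] := Metric.closedBall 0 (ε / p) ∩ {t | ε / p ^ 2 ≤ ‖t‖}
  have hC : IsCompact C :=
    (isCompact_closedBall _ _).inter_right (isClosed_le continuous_const continuous_norm)
  obtain ⟨V, hV, hVN⟩ := compact_open_separated_mul_right (hC.image φ.continuous_curve)
    hN.isOpen_compl (by
      rintro _ ⟨t, ht, rfl⟩ hmem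
      have := ht.2
      rw [Set.mem_ofPred_eq, h0 t hmem, norm_zero] at this
      exact absurd this (not_le.2 (by positivity)))
  obtain ⟨K, hK, hKV⟩ := exists_subgroup_subset_of_mem_nhds p m hV
  refine ⟨K, hK, fun n hn t ht => ?_⟩
  by_contra! hlt
  have hex : ∃ j : ℕ, ‖(p : ℚ_[p]) ^ j * t‖ ≤ ε / p := by
    have := (tendsto_pow_mul_zero p t).norm
    rw [norm_zero] at this
    exact (this.eventually (eventually_le_nhds (div_pos hε hp))).exists
  classical
  obtain ⟨j, hj, hjmin⟩ : ∃ j : ℕ, ‖(p : ℚ_[p]) ^ j * t‖ ≤ ε / p ∧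
      ∀ i < j, ε / p < ‖(p : ℚ_[p]) ^ i * t‖ :=
    ⟨Nat.find hex, Nat.find_spec hex, fun i hi => not_le.1 (Nat.find_min hex hi)⟩
  have hjC : (p : ℚ_[p]) ^ j * t ∈ C := by
    refine ⟨by simpa using hj, ?_⟩
    rw [Set.mem_ofPred_eq]
    cases j with
    | zero =>
      have hp2 : (1 : ℝ) < p := by exact_mod_cast (Fact.out : p.Prime).one_lt
      have : ε / p < ε := div_lt_self hε hp2
      simp only [pow_zero, one_mul] at hj
      linarith
    | succ i =>
      have := hjmin i i.lt_succ_self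
      rw [pow_succ' (p : ℚ_[p]), mul_assoc, norm_mul, Padic.norm_p, pow_two, ← div_div,
        div_eq_inv_mul]
      exact mul_le_mul_of_nonneg_left this.le (by positivity)
  have k1 := mul_pow_mul_inv_mem (M := N) (a := n) (b := φ.curve t) (k := p ^ j)
    (Subgroup.le_normalizer hn) (hφN t) (by
      have := mul_mem hn ((Subgroup.mem_normalizer_iff.1 (hφN t) _).1 (inv_mem hn))
      convert this using 1
      group)
  have e1 : φ.curve (p ^ j * t) = φ.curve t ^ p ^ j := by
    have := φ.curve_natCast_mul (p ^ j) t
    exact_mod_cast this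
  rw [← e1] at k1
  have k2 := mul_mem k1 (pow_mem hn (p ^ j))
  have k3 := hVN (Set.mul_mem_mul ⟨_, hjC, rfl⟩ (hKV (inv_mem (pow_mem ht (p ^ j)))))
  refine k3 (SetLike.mem_coe.2 ?_)
  have := inv_mem k2
  simpa only [mul_inv_rev, inv_inv, mul_assoc, mul_inv_cancel_left, inv_mul_cancel_left] using this

section Cons

variable {N' : Subgroup G}

/-- The product of a closed subgroup `N` with a one-parameter morphism that normalises it and meets
it trivially is closed: near the identity it is the product of `N` with a compact set. -/
theorem isClosed_of_mem_iff (hmem : ∀ g, g ∈ N' ↔ ∃ n ∈ N, ∃ t, g = n * φ.curve t) (m : ℕ)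
    [ChartedSpace (Fin m → ℚ_[p]) G]
    [LieGroup (model p m) ω G] (hN : IsClosed (N : Set G))
    (hφN : ∀ t, φ.curve t ∈ Subgroup.normalizer (N : Set G))
    (h0 : ∀ t, φ.curve t ∈ N → t = 0) : IsClosed (N' : Set G) := by
  have : IsTopologicalGroup G := topologicalGroup_of_lieGroup (model p m) ω
  obtain ⟨K, hK, hKt⟩ := exists_subgroup_norm_lt m hN hφN h0 one_pos
  have hKo := K.isOpen_of_mem_nhds hK
  have hc : IsClosed ((N' : Set G) ∩ K) := by
    have : (N' : Set G) ∩ K = (N : Set G) * (φ.curve '' Metric.closedBall 0 1) ∩ K := by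
      ext g
      refine and_congr_left fun hgK => ⟨fun hg => ?_, ?_⟩
      · obtain ⟨n, hn, t, rfl⟩ := (hmem g).1 hg
        exact Set.mul_mem_mul hn ⟨t, by simpa using (hKt n hn t hgK).le, rfl⟩
      · rintro ⟨n, hn, _, ⟨t, -, rfl⟩, rfl⟩
        exact (hmem _).2 ⟨n, hn, t, rfl⟩
    rw [this]
    exact (hN.mul_right_of_isCompact ((isCompact_closedBall _ _).image φ.continuous_curve)).inter
      (K.isClosed_of_isOpen hKo)
  refine isClosed_of_closure_subset fun g hg => ?_
  obtain ⟨n, hn1, hn2⟩ := mem_closure_iff_nhds.1 hg ((fun x => x⁻¹ * g) ⁻¹' K)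
    (ContinuousAt.preimage_mem_nhds (by fun_prop) (by simpa using hK))
  have h1 : n⁻¹ * g ∈ closure (N' : Set G) :=
    mul_mem (S := Subgroup G) (s := N'.topologicalClosure)
      (inv_mem (N'.le_topologicalClosure hn2)) hg
  have h2 : n⁻¹ * g ∈ closure ((N' : Set G) ∩ K) := by
    rw [Set.inter_comm]
    exact hKo.inter_closure ⟨hn1, h1⟩
  rw [hc.closure_eq] at h2
  have := mul_mem hn2 h2.1
  simpa using this

/-- The local parametrisation `(t, x) ↦ Ψ(x) φ(t)` of the product of `N` with a one-parameter
morphism transverse to it. -/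
theorem IsLocalParam.cons (hmem : ∀ g, g ∈ N' ↔ ∃ n ∈ N, ∃ t, g = n * φ.curve t)
    (h : IsLocalParam N S Ψ) (hN : IsClosed (N : Set G))
    (hφN : ∀ t, φ.curve t ∈ Subgroup.normalizer (N : Set G))
    (hφ : IsLocalOneParam p φ.curve Y) (hY : Y ∉ S) :
    ∃ Ψ' : (Fin (d + 1) → ℚ_[p]) → N', IsLocalParam N' (S ⊔ Submodule.span ℚ_[p] {Y}) Ψ' := by
  have : IsTopologicalGroup G := topologicalGroup_of_lieGroup (model p m) ω
  set T : (Fin (d + 1) → ℚ_[p]) →L[ℚ_[p]] (Fin d → ℚ_[p]) :=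
    ContinuousLinearMap.pi fun i => ContinuousLinearMap.proj i.succ
  set π : (Fin (d + 1) → ℚ_[p]) →L[ℚ_[p]] ℚ_[p] := ContinuousLinearMap.proj 0
  have hcons : ∀ (c : ℚ_[p]) (w : Fin d → ℚ_[p]), T (Fin.cons c w) = w ∧
      π (Fin.cons c w : Fin (d + 1) → ℚ_[p]) = c := fun c w =>
    ⟨by ext i; simp [T], by simp [π]⟩
  have hext : ∀ v, T v = 0 → π v = 0 → v = 0 := fun v h1 h2 => by
    ext i
    refine Fin.cases h2 (fun i => congrFun h1 i) i
  refine ⟨fun x => ⟨Ψ (T x) * φ.curve (π x), (hmem _).2 ⟨_, (Ψ (T x)).2, _, rfl⟩⟩, ?_⟩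
  set D := fderiv ℚ_[p] (fun x => coord p m (Ψ x : G)) 0 with hD
  have hΨT : ContMDiffAt (model p (d + 1)) (model p m) ω
      (fun x => (Ψ (T x) : G)) 0 :=
    ContMDiffAt.comp (g := fun x => (Ψ x : G)) (0 : Fin (d + 1) → ℚ_[p])
      (by rw [_root_.map_zero]; exact h.contMDiffAt) T.contMDiff.contMDiffAt
  have hφπ : ContMDiffAt (model p (d + 1)) (model p m) ω (fun x => φ.curve (π x)) 0 :=
    ContMDiffAt.comp (g := φ.curve) (0 : Fin (d + 1) → ℚ_[p])
      (contMDiff_curve hφ).contMDiffAt π.contMDiff.contMDiffAt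
  have hder : HasFDerivAt (fun x => coord p m ((Ψ (T x) : G) * φ.curve (π x)))
      (D.comp T + π.smulRight Y) 0 := by
    have h1 : HasStrictFDerivAt (fun x => coord p m (Ψ (T x) : G)) (D.comp T) 0 :=
      HasStrictFDerivAt.comp (g := fun x => coord p m (Ψ x : G)) (0 : Fin (d + 1) → ℚ_[p])
        (by rw [_root_.map_zero]; exact h.analyticAt.hasStrictFDerivAt) T.hasStrictFDerivAt
    have h2 : HasStrictFDerivAt (fun x => coord p m (φ.curve (π x))) (π.smulRight Y) 0 := by
      have k1 := hφ.analyticAt.hasStrictFDerivAt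
      have k2 : fderiv ℚ_[p] (fun t => coord p m (φ.curve t)) 0 =
          ContinuousLinearMap.toSpanSingleton ℚ_[p] Y := hφ.hasDerivAt.hasFDerivAt.fderiv
      rw [k2] at k1
      refine (HasStrictFDerivAt.comp (g := fun t => coord p m (φ.curve t))
        (0 : Fin (d + 1) → ℚ_[p]) (by rw [_root_.map_zero]; exact k1)
          π.hasStrictFDerivAt).congr_fderiv ?_
      ext1 v
      simp
    exact (hasStrictFDerivAt_coord_mul p m h1 h2 hΨT.continuousAt hφπ.continuousAt
      (by simp [h.map_zero]) (by simp)).hasFDerivAt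
  have hSD : ∀ w, D w ∈ S := fun w => (h.mem_iff _).2 ⟨w, rfl⟩
  refine ⟨hΨT.mul hφπ, ?_, fun v hv => ?_, fun X => ?_, fun U hU => ?_⟩
  · simp [h.map_zero]
  · rw [hder.fderiv] at hv
    replace hv : D (T v) + π v • Y = 0 := hv
    have hπ : π v = 0 := by
      by_contra hne
      refine hY ((S.smul_mem_iff hne).1 ?_)
      rw [← neg_eq_of_add_eq_zero_right hv]
      exact S.neg_mem (hSD _)
    rw [hπ, zero_smul, add_zero] at hv
    exact hext v (h.ker_fderiv _ hv) hπ
  · rw [hder.fderiv, Submodule.mem_sup]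
    constructor
    · rintro ⟨Z, hZ, W, hW, rfl⟩
      obtain ⟨w, rfl⟩ := (h.mem_iff Z).1 hZ
      obtain ⟨c, rfl⟩ := Submodule.mem_span_singleton.1 hW
      refine ⟨Fin.cons c w, ?_⟩
      change D (T _) + π _ • Y = _
      rw [(hcons c w).1, (hcons c w).2]
    · rintro ⟨v, rfl⟩
      exact ⟨_, hSD (T v), _, Submodule.mem_span_singleton.2 ⟨π v, rfl⟩, rfl⟩
  · have hc : Continuous fun z : ℚ_[p] × (Fin d → ℚ_[p]) =>
        (Fin.cons z.1 z.2 : Fin (d + 1) → ℚ_[p]) := by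
      refine continuous_pi fun i => ?_
      refine Fin.cases ?_ (fun i => ?_) i
      · exact continuous_fst
      · exact (continuous_apply i).comp continuous_snd
    have hc0 : (Fin.cons (0 : ℚ_[p]) (0 : Fin d → ℚ_[p]) : Fin (d + 1) → ℚ_[p]) = 0 :=
      hext _ (hcons _ _).1 (hcons _ _).2
    have hU' := hc.continuousAt (x := ((0 : ℚ_[p]), (0 : Fin d → ℚ_[p]))) (by
      simp only [hc0]; exact hU)
    rw [mem_map, nhds_prod_eq] at hU'
    obtain ⟨A, hA, B, hB, hAB⟩ := mem_prod_iff.1 hU'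
    have hmul : ContinuousAt (fun z : G × ℚ_[p] => z.1 * (φ.curve z.2)⁻¹) (1, 0) :=
      (continuous_fst.mul (φ.continuous_curve.comp continuous_snd).inv).continuousAt
    have hW := hmul.eventually (p := fun g => ∀ h : g ∈ N, ∃ x ∈ B, Ψ x = ⟨g, h⟩)
      (by simpa using h.eventually_mem_image B hB)
    rw [nhds_prod_eq] at hW
    obtain ⟨W, hW1, A', hA', hWA⟩ := mem_prod_iff.1 hW
    obtain ⟨ε, hε, hεA⟩ := Metric.mem_nhds_iff.1 (inter_mem hA hA')
    obtain ⟨K, hK, hKt⟩ := exists_subgroup_norm_lt m hN hφN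
      (fun t => h.eq_zero_of_curve_mem hN hφ hY) hε
    filter_upwards [hW1, hK] with g hg1 hg2 hg3
    obtain ⟨n, hn, t, rfl⟩ := (hmem g).1 hg3
    have ht := hεA (mem_ball_zero_iff.2 (hKt n hn t hg2))
    have hx := hWA (Set.mk_mem_prod hg1 ht.2)
    simp only [Set.mem_ofPred_eq, mul_inv_cancel_right] at hx
    obtain ⟨x, hxB, hx⟩ := hx hn
    refine ⟨Fin.cons t x, hAB (Set.mk_mem_prod ht.1 hxB), Subtype.ext ?_⟩
    change (Ψ (T _) : G) * φ.curve (π _) = _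
    rw [(hcons t x).1, (hcons t x).2, hx]

/-- Modulo `N`, a one-parameter morphism `F` with values in `N φ(ℚ_p)` is a rescaling of `φ`. -/
theorem IsLocalParam.exists_curve_mul_inv_mem
    (hmem : ∀ g, g ∈ N' ↔ ∃ n ∈ N, ∃ t, g = n * φ.curve t) (h : IsLocalParam N S Ψ)
    (hN : IsClosed (N : Set G))
    (hφN : ∀ t, φ.curve t ∈ Subgroup.normalizer (N : Set G))
    (hφ : IsLocalOneParam p φ.curve Y) (hY : Y ∉ S) {F : OneParameterMorphism p G}
    (hF : ∀ t, F.curve t ∈ N') {Z : Fin m → ℚ_[p]} (hFZ : IsLocalOneParam p F.curve Z) :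
    ∃ c : ℚ_[p], (∀ t, F.curve t * (φ.curve (t * c))⁻¹ ∈ N) ∧ Z - c • Y ∈ S := by
  have : IsTopologicalGroup G := topologicalGroup_of_lieGroup (model p m) ω
  choose n hn l hl using fun t => (hmem _).1 (hF t)
  have h0 : ∀ t, φ.curve t ∈ N → t = 0 := fun t => h.eq_zero_of_curve_mem hN hφ hY
  have hadd : ∀ s t, l (s + t) = l s + l t := by
    intro s t
    have e : n (s + t) * φ.curve (l (s + t)) = n s * φ.curve (l s) * (n t * φ.curve (l t)) := by
      rw [← hl, ← hl, ← hl, curve_add]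
    have k1 := (Subgroup.mem_normalizer_iff.1 (hφN (l s)) _).1 (hn t)
    have k2 := mul_mem (inv_mem (hn (s + t))) (mul_mem (hn s) k1)
    have e2 : φ.curve (l (s + t) - (l s + l t)) =
        (n (s + t))⁻¹ * (n s * (φ.curve (l s) * n t * (φ.curve (l s))⁻¹)) := by
      rw [sub_eq_add_neg, curve_add, curve_neg, curve_add, mul_inv_eq_iff_eq_mul,
        eq_comm, mul_assoc, inv_mul_eq_iff_eq_mul, e]
      group
    exact sub_eq_zero.1 (h0 _ (e2 ▸ k2))
  let L : ℚ_[p] →+ ℚ_[p] := AddMonoidHom.mk' l hadd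
  have hLc : Continuous L := by
    refine continuous_of_continuousAt_zero L (Metric.continuousAt_iff.2 fun ε hε => ?_)
    obtain ⟨K, hK, hKt⟩ := exists_subgroup_norm_lt m hN hφN h0 hε
    have := (F.continuous_curve.tendsto 0).eventually (p := (· ∈ K)) (by rw [curve_zero]; exact hK)
    obtain ⟨δ, hδ, hball⟩ := Metric.eventually_nhds_iff.1 this
    refine ⟨δ, hδ, fun t ht => ?_⟩
    rw [_root_.map_zero L, dist_zero_right]
    exact hKt _ (hn t) _ (hl t ▸ hball ht)
  -- a continuous additive function on `ℚ_p` is linear, by density of `ℚ`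
  have hlin : ∀ t, l t = t * l 1 := by
    refine fun t => (Padic.denseRange_ratCast p).induction_on
      (p := fun t => l t = t * l 1) t ?_ fun q => ?_
    · exact isClosed_eq hLc (by fun_prop)
    · have := map_ratCast_smul L ℚ_[p] ℚ_[p] q 1
      rw [smul_eq_mul, smul_eq_mul, mul_one] at this
      exact this
  have hmemN : ∀ t, F.curve t * (φ.curve (t * l 1))⁻¹ ∈ N := fun t => by
    rw [hl t, hlin t, mul_inv_cancel_right]
    exact hn t
  refine ⟨l 1, hmemN, ?_⟩
  have hd : HasDerivAt (fun t => coord p m ((φ.curve (t * l 1))⁻¹)) (-(l 1 • Y)) 0 := by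
    have k1 := hφ.hasDerivAt
    have k2 : HasDerivAt (fun t : ℚ_[p] => -(t * l 1)) (-(l 1)) 0 := by
      have := ((hasDerivAt_id (0 : ℚ_[p])).mul_const (l 1)).neg
      rw [one_mul] at this
      exact this
    have k3 := HasDerivAt.scomp (g₁ := fun t => coord p m (φ.curve t)) (0 : ℚ_[p])
      (by simpa using k1) k2
    simp only [← curve_neg, ← neg_smul]
    exact k3
  have hc2 : ContinuousAt (fun t => (φ.curve (t * l 1))⁻¹) 0 :=
    (φ.continuous_curve.comp (by fun_prop)).inv.continuousAt
  have := h.mem_of_hasDerivAt (c := fun t => F.curve t * (φ.curve (t * l 1))⁻¹)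
    (hFZ.continuousAt.mul hc2) (by simp) (Eventually.of_forall hmemN)
    (hasDerivAt_coord_mul p m hFZ.hasDerivAt hd hFZ.continuousAt hc2 (by simp) (by simp))
  rwa [sub_eq_add_neg]

end Cons

end Extension

/-! ### Commutators of one-parameter morphisms -/

section Commutator

open OneParameterMorphism

variable {p : ℕ} [Fact p.Prime] {m : ℕ} {G : Type*} [TopologicalSpace G]
  [ChartedSpace (Fin m → ℚ_[p]) G] [Group G]

theorem IsWeaklyRegular.curve_eq (hG : IsWeaklyRegular p m G) {φ ψ : OneParameterMorphism p G}
    {X : Fin m → ℚ_[p]} (hφ : IsLocalOneParam p φ.curve X) (hψ : IsLocalOneParam p ψ.curve X) :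
    φ.curve = ψ.curve := by
  rw [hG φ ψ X (hasDerivative_iff.2 hφ) (hasDerivative_iff.2 hψ)]

/-- `l` generates a closed unipotent subgroup with Lie algebra `S`. -/
structure HasLieAlg (l : List (OneParameterMorphism p G))
    (S : Submodule ℚ_[p] (Fin m → ℚ_[p])) : Prop where
  isUnipotentList : IsUnipotentList l
  isClosed : IsClosed (gen l : Set G)
  exists_isLocalParam : ∃ (d : ℕ) (Ψ : (Fin d → ℚ_[p]) → gen l), IsLocalParam (gen l) S Ψ

variable [LieGroup (model p m) ω G]

/-- A local one-parameter subgroup of `gen l` extends to a one-parameter morphism of `gen l`, thanks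
to unique `p`-th roots. -/
theorem HasLieAlg.exists_oneParameterMorphism {l : List (OneParameterMorphism p G)}
    {S : Submodule ℚ_[p] (Fin m → ℚ_[p])} (h : HasLieAlg l S) {γ : ℚ_[p] → G}
    {X : Fin m → ℚ_[p]} (hγ : IsLocalOneParam p γ X) (hmem : ∀ᶠ t in 𝓝 0, γ t ∈ gen l) :
    ∃ F : OneParameterMorphism p G, (∀ t, F.curve t ∈ gen l) ∧ IsLocalOneParam p F.curve X := by
  have : IsTopologicalGroup G := topologicalGroup_of_lieGroup (model p m) ω
  obtain ⟨δ, hδ, hadd⟩ := hγ.exists_hom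
  obtain ⟨ε, hε, hball⟩ := Metric.nhds_basis_closedBall.mem_iff.1 hmem
  obtain ⟨F, hF, hFγ⟩ := h.isUnipotentList.hasUniqueRoots.exists_oneParameterMorphism
    (γ := γ) (lt_min hδ hε) (fun s t hs ht => hadd s t (hs.trans (min_le_left _ _))
      (ht.trans (min_le_left _ _))) hγ.continuousAt
    (fun t ht => hball (mem_closedBall_zero_iff.2 (ht.trans (min_le_right _ _))))
  refine ⟨F, hF, hγ.congr ?_⟩
  filter_upwards [Metric.closedBall_mem_nhds (0 : ℚ_[p]) (lt_min hδ hε)] with t ht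
  exact hFγ t (mem_closedBall_zero_iff.1 ht)

theorem HasLieAlg.exists_oneParameterMorphism_of_mem {l : List (OneParameterMorphism p G)}
    {S : Submodule ℚ_[p] (Fin m → ℚ_[p])} (h : HasLieAlg l S) {X : Fin m → ℚ_[p]} (hX : X ∈ S) :
    ∃ F : OneParameterMorphism p G, (∀ t, F.curve t ∈ gen l) ∧ IsLocalOneParam p F.curve X := by
  obtain ⟨d, Ψ, hΨ⟩ := h.exists_isLocalParam
  obtain ⟨γ, hγ⟩ := hΨ.exists_isLocalOneParam h.isClosed hX
  exact h.exists_oneParameterMorphism hγ (Eventually.of_forall fun t => (γ t).2)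

/-- The conjugate of a one-parameter morphism. -/
def OneParameterMorphism.conj [IsTopologicalGroup G] (φ : OneParameterMorphism p G) (g : G) :
    OneParameterMorphism p G :=
  ofCurve (fun t => g * φ.curve t * g⁻¹) (fun s t => by rw [curve_add]; group)
    ((continuous_const.mul φ.continuous_curve).mul continuous_const).continuousAt

/-- The one-parameter morphisms of `Y` and `Z` commute modulo `gen l` if `ad Y Z` is in the Lie
algebra `S` of `gen l`. For small `t`, weak regularity identifies the conjugate of `ψ` by `φ t` with
a one-parameter morphism of `gen (ψ :: l)`. For all `t`, it identifies the conjugate of `φ` by `ψ s`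
with a one-parameter morphism of `gen (φ :: l)`. -/
theorem commutator_mem_gen (hG : IsWeaklyRegular p m G) {l : List (OneParameterMorphism p G)}
    {S S₁ S₂ : Submodule ℚ_[p] (Fin m → ℚ_[p])} {φ ψ : OneParameterMorphism p G}
    {Y Z : Fin m → ℚ_[p]} (hφ : IsLocalOneParam p φ.curve Y) (hψ : IsLocalOneParam p ψ.curve Z)
    (hl : HasLieAlg l S) (hφl : HasLieAlg (φ :: l) S₁) (hψl : HasLieAlg (ψ :: l) S₂)
    (hY : Y ∉ S) (hZ : Z ∉ S) (hS₂ : S ≤ S₂) (hZS₂ : Z ∈ S₂)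
    (hYS : ∀ W ∈ S, ad p m G Y W ∈ S) (hYZ : ad p m G Y Z ∈ S) (s t : ℚ_[p]) :
    φ.curve t * ψ.curve s * (φ.curve t)⁻¹ * (ψ.curve s)⁻¹ ∈ gen l := by
  have : IsTopologicalGroup G := topologicalGroup_of_lieGroup (model p m) ω
  obtain ⟨d, Ψ, hΨ⟩ := hl.exists_isLocalParam
  have hsmall : ∀ᶠ t in 𝓝 0, ∀ s,
      φ.curve t * ψ.curve s * (φ.curve t)⁻¹ * (ψ.curve s)⁻¹ ∈ gen l := by
    filter_upwards [hφ.eventually_Ad_sub_mem S hYS hYZ] with t ht s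
    have hF : IsLocalOneParam p (ψ.conj (φ.curve t)).curve (Ad (φ.curve t) Z) := hψ.conj _
    obtain ⟨F, hFl, hFA⟩ := hψl.exists_oneParameterMorphism_of_mem
      (X := Ad (φ.curve t) Z) (by simpa using S₂.add_mem (hS₂ ht) hZS₂)
    obtain ⟨c, hc, hcS⟩ := hΨ.exists_curve_mul_inv_mem
      (fun g => mem_gen_cons hψl.isUnipotentList.curve_mem_normalizer) hl.isClosed
      hψl.isUnipotentList.curve_mem_normalizer hψ hZ hFl hFA
    -- `Ad (φ t) Z` is congruent to both `Z` and `c Z` modulo `S`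
    have hc1 : c = 1 := by
      by_contra hne
      refine hZ ((S.smul_mem_iff (sub_ne_zero.2 hne)).1 ?_)
      have := S.sub_mem ht hcS
      rw [sub_smul, one_smul]
      simpa using this
    have := hc s
    rw [← hG.curve_eq hF hFA, hc1, mul_one] at this
    exact this
  -- for fixed `s`, extend from small `t` to all `t`
  have hρ : IsLocalOneParam p (φ.conj (ψ.curve s)).curve (Ad (ψ.curve s) Y) := hφ.conj _
  have hρsmall : ∀ᶠ t in 𝓝 0, (φ.conj (ψ.curve s)).curve t * (φ.curve t)⁻¹ ∈ gen l := by
    filter_upwards [hsmall] with t ht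
    have := inv_mem (ht s)
    change ψ.curve s * φ.curve t * (ψ.curve s)⁻¹ * (φ.curve t)⁻¹ ∈ gen l
    convert this using 1
    group
  obtain ⟨F, hFl, hFA⟩ := hφl.exists_oneParameterMorphism hρ (hρsmall.mono fun t ht => by
    have := mul_mem (gen_le_cons φ l ht) (curve_mem_gen_cons φ l t)
    simpa using this)
  obtain ⟨c, hc, -⟩ := hΨ.exists_curve_mul_inv_mem
    (fun g => mem_gen_cons hφl.isUnipotentList.curve_mem_normalizer) hl.isClosed
    hφl.isUnipotentList.curve_mem_normalizer hφ hY hFl hFA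
  rw [← hG.curve_eq hρ hFA] at hc
  -- for small `u ≠ 0`, the conjugate is congruent to both `φ u` and `φ (u c)` modulo `gen l`
  have hc1 : c = 1 := by
    obtain ⟨u, hu, hu0⟩ := (hρsmall.filter_mono nhdsWithin_le_nhds |>.and
      (self_mem_nhdsWithin (s := {0}ᶜ))).exists
    have h1 := mul_mem (inv_mem (hc u)) hu
    have h2 : φ.curve (u * c - u) ∈ gen l := by
      rw [sub_eq_add_neg, curve_add, curve_neg]
      convert h1 using 1
      group
    have h3 := hΨ.eq_zero_of_curve_mem hl.isClosed hφ hY h2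
    have h4 : u * (c - 1) = 0 := by rw [mul_sub, mul_one, h3]
    exact sub_eq_zero.1 ((mul_eq_zero.1 h4).resolve_left hu0)
  have := inv_mem (hc t)
  rw [hc1, mul_one] at this
  convert this using 1
  change _ = (ψ.curve s * φ.curve t * (ψ.curve s)⁻¹ * (φ.curve t)⁻¹)⁻¹
  group

end Commutator

/-! ### Flags of derivatives of one-parameter morphisms -/

section Flags

open OneParameterMorphism

variable {p : ℕ} [Fact p.Prime] {m : ℕ} {G : Type*} [TopologicalSpace G]
  [ChartedSpace (Fin m → ℚ_[p]) G] [Group G]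

variable (p m G) in
/-- A one-parameter morphism with derivative `Y`, when there is one. -/
def oneParam (Y : Fin m → ℚ_[p]) : OneParameterMorphism p G :=
  Classical.epsilon fun φ => IsLocalOneParam p φ.curve Y

theorem isLocalOneParam_oneParam {Y : Fin m → ℚ_[p]} (hY : Y ∈ oneParameterDerivatives p m G) :
    IsLocalOneParam p (oneParam p m G Y).curve Y := by
  obtain ⟨φ, hφ⟩ := hY
  exact Classical.epsilon_spec (p := fun φ : OneParameterMorphism p G =>
    IsLocalOneParam p φ.curve Y) ⟨φ, hasDerivative_iff.1 hφ⟩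

theorem mem_oneParameterDerivatives {φ : OneParameterMorphism p G} {Y : Fin m → ℚ_[p]}
    (h : IsLocalOneParam p φ.curve Y) : (Y : LieAlg p m G) ∈ oneParameterDerivatives p m G :=
  ⟨φ, hasDerivative_iff.2 h⟩

/-- The span of a list of vectors. -/
def listSpan : List (Fin m → ℚ_[p]) → Submodule ℚ_[p] (Fin m → ℚ_[p])
  | [] => ⊥
  | Y :: L => listSpan L ⊔ Submodule.span ℚ_[p] {Y}

variable (G) in
/-- `X` acts on the flag of spans of the tails of the list by a strictly triangular matrix. -/
def ActsUnipotently (X : Fin m → ℚ_[p]) : List (Fin m → ℚ_[p]) → Prop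
  | [] => True
  | Y :: L => ad p m G X Y ∈ listSpan L ∧ ActsUnipotently X L

variable (G) in
/-- A list of linearly independent derivatives of one-parameter morphisms, each acting
unipotently on the subsequent ones. -/
def IsFlag : List (Fin m → ℚ_[p]) → Prop
  | [] => True
  | Y :: L => IsFlag L ∧ (Y : LieAlg p m G) ∈ oneParameterDerivatives p m G ∧ Y ∉ listSpan L ∧
      ActsUnipotently G Y L

theorem listSpan_le_cons (Y : Fin m → ℚ_[p]) (L) : listSpan L ≤ listSpan (Y :: L) := le_sup_left

theorem mem_listSpan_cons (Y : Fin m → ℚ_[p]) (L) : Y ∈ listSpan (Y :: L) :=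
  (le_sup_right : _ ≤ listSpan (Y :: L)) (Submodule.mem_span_singleton_self Y)

theorem ActsUnipotently.ad_mem {X : Fin m → ℚ_[p]} {L} (h : ActsUnipotently G X L) :
    ∀ W ∈ listSpan L, ad p m G X W ∈ listSpan L := by
  induction L with
  | nil =>
    intro W hW
    rw [listSpan, Submodule.mem_bot] at hW ⊢
    rw [hW, map_zero]
  | cons Y L ih =>
    change listSpan L ⊔ Submodule.span ℚ_[p] {Y} ≤
      (listSpan (Y :: L)).comap (ad p m G X : (Fin m → ℚ_[p]) →ₗ[ℚ_[p]] (Fin m → ℚ_[p]))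
    refine sup_le (fun W hW => listSpan_le_cons Y L (ih h.2 W hW)) ?_
    rw [Submodule.span_singleton_le_iff_mem]
    exact listSpan_le_cons Y L h.1

variable [LieGroup (model p m) ω G]

variable (p m G) in
theorem hasLieAlg_nil : HasLieAlg (p := p) (G := G) (m := m) [] ⊥ := by
  have : T2Space G := t2Space_of_lieGroup p m G
  refine ⟨⟨fun _ _ => trivial, fun φ l' h => ?_⟩, ?_, 0, fun _ => 1, ?_, rfl, ?_, ?_, ?_⟩
  · simp at h
  · simp [gen]
  · exact contMDiffAt_const
  · intro v _
    exact Subsingleton.elim _ _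
  · intro X
    simp [eq_comm]
  · intro U hU
    refine Eventually.of_forall fun g hg => ⟨0, mem_of_mem_nhds hU, Subtype.ext ?_⟩
    exact (Subgroup.mem_bot.1 hg).symm

/-- Extension by a one-parameter morphism which is transverse to `gen l` and acts on it
unipotently. -/
theorem HasLieAlg.cons {l : List (OneParameterMorphism p G)}
    {S : Submodule ℚ_[p] (Fin m → ℚ_[p])} (h : HasLieAlg l S) {φ : OneParameterMorphism p G}
    {Y : Fin m → ℚ_[p]} (hφ : IsLocalOneParam p φ.curve Y) (hY : Y ∉ S)
    (hc : ∀ t, Centralizes l (φ.curve t)) :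
    HasLieAlg (φ :: l) (S ⊔ Submodule.span ℚ_[p] {Y}) := by
  obtain ⟨d, Ψ, hΨ⟩ := h.exists_isLocalParam
  have hn := fun t => (hc t).mem_normalizer
  have h0 := fun t => hΨ.eq_zero_of_curve_mem h.isClosed hφ hY (t := t)
  have hmem := fun g => mem_gen_cons hn (g := g)
  refine ⟨⟨fun g hg => ?_, fun ψ l' hl => ?_⟩,
    isClosed_of_mem_iff hmem m h.isClosed hn h0, d + 1, hΨ.cons hmem h.isClosed hn hφ hY⟩
  · obtain ⟨n, hng, t, rfl⟩ := (hmem g).1 hg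
    refine ⟨(h.isUnipotentList.centralizes n hng).mul (hc t), fun s => ?_⟩
    have h1 := mul_mem hng ((Subgroup.mem_normalizer_iff.1 (hn s) _).1 (inv_mem hng))
    have h2 : φ.curve t * φ.curve s * (φ.curve t)⁻¹ = φ.curve s := by
      rw [← curve_add, ← curve_neg, ← curve_add]
      ring_nf
    have h3 : n * φ.curve t * φ.curve s * (n * φ.curve t)⁻¹ * (φ.curve s)⁻¹ =
        n * (φ.curve t * φ.curve s * (φ.curve t)⁻¹) * n⁻¹ * (φ.curve s)⁻¹ := by group
    rw [h3, h2]
    simpa only [mul_assoc] using h1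
  · rcases List.suffix_cons_iff.1 hl with heq | hl'
    · obtain ⟨rfl, rfl⟩ := List.cons_eq_cons.1 heq
      exact h0
    · exact h.isUnipotentList.pairwise ψ l' hl'

/-- The one-parameter morphisms of a flag generate a closed unipotent subgroup whose Lie algebra is
the span of the flag. For a flag `Y, Z, L` the induction uses the flags `L`, `Z, L` and `Y, L`, from
which `commutator_mem_gen` shows that the morphism of `Y` acts unipotently on that of `Z`. -/
theorem IsFlag.hasLieAlg (hG : IsWeaklyRegular p m G) {L : List (Fin m → ℚ_[p])}
    (hL : IsFlag G L) : HasLieAlg (L.map (oneParam p m G)) (listSpan L) := by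
  induction hn : L.length using Nat.strong_induction_on generalizing L with
  | _ n ih =>
    subst hn
    match L with
    | [] => exact hasLieAlg_nil p m G
    | [Y] =>
      obtain ⟨-, hYG, hYL, -⟩ := hL
      exact (hasLieAlg_nil p m G).cons (isLocalOneParam_oneParam hYG) hYL fun _ => trivial
    | Y :: Z :: L =>
      obtain ⟨hZL, hYG, hYZL, hYZ, hYL⟩ := hL
      have hZL' := hZL
      obtain ⟨hL, hZG, hZnL, hZaL⟩ := hZL'
      have hYnL : Y ∉ listSpan L := fun h => hYZL (listSpan_le_cons Z L h)
      have k0 := ih L.length (by simp) hL rfl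
      have k1 := ih (Z :: L).length (by simp) hZL rfl
      have k2 := ih (Y :: L).length (by simp) (L := Y :: L) ⟨hL, hYG, hYnL, hYL⟩ rfl
      refine k1.cons (isLocalOneParam_oneParam hYG) hYZL fun t => ⟨?_, fun s => ?_⟩
      · exact (k2.isUnipotentList.centralizes_curve t).1
      · exact commutator_mem_gen hG (isLocalOneParam_oneParam hYG) (isLocalOneParam_oneParam hZG)
          k0 k2 k1 hYnL hZnL (listSpan_le_cons Z L) (mem_listSpan_cons Z L) hYL.ad_mem hYZ s t

end Flags

/-! ### The lower central series -/

section LowerCentralSeries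

variable {p : ℕ} [Fact p.Prime] {m : ℕ} {G : Type*} [TopologicalSpace G]
  [ChartedSpace (Fin m → ℚ_[p]) G] [Group G]

variable (G) in
/-- The lower central series of a subspace stable under brackets, with `lcs n 0 = n`. It is defined
on subspaces, in terms of `ad`, so that different subalgebras can be compared. -/
def lcs (n : Submodule ℚ_[p] (Fin m → ℚ_[p])) : ℕ → Submodule ℚ_[p] (Fin m → ℚ_[p])
  | 0 => n
  | k + 1 => Submodule.span ℚ_[p] {Z | ∃ X ∈ n, ∃ Y ∈ lcs n k, ad p m G X Y = Z}

variable {n n' : Submodule ℚ_[p] (Fin m → ℚ_[p])}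

theorem ad_mem_lcs_succ {X Y : Fin m → ℚ_[p]} (hX : X ∈ n) {k : ℕ} (hY : Y ∈ lcs G n k) :
    ad p m G X Y ∈ lcs G n (k + 1) :=
  Submodule.subset_span ⟨X, hX, Y, hY, rfl⟩

theorem lcs_mono (h : n' ≤ n) (k : ℕ) : lcs G n' k ≤ lcs G n k := by
  induction k with
  | zero => exact h
  | succ k ih =>
    refine Submodule.span_le.2 ?_
    rintro _ ⟨X, hX, Y, hY, rfl⟩
    exact ad_mem_lcs_succ (h hX) (ih hY)

theorem lcs_succ_le (hn : ∀ X ∈ n, ∀ Y ∈ n, ad p m G X Y ∈ n) (k : ℕ) :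
    lcs G n (k + 1) ≤ lcs G n k := by
  induction k with
  | zero =>
    refine Submodule.span_le.2 ?_
    rintro _ ⟨X, hX, Y, hY, rfl⟩
    exact hn X hX Y hY
  | succ k ih =>
    refine Submodule.span_le.2 ?_
    rintro _ ⟨X, hX, Y, hY, rfl⟩
    exact ad_mem_lcs_succ hX (ih hY)

theorem lcs_le (hn : ∀ X ∈ n, ∀ Y ∈ n, ad p m G X Y ∈ n) (k : ℕ) : lcs G n k ≤ n :=
  (antitone_nat_of_succ_le (lcs_succ_le hn)) (Nat.zero_le k)

variable [LieGroup (model p m) ω G]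

theorem ad_self (X : Fin m → ℚ_[p]) : ad p m G X X = 0 :=
  (ad_apply (G := G) X X).trans (lie_self (L := LieAlg p m G) X)

theorem ad_swap (X Y : Fin m → ℚ_[p]) : ad p m G X Y = -ad p m G Y X :=
  (ad_apply (G := G) X Y).trans ((lie_skew (L := LieAlg p m G) X Y).symm.trans
    (congrArg Neg.neg (ad_apply (G := G) Y X).symm))

/-- A nilpotent Lie algebra generated by one vector modulo its derived algebra is abelian. -/
theorem lcs_one_eq_bot (hn : ∀ X ∈ n, ∀ Y ∈ n, ad p m G X Y ∈ n) {k : ℕ} (hk : lcs G n k = ⊥)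
    {Y : Fin m → ℚ_[p]} (hY : Y ∈ n) (hle : n ≤ Submodule.span ℚ_[p] {Y} ⊔ lcs G n 1) :
    lcs G n 1 = ⊥ := by
  have h1 : lcs G n 1 ≤ lcs G n 2 := by
    refine Submodule.span_le.2 ?_
    rintro _ ⟨X, hX, Z, hZ, rfl⟩
    obtain ⟨_, hA, c, hc, rfl⟩ := Submodule.mem_sup.1 (hle hX)
    obtain ⟨_, hB, c', hc', rfl⟩ := Submodule.mem_sup.1 (hle hZ)
    obtain ⟨a, rfl⟩ := Submodule.mem_span_singleton.1 hA
    obtain ⟨b, rfl⟩ := Submodule.mem_span_singleton.1 hB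
    have k1 : ad p m G (a • Y + c) c' ∈ lcs G n 2 := ad_mem_lcs_succ hX hc'
    have k2 : ad p m G (b • Y) c ∈ lcs G n 2 := ad_mem_lcs_succ (n.smul_mem _ hY) hc
    have k3 : ad p m G (a • Y) (b • Y) = 0 := by
      have := ad_self (G := G) Y
      rw [map_smul, ad_swap, map_smul, this]
      simp
    have e : ad p m G (a • Y + c) (b • Y + c') =
        ad p m G (a • Y + c) c' - ad p m G (b • Y) c := by
      rw [map_add, ad_swap (a • Y + c) (b • Y), map_add, ad_swap (b • Y) (a • Y), k3]
      abel
    rw [SetLike.mem_coe, e]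
    exact Submodule.sub_mem _ k1 k2
  have h2 : ∀ j, lcs G n (j + 1) ≤ lcs G n (j + 2) := by
    intro j
    induction j with
    | zero => exact h1
    | succ j ih =>
      refine Submodule.span_le.2 ?_
      rintro _ ⟨X, hX, Z, hZ, rfl⟩
      exact ad_mem_lcs_succ hX (ih hZ)
  have h3 : Monotone fun j => lcs G n (j + 1) := monotone_nat_of_le_succ h2
  rw [eq_bot_iff]
  refine (h3 (Nat.zero_le k)).trans ?_
  rw [← hk]
  exact lcs_succ_le hn k

end LowerCentralSeries

/-! ### Existence of a flag -/

section Main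

open OneParameterMorphism

variable {p : ℕ} [Fact p.Prime] {m : ℕ} {G : Type*} [TopologicalSpace G]
  [ChartedSpace (Fin m → ℚ_[p]) G] [Group G] [LieGroup (model p m) ω G]

theorem HasLieAlg.mem_oneParameterDerivatives {l : List (OneParameterMorphism p G)}
    {S : Submodule ℚ_[p] (Fin m → ℚ_[p])} (h : HasLieAlg l S) {X : Fin m → ℚ_[p]} (hX : X ∈ S) :
    (X : LieAlg p m G) ∈ oneParameterDerivatives p m G := by
  obtain ⟨F, -, hF⟩ := h.exists_oneParameterMorphism_of_mem hX
  exact PadicLie.mem_oneParameterDerivatives hF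

theorem Ad_mem_oneParameterDerivatives {Y : Fin m → ℚ_[p]}
    (hY : (Y : LieAlg p m G) ∈ oneParameterDerivatives p m G) (g : G) :
    (Ad g Y : LieAlg p m G) ∈ oneParameterDerivatives p m G := by
  have : IsTopologicalGroup G := topologicalGroup_of_lieGroup (model p m) ω
  have h : IsLocalOneParam p ((oneParam p m G Y).conj g).curve (Ad g Y) :=
    (isLocalOneParam_oneParam hY).conj g
  exact PadicLie.mem_oneParameterDerivatives h

/-- If the derivatives of one-parameter morphisms lying in `n` are stable under `n`, they are
spanned by a flag. -/
theorem exists_isFlag_of_ad_mem (hG : IsWeaklyRegular p m G)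
    {n : Submodule ℚ_[p] (Fin m → ℚ_[p])} {k : ℕ} (hk : lcs G n k = ⊥)
    (hn : ∀ X ∈ n, ∀ Y ∈ n, ad p m G X Y ∈ n)
    (had : ∀ X ∈ n, ∀ Y ∈ n, (Y : LieAlg p m G) ∈ oneParameterDerivatives p m G →
      (ad p m G X Y : LieAlg p m G) ∈ oneParameterDerivatives p m G) :
    ∃ L, IsFlag G L ∧ (∀ X ∈ n, ActsUnipotently G X L) ∧
      ∀ Y, Y ∈ listSpan L ↔ Y ∈ n ∧ (Y : LieAlg p m G) ∈ oneParameterDerivatives p m G := by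
  -- a flag of maximal span
  obtain ⟨S, ⟨L, hL, hLn, hLa, rfl⟩, hmax⟩ :=
    (wellFounded_gt (α := Submodule ℚ_[p] (Fin m → ℚ_[p]))).has_min
    {S | ∃ L, IsFlag G L ∧ listSpan L ≤ n ∧ (∀ X ∈ n, ActsUnipotently G X L) ∧ listSpan L = S}
    ⟨⊥, [], trivial, bot_le, fun _ _ => trivial, rfl⟩
  refine ⟨L, hL, hLa, fun Y => ⟨fun hY =>
    ⟨hLn hY, (hL.hasLieAlg hG).mem_oneParameterDerivatives hY⟩, fun hY => ?_⟩⟩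
  -- descending induction along the lower central series
  suffices h : ∀ j, ∀ Y ∈ lcs G n j, (Y : LieAlg p m G) ∈ oneParameterDerivatives p m G →
      Y ∈ listSpan L from h 0 Y hY.1 hY.2
  intro j
  by_cases hj : k ≤ j
  · intro Y hY _
    have : Y ∈ lcs G n k := antitone_nat_of_succ_le (lcs_succ_le hn) hj hY
    rw [hk, Submodule.mem_bot] at this
    rw [this]
    exact Submodule.zero_mem _
  · induction hi : k - j generalizing j with
    | zero => omega
    | succ i ih =>
      intro Y hY hYG
      by_contra hYL
      have hYn := lcs_le hn j hY
      have hnext : ∀ X ∈ n, ad p m G X Y ∈ listSpan L := fun X hX => by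
        have h1 := ad_mem_lcs_succ hX hY
        have h2 := had X hX Y hYn hYG
        by_cases hj' : k ≤ j + 1
        · have : ad p m G X Y ∈ lcs G n k := antitone_nat_of_succ_le (lcs_succ_le hn) hj' h1
          rw [hk, Submodule.mem_bot] at this
          rw [this]
          exact Submodule.zero_mem _
        · exact ih (j + 1) hj' (by omega) _ h1 h2
      -- `Y` could be added to the flag
      refine hmax (listSpan (Y :: L)) ⟨Y :: L, ⟨hL, hYG, hYL, hLa Y hYn⟩, ?_,
        fun X hX => ⟨hnext X hX, hLa X hX⟩, rfl⟩ ?_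
      · exact sup_le hLn ((Submodule.span_singleton_le_iff_mem _ _).2 hYn)
      · exact lt_of_le_of_ne (listSpan_le_cons Y L) fun h => hYL (h ▸ mem_listSpan_cons Y L)

/-- For a nilpotent Lie algebra `n`, the derivatives of one-parameter morphisms that lie in `n` are
spanned by a flag, on which `n` acts unipotently. -/
theorem exists_isFlag (hG : IsWeaklyRegular p m G) {n : Submodule ℚ_[p] (Fin m → ℚ_[p])} {k : ℕ}
    (hk : lcs G n k = ⊥) (hn : ∀ X ∈ n, ∀ Y ∈ n, ad p m G X Y ∈ n) :
    ∃ L, IsFlag G L ∧ (∀ X ∈ n, ActsUnipotently G X L) ∧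
      ∀ Y, Y ∈ listSpan L ↔ Y ∈ n ∧ (Y : LieAlg p m G) ∈ oneParameterDerivatives p m G := by
  induction hr : Module.finrank ℚ_[p] n using Nat.strong_induction_on generalizing n with
  | _ r ih =>
    subst hr
    refine exists_isFlag_of_ad_mem hG hk hn fun X hX Y hY hYG => ?_
    set n' := Submodule.span ℚ_[p] {Y} ⊔ lcs G n 1
    have hn'n : n' ≤ n := sup_le ((Submodule.span_singleton_le_iff_mem _ _).2 hY) (lcs_le hn 1)
    have hn' : ∀ X ∈ n', ∀ Y ∈ n', ad p m G X Y ∈ n' := fun A hA B hB =>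
      (le_sup_right : _ ≤ n') (ad_mem_lcs_succ (hn'n hA) (k := 0) (hn'n hB))
    have hXY : ad p m G X Y ∈ lcs G n 1 := ad_mem_lcs_succ hX (k := 0) hY
    rcases hn'n.eq_or_lt with heq | hlt
    · -- here `n` is abelian, and `0` is the derivative of the trivial morphism
      rw [lcs_one_eq_bot hn hk hY heq.ge, Submodule.mem_bot] at hXY
      rw [hXY]
      exact (hasLieAlg_nil p m G).mem_oneParameterDerivatives (Submodule.zero_mem _)
    · obtain ⟨L, -, -, hL⟩ := ih _ (Submodule.finrank_lt_finrank_of_lt hlt)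
        (eq_bot_iff.2 ((lcs_mono hn'n k).trans hk.le)) hn' rfl
      obtain ⟨γ, hγ, -⟩ := exists_analytic_isLocalOneParam G X
      refine ((hL _).1 (hγ.ad_mem_of_eventually (listSpan L) ?_)).2
      filter_upwards [hγ.eventually_Ad_sub_mem (lcs G n 1)
        (fun W hW => lcs_succ_le hn 1 (ad_mem_lcs_succ hX hW)) hXY] with t ht
      refine (hL _).2 ⟨?_, Ad_mem_oneParameterDerivatives hYG _⟩
      have h1 : Y ∈ n' := (le_sup_left : _ ≤ n') (Submodule.mem_span_singleton_self Y)
      have h2 : Ad (γ t) Y - Y ∈ n' := (le_sup_right : _ ≤ n') ht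
      simpa using n'.add_mem h2 h1

end Main

/-! ### Bijectivity of the logarithm -/

section Log

open OneParameterMorphism

variable {p : ℕ} [Fact p.Prime] {m : ℕ} {G : Type*} [TopologicalSpace G]
  [ChartedSpace (Fin m → ℚ_[p]) G] [Group G]

theorem IsLocalOneParam.isLog {F : OneParameterMorphism p G} {X : Fin m → ℚ_[p]}
    (h : IsLocalOneParam p F.curve X) : IsLog p m (F.curve 1) (X : LieAlg p m G) := by
  let γ : Multiplicative ℤ_[p] →ₜ* G :=
    { toFun := fun z => F.curve (z.toAdd : ℚ_[p])
      map_one' := by simp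
      map_mul' := fun z w => by
        rw [toAdd_mul, PadicInt.coe_add, curve_add]
      continuous_toFun := F.continuous_curve.comp
        (continuous_subtype_val.comp continuous_toAdd) }
  refine ⟨γ, congrArg F.curve PadicInt.coe_one, (h.congr ?_).hasDerivativeAtZero⟩
  filter_upwards [Metric.closedBall_mem_nhds (0 : ℚ_[p]) one_pos] with t ht
  rw [dif_pos (mem_closedBall_zero_iff.1 ht)]
  rfl

variable [LieGroup (model p m) ω G]

theorem HasUniqueRoots.exists_isLocalOneParam_extension (hG : HasUniqueRoots p (⊤ : Subgroup G))
    {γ : ℚ_[p] → G} {X : Fin m → ℚ_[p]} (hγ : IsLocalOneParam p γ X) {δ : ℝ} (hδ : 0 < δ)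
    (hadd : ∀ s t, ‖s‖ ≤ δ → ‖t‖ ≤ δ → γ (s + t) = γ s * γ t) :
    ∃ F : OneParameterMorphism p G, (∀ t, ‖t‖ ≤ δ → F.curve t = γ t) ∧
      IsLocalOneParam p F.curve X := by
  have : IsTopologicalGroup G := topologicalGroup_of_lieGroup (model p m) ω
  obtain ⟨F, -, hF⟩ := hG.exists_oneParameterMorphism hδ hadd hγ.continuousAt fun _ _ => trivial
  refine ⟨F, hF, hγ.congr ?_⟩
  filter_upwards [Metric.closedBall_mem_nhds (0 : ℚ_[p]) hδ] with t ht
  exact hF t (mem_closedBall_zero_iff.1 ht)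

theorem HasUniqueRoots.exists_isLocalOneParam (hG : HasUniqueRoots p (⊤ : Subgroup G))
    (X : Fin m → ℚ_[p]) : ∃ F : OneParameterMorphism p G, IsLocalOneParam p F.curve X := by
  obtain ⟨γ, hγ, -⟩ := exists_analytic_isLocalOneParam G X
  obtain ⟨δ, hδ, hadd⟩ := hγ.exists_hom
  obtain ⟨F, -, hF⟩ := hG.exists_isLocalOneParam_extension hγ hδ hadd
  exact ⟨F, hF⟩

/-- Groups with unique `p`-th roots are weakly regular. -/
theorem HasUniqueRoots.curve_eq (hG : HasUniqueRoots p (⊤ : Subgroup G)) {X : Fin m → ℚ_[p]}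
    {F F' : OneParameterMorphism p G} (hF : IsLocalOneParam p F.curve X)
    (hF' : IsLocalOneParam p F'.curve X) (t : ℚ_[p]) : F.curve t = F'.curve t := by
  obtain ⟨k, hk⟩ := ((tendsto_pow_mul_zero p t).eventually (hF.eventuallyEq hF')).exists
  refine (hG.pow k).eq_of_pow_eq trivial trivial ?_
  rw [← curve_natCast_mul, ← curve_natCast_mul]
  exact_mod_cast hk

/-- An element that admits a logarithm is on a one-parameter morphism: `g ^ (p ^ k)` is so, being
close to the identity, and `p ^ k`-th roots are unique. -/
theorem HasUniqueRoots.exists_curve_one_eq (hG : HasUniqueRoots p (⊤ : Subgroup G)) {g : G}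
    (hg : AdmitsLog p g) : ∃ (F : OneParameterMorphism p G) (X : Fin m → ℚ_[p]),
      F.curve 1 = g ∧ IsLocalOneParam p F.curve X := by
  have : IsTopologicalGroup G := topologicalGroup_of_lieGroup (model p m) ω
  have hp : (p : ℚ_[p]) ≠ 0 := by exact_mod_cast (Fact.out : p.Prime).ne_zero
  obtain ⟨k, γ, X, hγ, hγ1, hadd⟩ := (hg.eventually
    (eventually_exists_isLocalOneParam p m G)).exists
  obtain ⟨F, hF, hFX⟩ := hG.exists_isLocalOneParam_extension hγ one_pos hadd
  set c : ℚ_[p] := ((p : ℚ_[p]) ^ k)⁻¹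
  have hc : Continuous fun t : ℚ_[p] => F.curve (t * c) := F.continuous_curve.comp (by fun_prop)
  set F' : OneParameterMorphism p G :=
    ofCurve (fun t => F.curve (t * c)) (fun s t => by rw [add_mul, curve_add]) hc.continuousAt
  have hder : HasDerivAt (fun t => coord p m (F'.curve t)) (c • X) 0 := by
    have k2 : HasDerivAt (fun t : ℚ_[p] => t * c) c 0 := by
      have := (hasDerivAt_id (0 : ℚ_[p])).mul_const c
      rw [one_mul] at this
      exact this
    exact HasDerivAt.scomp (g₁ := fun t => coord p m (F.curve t)) (0 : ℚ_[p])
      (by simpa using hFX.hasDerivAt) k2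
  refine ⟨F', c • X, ?_, F'.continuous_curve.continuousAt, hder, 1, one_pos,
    fun s t _ _ => F'.curve_add s t⟩
  refine (hG.pow k).eq_of_pow_eq trivial trivial ?_
  rw [← hγ1, ← hF 1 (by simp), curve_ofCurve, ← curve_natCast_mul]
  have hpk : (p : ℚ_[p]) ^ k ≠ 0 := pow_ne_zero _ hp
  simp [c, hpk]

theorem IsLog.unique {g : G} {X Y : LieAlg p m G} (hX : IsLog p m g X) (hY : IsLog p m g Y) :
    X = Y := by
  have : T2Space G := t2Space_of_lieGroup p m G
  obtain ⟨γ, hγ, hX⟩ := hX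
  obtain ⟨γ', hγ', hY⟩ := hY
  have heq : γ = γ' := by
    refine ContinuousMonoidHom.ext fun z => ?_
    refine PadicInt.denseRange_natCast.induction_on
      (p := fun z : ℤ_[p] => γ (Multiplicative.ofAdd z) = γ' (Multiplicative.ofAdd z)) z.toAdd
      (isClosed_eq ?_ ?_) fun k => ?_
    · exact γ.continuous_toFun.comp continuous_ofAdd
    · exact γ'.continuous_toFun.comp continuous_ofAdd
    · have e : Multiplicative.ofAdd (k : ℤ_[p]) = Multiplicative.ofAdd (1 : ℤ_[p]) ^ k := by
        rw [← ofAdd_nsmul, nsmul_one]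
      rw [e, map_pow, map_pow, hγ, hγ']
  subst heq
  exact ((hasDerivativeAtZero_iff p m).1 hX).2.2.unique ((hasDerivativeAtZero_iff p m).1 hY).2.2

theorem HasUniqueRoots.bijective_log (hG : HasUniqueRoots p (⊤ : Subgroup G))
    (hlog : ∀ g : G, AdmitsLog p g) : Function.Bijective (log p m : G → LieAlg p m G) := by
  have hspec : ∀ g : G, ∃ F : OneParameterMorphism p G, F.curve 1 = g ∧
      IsLocalOneParam p F.curve (log p m g : Fin m → ℚ_[p]) := fun g => by
    obtain ⟨F, X, rfl, hF⟩ := hG.exists_curve_one_eq (m := m) (hlog g)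
    have h1 : IsLog p m (F.curve 1) (log p m (F.curve 1)) :=
      Classical.epsilon_spec (p := fun X : LieAlg p m G => IsLog p m (F.curve 1) X) ⟨_, hF.isLog⟩
    exact ⟨F, rfl, by rwa [h1.unique hF.isLog]⟩
  constructor
  · intro g g' h
    obtain ⟨F, rfl, hF⟩ := hspec g
    obtain ⟨F', rfl, hF'⟩ := hspec g'
    rw [← h] at hF'
    exact hG.curve_eq hF hF' 1
  · intro X
    obtain ⟨F, hF⟩ := hG.exists_isLocalOneParam (m := m) X
    refine ⟨F.curve 1, ?_⟩
    have h1 : IsLog p m (F.curve 1) (log p m (F.curve 1)) :=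
      Classical.epsilon_spec (p := fun X : LieAlg p m G => IsLog p m (F.curve 1) X) ⟨_, hF.isLog⟩
    exact h1.unique hF.isLog

end Log

/-! ### The algebraic unipotent subgroup -/

section Final

variable {p : ℕ} [Fact p.Prime] {m : ℕ} {G : Type*} [TopologicalSpace G]
  [ChartedSpace (Fin m → ℚ_[p]) G] [Group G] [LieGroup (model p m) ω G]

/-- Nilpotency of the Lie subalgebra, in terms of `lcs`. -/
theorem exists_lcs_eq_bot (𝔫 : LieSubalgebra ℚ_[p] (LieAlg p m G)) (h𝔫 : LieRing.IsNilpotent 𝔫)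
    (n : Submodule ℚ_[p] (Fin m → ℚ_[p])) (hn : ∀ X : LieAlg p m G, X ∈ n ↔ X ∈ 𝔫) :
    ∃ k, lcs G n k = ⊥ := by
  obtain ⟨k, hk⟩ := (LieModule.isNilpotent_iff ℚ_[p] 𝔫 𝔫).1 h𝔫
  refine ⟨k, eq_bot_iff.2 ?_⟩
  have key : ∀ j, ∀ X ∈ lcs G n j, ∃ Y ∈ LieModule.lowerCentralSeries ℚ_[p] 𝔫 𝔫 j,
      ((Y : LieAlg p m G) : Fin m → ℚ_[p]) = X := by
    intro j
    induction j with
    | zero =>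
      intro X hX
      exact ⟨⟨X, (hn X).1 hX⟩, LieSubmodule.mem_top _, rfl⟩
    | succ j ih =>
      intro X hX
      induction hX using Submodule.span_induction with
      | mem X hX =>
        obtain ⟨A, hA, B, hB, rfl⟩ := hX
        obtain ⟨C, hC, rfl⟩ := ih B hB
        refine ⟨⁅(⟨A, (hn A).1 hA⟩ : 𝔫), C⁆, ?_, (ad_apply (G := G) A C).symm⟩
        rw [LieModule.lowerCentralSeries_succ]
        exact LieSubmodule.lie_mem_lie (LieSubmodule.mem_top _) hC
      | zero => exact ⟨0, zero_mem _, rfl⟩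
      | add X Y _ _ hX hY =>
        obtain ⟨A, hA, rfl⟩ := hX
        obtain ⟨B, hB, rfl⟩ := hY
        exact ⟨A + B, add_mem hA hB, rfl⟩
      | smul c X _ hX =>
        obtain ⟨A, hA, rfl⟩ := hX
        exact ⟨c • A, SMulMemClass.smul_mem c hA, rfl⟩
  intro X hX
  obtain ⟨Y, hY, rfl⟩ := key k X hX
  rw [hk, LieSubmodule.mem_bot] at hY
  rw [hY]
  exact Submodule.zero_mem _

/-- A unipotent list with Lie algebra inside a nilpotent one generates an algebraic unipotent
subgroup; its Lie algebra is nilpotent since it embeds into `𝔫`. -/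
theorem HasLieAlg.isAlgebraicUnipotentSubgroup {l : List (OneParameterMorphism p G)}
    {S : Submodule ℚ_[p] (Fin m → ℚ_[p])} (h : HasLieAlg l S)
    (𝔫 : LieSubalgebra ℚ_[p] (LieAlg p m G)) (h𝔫 : LieRing.IsNilpotent 𝔫)
    (hS : ∀ X : LieAlg p m G, X ∈ S → X ∈ 𝔫) :
    IsAlgebraicUnipotentSubgroup (m := m) p (gen l) (S : Set (Fin m → ℚ_[p])) := by
  obtain ⟨d, Ψ, hΨ⟩ := h.exists_isLocalParam
  obtain ⟨hch, hL, D, hDS, hD, hD0, hDmem⟩ := hΨ.exists_isLieSubgroup h.isClosed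
  have := hL.lieGroup
  have hlog : ∀ g : gen l, AdmitsLog p g := fun g =>
    Topology.IsInducing.subtypeVal.tendsto_nhds_iff.2 (h.isUnipotentList.admitsLog (m := m) g.2)
  have hroots : HasUniqueRoots p (⊤ : Subgroup (gen l)) := fun x _ => by
    obtain ⟨y, ⟨hy, e⟩, hu⟩ := h.isUnipotentList.hasUniqueRoots x x.2
    exact ⟨⟨y, hy⟩, ⟨trivial, Subtype.ext e⟩,
      fun z hz => Subtype.ext (hu z ⟨z.2, congrArg Subtype.val hz.2⟩)⟩
  refine ⟨d, hch, hL, ⟨?_, hlog, hroots.bijective_log hlog⟩, hDS⟩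
  let f : LieAlg p d (gen l) →ₗ⁅ℚ_[p]⁆ 𝔫 :=
      { toFun := fun v => ⟨D v, hS _ ((hDmem _).2 ⟨v, rfl⟩)⟩
        map_add' := fun v w => Subtype.ext (map_add D v w)
        map_smul' := fun c v => Subtype.ext (map_smul D c v)
        map_lie' := fun {v w} => Subtype.ext (by
          have h1 := map_ad (f := (gen l).subtype) continuous_subtype_val hD v w
          have h2 := congrArg D (ad_apply (G := gen l) v w)
          exact h2.symm.trans (h1.trans (ad_apply (G := G) (D v) (D w)))) }
  have hf : Function.Injective f :=
    (injective_iff_map_eq_zero f).2 fun v hv => hD0 v (congrArg Subtype.val hv)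
  exact hf.lieAlgebra_isNilpotent

end Final

end PadicLie

end

open PadicLie in
theorem proposition2p5 (p : ℕ) [Fact p.Prime] (m : ℕ) (G : Type*) [Group G] [TopologicalSpace G]
    [ChartedSpace (Fin m → ℚ_[p]) G] [LieGroup (PadicLie.model p m) ω G]
    (hG : PadicLie.IsWeaklyRegular p m G)
    (𝔫 : LieSubalgebra ℚ_[p] (PadicLie.LieAlg p m G)) (h𝔫 : LieRing.IsNilpotent 𝔫) :
    (∃ J : LieIdeal ℚ_[p] 𝔫,
      ∀ X : 𝔫, X ∈ J ↔ (X : PadicLie.LieAlg p m G) ∈ PadicLie.oneParameterDerivatives p m G) ∧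
    ∃ N : Subgroup G, PadicLie.IsAlgebraicUnipotentSubgroup p N
      ((𝔫 : Set (PadicLie.LieAlg p m G)) ∩ PadicLie.oneParameterDerivatives p m G) := by
  let n : Submodule ℚ_[p] (Fin m → ℚ_[p]) :=
    { carrier := {X | (X : LieAlg p m G) ∈ 𝔫}
      add_mem' := fun {_ _} h h' => 𝔫.add_mem h h'
      zero_mem' := 𝔫.zero_mem
      smul_mem' := fun c _ h => 𝔫.smul_mem c h }
  have hn : ∀ X ∈ n, ∀ Y ∈ n, ad p m G X Y ∈ n := fun X hX Y hY => by
    have := 𝔫.lie_mem (x := (X : LieAlg p m G)) (y := (Y : LieAlg p m G)) hX hY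
    have e : ad p m G X Y = _ := ad_apply (G := G) X Y
    change (ad p m G X Y : LieAlg p m G) ∈ 𝔫
    rw [e]
    exact this
  obtain ⟨k, hk⟩ := exists_lcs_eq_bot 𝔫 h𝔫 n fun _ => Iff.rfl
  obtain ⟨L, hL, hLa, hmem⟩ := exists_isFlag hG hk hn
  refine ⟨⟨{ carrier := {X | ((X : LieAlg p m G) : Fin m → ℚ_[p]) ∈ listSpan L}
             add_mem' := fun {_ _} h h' => (listSpan L).add_mem h h'
             zero_mem' := (listSpan L).zero_mem
             smul_mem' := fun c _ h => (listSpan L).smul_mem c h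
             lie_mem := fun {X Y} hY => ?_ }, fun X => ?_⟩,
    gen (L.map (oneParam p m G)), ?_⟩
  · have h1 := (hLa (X : LieAlg p m G) X.2).ad_mem _ hY
    have h2 := ad_apply (G := G) (X : LieAlg p m G) (Y : LieAlg p m G)
    rw [h2] at h1
    exact h1
  · exact (hmem (X : LieAlg p m G)).trans ⟨fun h => h.2, fun h => ⟨X.2, h⟩⟩
  · have h1 := (hL.hasLieAlg hG).isAlgebraicUnipotentSubgroup 𝔫 h𝔫
      fun X hX => ((hmem X).1 hX).1
    have h2 : ((listSpan L : Submodule ℚ_[p] (Fin m → ℚ_[p])) : Set (Fin m → ℚ_[p])) =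
        (𝔫 : Set (LieAlg p m G)) ∩ oneParameterDerivatives p m G := Set.ext hmem
    rwa [h2] at h1
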